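/- Let $k\ge 1$. For $i=1,\dots,k$ let $(X_i,\mu_i)$ be a non-atomic Lebesgue probability space (a standard Borel space with a non-atomic probability measure) and let $\{T_i^z\}_{z\in\mathbb Z^2}$ be a $\mathbb Z^2$-action by automorphisms (invertible measure-preserving transformations) of $(X_i,\mu_i)$, i.e. $T_i^{z}T_i^{z'}=T_i^{z+z'}$. To an automorphism $S$ of a probability space $(Y,\nu)$ corresponds the operator $(\hat Sf)(y)=f(Sy)$ on the complex space $L_2(Y,\nu)$. Let $I$ be the identity operator, $\Theta$ the orthogonal projection onto the constants, and $L_2^0(Y,\nu)=L_2(Y,\nu)\ominus\{\mathrm{const}\}$. A $\mathbb Z^2$-action $\{S^z\}$ is totally ergodic if $S^z$ is ergodic for every $z\ne 0$. A closed subspace $C$ is cyclic if it is the closed linear span of $\{\hat S^zh: z\in\mathbb Z^2\}$ for some vector $h$. The symmetric square $\hat T_i\odot\hat T_i$ is the restriction of $\{\hat T_i^z\otimes\hat T_i^z\}$ to the functions $F\in L_2(X_i\times X_i,\mu_i\times\mu_i)$ with $F(x,y)=F(y,x)$; it has simple spectrum if the space of such functions orthogonal to the constants is cyclic. The restriction of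 an action to an invariant closed subspace $K$ has homogeneous spectrum of multiplicity $n\in\{1,2,\dots,\infty\}$ if $K$ is an orthogonal sum of $n$ cyclic subspaces on which the restrictions of the action are unitarily isomorphic to each other. The set of spectral multiplicities of $\{S^z\}$ is the set of essential values of the multiplicity function of $\{\hat S^z\}$ on $L_2^0(Y,\nu)$; that is, $n$ belongs to it if and only if there is a nonzero closed invariant subspace $K\subseteq L_2^0(Y,\nu)$ on which the action has homogeneous spectrum of multiplicity $n$ and such that there is no nonzero bounded operator $K\to L_2^0(Y,\nu)\ominus K$ intertwining the two restrictions of the action. **Theorem.** Suppose that the action $$\{(\hat T_1^z\otimes\hat T_1^z)\otimes\dots\otimes(\hat T_k^z\otimes\hat T_k^z)\}_{z\in\mathbb Z^2},$$ that is, the diagonal action $(T_1^z\times T_1^z)\times\dots\times(T_k^z\times T_k^z)$ on $\prod_{i=1}^k(X_i\times X_i)$ with the product measure, is totally ergodic, and that 1. each of the symmetric squares $\hat T_1\odot\hat T_1,\dots,\hat T_k\odot\hat T_k$ has simple spectrum; 2. for each $i\in\{1,\dots,k\}$ there are sequences $w_n^i,u_n^i\in\mathbb Z^2$ and real numbers $a_j^i,b_j^i>0$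 ($1\le j\le k$) such that, in the weak operator topology as $n\to\infty$, $$\hat T_i^{w_n^i}\to a_i^i\hat T_i^{(1,0)}+(1-a_i^i)\Theta,\qquad \hat T_j^{w_n^i}\to a_j^iI+(1-a_j^i)\Theta\quad(j\ne i),$$ $$\hat T_i^{u_n^i}\to b_i^i\hat T_i^{(0,1)}+(1-b_i^i)\Theta,\qquad \hat T_j^{u_n^i}\to b_j^iI+(1-b_j^i)\Theta\quad(j\ne i).$$ Then the set of spectral multiplicities of this action is exactly $\{2,4,8,\dots,2^k\}$. -/

import Mathlib

open MeasureTheory Filter Topology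

/-- A `ℤ²`-action by automorphisms (invertible bi-measurable measure preserving maps) of the
measure space `(X, μ)`. -/
structure Z2Action (X : Type*) [MeasurableSpace X] (μ : Measure X) where
  /-- the automorphism `T^z` -/
  map : ℤ × ℤ → X ≃ᵐ X
  measurePreserving : ∀ z, MeasurePreserving (map z) μ μ
  map_add : ∀ z₁ z₂ x, map (z₁ + z₂) x = map z₁ (map z₂ x)

namespace Z2Action

noncomputable section

section basic

variable {X : Type*} [MeasurableSpace X] {μ : Measure X}

/-- The Koopman operator `(T̂^z f)(x) = f(T^z x)` on the complex space `L²(X, μ)`. -/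
def koopman (T : Z2Action X μ) (z : ℤ × ℤ) : Lp ℂ 2 μ →L[ℂ] Lp ℂ 2 μ :=
  (Lp.compMeasurePreservingₗᵢ ℂ (T.map z) (T.measurePreserving z)).toContinuousLinearMap

/-- Totally ergodic: every `T^z` with `z ≠ 0` is ergodic. -/
def TotallyErgodic (T : Z2Action X μ) : Prop :=
  ∀ z : ℤ × ℤ, z ≠ 0 → Ergodic (T.map z) μ

/-- The diagonal action `T^z × T^z` on `(X × X, μ × μ)`; its Koopman operators are
`T̂^z ⊗ T̂^z`. -/
def square [SFinite μ] (T : Z2Action X μ) : Z2Action (X × X) (μ.prod μ) where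
  map z := (T.map z).prodCongr (T.map z)
  measurePreserving z := (T.measurePreserving z).prod (T.measurePreserving z)
  map_add z₁ z₂ x := Prod.ext (T.map_add z₁ z₂ x.1) (T.map_add z₁ z₂ x.2)

end basic

/-- The diagonal action `S₁^z × ⋯ × S_k^z` on the product space; its Koopman operators are
`Ŝ₁^z ⊗ ⋯ ⊗ Ŝ_k^z`. -/
def pi {ι : Type*} [Fintype ι] {Y : ι → Type*} [∀ i, MeasurableSpace (Y i)]
    {ν : ∀ i, Measure (Y i)} [∀ i, SigmaFinite (ν i)] (S : ∀ i, Z2Action (Y i) (ν i)) :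
    Z2Action (∀ i, Y i) (Measure.pi ν) where
  map z := MeasurableEquiv.piCongrRight fun i => (S i).map z
  measurePreserving z := measurePreserving_pi ν ν fun i => (S i).measurePreserving z
  map_add z₁ z₂ x := funext fun i => (S i).map_add z₁ z₂ (x i)

end

end Z2Action

namespace L2

noncomputable section

variable {X : Type*} [MeasurableSpace X]

/-- The subspace of constants in `L²(X, μ)`. -/
def constants (μ : Measure X) [IsFiniteMeasure μ] : Submodule ℂ (Lp ℂ 2 μ) :=
  Submodule.span ℂ {Lp.const 2 μ (1 : ℂ)}

/-- The subspace `L²₀(X, μ) = L²(X, μ) ⊖ {const}`. -/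
def zeroMean (μ : Measure X) [IsFiniteMeasure μ] : Submodule ℂ (Lp ℂ 2 μ) :=
  (constants μ)ᗮ

instance (μ : Measure X) [IsFiniteMeasure μ] : (constants μ).HasOrthogonalProjection := by
  unfold constants; infer_instance

/-- The orthogonal projection `Θ` onto the constants. -/
def Theta (μ : Measure X) [IsFiniteMeasure μ] : Lp ℂ 2 μ →L[ℂ] Lp ℂ 2 μ :=
  (constants μ).starProjection

/-- The symmetric functions `F(x, y) = F(y, x)` in `L²(X × X, μ × μ)`,
i.e. `L²(X, μ) ⊙ L²(X, μ)`. -/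
def symmetric (μ : Measure X) [SFinite μ] : Submodule ℂ (Lp ℂ 2 (μ.prod μ)) :=
  LinearMap.eqLocus
    (Lp.compMeasurePreservingₗ ℂ Prod.swap (Measure.measurePreserving_swap (μ := μ) (ν := μ)))
    LinearMap.id

end

end L2

namespace Z2Spectral

noncomputable section

variable {H : Type*} [NormedAddCommGroup H] [InnerProductSpace ℂ H]

/-- Convergence of a sequence of operators in the weak operator topology. -/
def WeakLimit (A : ℕ → H →L[ℂ] H) (B : H →L[ℂ] H) : Prop :=
  ∀ f g : H, Tendsto (fun n => inner ℂ g (A n f)) atTop (𝓝 (inner ℂ g (B f)))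

/-- `C` is a cyclic subspace: the closed linear span of the orbit of some vector `h`. -/
def IsCyclicSubspace (U : ℤ × ℤ → H →L[ℂ] H) (C : Submodule ℂ H) : Prop :=
  ∃ h : H, (Submodule.span ℂ (Set.range fun z => U z h)).topologicalClosure = C

/-- A map `J` between (invariant) subspaces intertwines the restrictions of `U` to them. -/
def Intertwines (U : ℤ × ℤ → H →L[ℂ] H) {K L : Submodule ℂ H} (J : K → L) : Prop :=
  ∀ (z : ℤ × ℤ) (x : K) (hx : U z x ∈ K), (J ⟨U z x, hx⟩ : H) = U z (J x)

/-- The restrictions of `U` to `K` and `L` are unitarily isomorphic. -/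
def IsomorphicOn (U : ℤ × ℤ → H →L[ℂ] H) (K L : Submodule ℂ H) : Prop :=
  ∃ Φ : K ≃ₗᵢ[ℂ] L, Intertwines U Φ

/-- The restrictions of `U` to `K` and `L` are disjoint: there is no nonzero bounded
intertwining operator. -/
def DisjointOn (U : ℤ × ℤ → H →L[ℂ] H) (K L : Submodule ℂ H) : Prop :=
  ∀ J : K →L[ℂ] L, Intertwines U J → J = 0

/-- The restriction of `U` to `K` has homogeneous spectrum of multiplicity `n`
(`n = ⊤` means countably infinite): `K` is the orthogonal (Hilbert) sum of `n` cyclic subspaces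
on which the restrictions of `U` are isomorphic to each other. -/
def HomogeneousOn (U : ℤ × ℤ → H →L[ℂ] H) (K : Submodule ℂ H) (n : ℕ∞) : Prop :=
  ∃ C : {i : ℕ // (i : ℕ∞) < n} → Submodule ℂ H,
    (∀ i, IsCyclicSubspace U (C i)) ∧
    (∀ i j, i ≠ j → C i ⟂ C j) ∧
    (∀ i j, IsomorphicOn U (C i) (C j)) ∧
    (⨆ i, C i).topologicalClosure = K

/-- The set of spectral multiplicities (essential values of the multiplicity function) of the
unitary representation `U` on the closed invariant subspace `M`. A part `K` of `M` is disjoint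
from its complement in `M` exactly when it is the range of a spectral projection `E(B)`, and it
is nonzero and homogeneous of multiplicity `n` exactly when `B` has positive measure for the
maximal spectral type and the multiplicity function equals `n` almost everywhere on `B`. -/
def multiplicities (U : ℤ × ℤ → H →L[ℂ] H) (M : Submodule ℂ H) : Set ℕ∞ :=
  {n | ∃ K : Submodule ℂ H, K ≤ M ∧ K ≠ ⊥ ∧ DisjointOn U K (M ⊓ Kᗮ) ∧ HomogeneousOn U K n}

end

end Z2Spectral

namespace Z2Action

variable {X : Type*} [MeasurableSpace X] {μ : Measure X}

/-- The symmetric square `T̂ ⊙ T̂` has simple spectrum: the symmetric functions of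
`L²(X × X, μ × μ)` orthogonal to the constants form a cyclic subspace. -/
def SymmetricSquareSimple [IsFiniteMeasure μ] (T : Z2Action X μ) : Prop :=
  Z2Spectral.IsCyclicSubspace T.square.koopman (L2.symmetric μ ⊓ L2.zeroMean (μ.prod μ))

/-- The set of spectral multiplicities of the action, on `L²₀(X, μ)`. -/
def spectralMultiplicities [IsFiniteMeasure μ] (T : Z2Action X μ) : Set ℕ∞ :=
  Z2Spectral.multiplicities T.koopman (L2.zeroMean μ)

end Z2Action

/-!
By hypothesis 2 the weak closure of the product action contains the tensor product of the operators
`Pⱼ Qⱼ ⊗ Pⱼ Qⱼ`, where `Pⱼ = Θ + aⱼ (1 - Θ)`, `Qᵢ = T̂ᵢ^(1,0)` or `T̂ᵢ^(0,1)`, and `Qⱼ = 1` for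
`j ≠ i`. This is a polar decomposition: a positive invertible operator times a commuting unitary
one, namely `Qᵢ ⊗ Qᵢ` acting in the `i`-th factor alone. An operator commuting with the product
action commutes with the limit and with its adjoint, hence with the unitary part. So every factor
action commutes with the whole commutant.

The splitting of `L²` into sectors, indexed by the set `A` of factors in which a function has no
constant component, is therefore preserved by the commutant, and different sectors are disjoint.
In one factor, `T̂ ⊗ 1 - 1 ⊗ T̂` commutes with the action, exchanges symmetric and antisymmetric
functions, and has trivial kernel and cokernel off the constants, so its polar part makes the two
parts isomorphic. Hence the sector of `A` is an orthogonal sum of `2 ^ |A|` isomorphic cells, one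
for each choice of parities. The cell of even functions is cyclic: a closed invariant subspace is
invariant under every factor action, so the tensor product of cyclic vectors generates it.

Finally a multiplicity is determined by the subspace: a cyclic representation has a commutative
reduced commutant `R`, so a nilpotent operator commuting with `m` copies of it is a nilpotent
`m × m` matrix over `R` and has vanishing `m`-th power by Cayley–Hamilton, whereas `m + 1` copies
carry a shift.
-/

/-! ### The commutant of a unitary representation -/

namespace Z2Spectral

section CyclicVector

variable {H : Type*} [NormedAddCommGroup H] [InnerProductSpace ℂ H] [CompleteSpace H]
  {A : StarSubalgebra ℂ (H →L[ℂ] H)} [IsMulCommutative A] {h : H} {S T : H →L[ℂ] H}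

theorem norm_star_apply_sub_eq
    (hS : S ∈ StarSubalgebra.centralizer ℂ (A : Set (H →L[ℂ] H))) (hsa : IsSelfAdjoint S)
    {a : H →L[ℂ] H} (ha : a ∈ A) (x : H) : ‖star a x - S x‖ = ‖a x - S x‖ := by
  have hSA : ∀ b ∈ A, b * S = S * b := fun b hb =>
    ((StarSubalgebra.mem_centralizer_iff ℂ).1 hS b hb).1
  have hnormal : IsStarNormal (a - S) := by
    refine ⟨?_⟩
    rw [commute_iff_eq, star_sub, hsa.star_eq]
    simp only [sub_mul, mul_sub, hSA a ha, hSA _ (star_mem ha),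
      setLike_mul_comm ha (star_mem ha)]
    abel
  have hnorm := ContinuousLinearMap.isStarNormal_iff_norm_eq_adjoint.1 hnormal x
  rw [← ContinuousLinearMap.star_eq_adjoint, star_sub, hsa.star_eq] at hnorm
  exact hnorm.symm

theorem mul_comm_of_isSelfAdjoint_of_cyclic
    (hh : DenseRange fun a : A => (a : H →L[ℂ] H) h)
    (hS : S ∈ StarSubalgebra.centralizer ℂ (A : Set (H →L[ℂ] H))) (hsa : IsSelfAdjoint S)
    (hT : T ∈ StarSubalgebra.centralizer ℂ (A : Set (H →L[ℂ] H))) : S * T = T * S := by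
  have apply_comm : ∀ {B}, B ∈ StarSubalgebra.centralizer ℂ (A : Set (H →L[ℂ] H)) →
      ∀ a ∈ A, ∀ x, B (a x) = a (B x) := fun hB a ha x =>
    DFunLike.congr_fun ((StarSubalgebra.mem_centralizer_iff ℂ).1 hB a ha).1.symm x
  obtain ⟨v, hv, hlim⟩ := mem_closure_iff_seq_limit.1 (hh (S h))
  choose a hav using hv
  obtain rfl : (fun n => (a n : H →L[ℂ] H) h) = v := funext hav
  have hlim_star : Tendsto (fun n => star (a n : H →L[ℂ] H) h) atTop (𝓝 (S h)) := by
    rw [tendsto_iff_norm_sub_tendsto_zero] at hlim ⊢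
    exact hlim.congr fun n => (norm_star_apply_sub_eq hS hsa (a n).2 h).symm
  have hST : S (T h) = T (S h) := by
    refine hh.eq_of_inner_right ℂ fun b => ?_
    have hleft : Tendsto (fun n => inner ℂ (b.1 (star (a n : H →L[ℂ] H) h)) (T h)) atTop
        (𝓝 (inner ℂ (b.1 h) (S (T h)))) := by
      have hmove : inner ℂ (b.1 h) (S (T h)) = inner ℂ (b.1 (S h)) (T h) := by
        rw [← apply_comm hS b b.2, ← ContinuousLinearMap.adjoint_inner_left,
          ← ContinuousLinearMap.star_eq_adjoint, hsa.star_eq]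
      rw [hmove]
      exact ((b.1.continuous.tendsto _).comp hlim_star).inner tendsto_const_nhds
    have hright : Tendsto (fun n => inner ℂ (b.1 h) (T ((a n : H →L[ℂ] H) h))) atTop
        (𝓝 (inner ℂ (b.1 h) (T (S h)))) :=
      tendsto_const_nhds.inner ((T.continuous.tendsto _).comp hlim)
    refine tendsto_nhds_unique hleft (hright.congr fun n => ?_)
    rw [apply_comm hT _ (a n).2, ← ContinuousLinearMap.adjoint_inner_left,
      ← ContinuousLinearMap.star_eq_adjoint, ← mul_apply_eq_comp, ← mul_apply_eq_comp,
      setLike_mul_comm (star_mem (a n).2) b.2]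
  refine DFunLike.coe_injective (hh.equalizer (by fun_prop) (by fun_prop) (funext fun b => ?_))
  simp only [Function.comp_apply, mul_apply_eq_comp, apply_comm hS b b.2, apply_comm hT b b.2, hST]

theorem isMulCommutative_centralizer_of_cyclic
    (hh : DenseRange fun a : A => (a : H →L[ℂ] H) h) :
    IsMulCommutative (StarSubalgebra.centralizer ℂ (A : Set (H →L[ℂ] H))) := by
  refine .of_setLike_mul_comm fun S hS T hT => ?_
  have hre : (realPart S : H →L[ℂ] H) ∈ StarSubalgebra.centralizer ℂ (A : Set (H →L[ℂ] H)) := by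
    rw [realPart_apply_coe, ← algebraMap_smul ℂ (2⁻¹ : ℝ)]
    exact SMulMemClass.smul_mem _ (add_mem hS (star_mem hS))
  have him : (imaginaryPart S : H →L[ℂ] H) ∈
      StarSubalgebra.centralizer ℂ (A : Set (H →L[ℂ] H)) := by
    rw [imaginaryPart_apply_coe, ← algebraMap_smul ℂ (2⁻¹ : ℝ)]
    exact SMulMemClass.smul_mem _ (SMulMemClass.smul_mem _ (sub_mem hS (star_mem hS)))
  rw [← realPart_add_I_smul_imaginaryPart S, add_mul, mul_add, smul_mul_assoc, mul_smul_comm,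
    mul_comm_of_isSelfAdjoint_of_cyclic hh hre (realPart S).2 hT,
    mul_comm_of_isSelfAdjoint_of_cyclic hh him (imaginaryPart S).2 hT]

end CyclicVector

theorem isReduced_of_isMulCommutative {B : Type*} [NormedRing B] [StarRing B] [CStarRing B]
    [Algebra ℂ B] [StarModule ℂ B] (A : StarSubalgebra ℂ B) [IsMulCommutative A] :
    IsReduced A := by
  rw [isReduced_iff_pow_one_lt 2 one_lt_two]
  rintro ⟨b, hb⟩ hsq
  have hbb : b * b = 0 := by simpa [pow_two] using congrArg Subtype.val hsq
  have hnormal : star b * b = b * star b := setLike_mul_comm (star_mem hb) hb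
  have hzero : star (star b * b) * (star b * b) = 0 :=
    calc star (star b * b) * (star b * b) = star b * (b * star b) * b := by
          rw [star_mul, star_star]; noncomm_ring
      _ = star b * star b * (b * b) := by rw [← hnormal]; noncomm_ring
      _ = 0 := by rw [hbb, mul_zero]
  rw [CStarRing.star_mul_self_eq_zero_iff, CStarRing.star_mul_self_eq_zero_iff] at hzero
  exact Subtype.ext hzero

section UnitaryRep

variable {G : Type*} {H : Type*} [NormedAddCommGroup H] [InnerProductSpace ℂ H] [CompleteSpace H]

/-- The family `U` is a unitary representation of the group `G`. It is a predicate on a family of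
bounded operators because this is the form in which Koopman operators are given. -/
structure IsUnitaryRep [AddGroup G] (U : G → H →L[ℂ] H) : Prop where
  map_zero : U 0 = 1
  map_add : ∀ z w, U (z + w) = U z * U w
  star_eq : ∀ z, star (U z) = U (-z)

/-- The algebra of bounded operators commuting with all `U z` and their adjoints. -/
noncomputable def commutant (U : G → H →L[ℂ] H) : StarSubalgebra ℂ (H →L[ℂ] H) :=
  StarSubalgebra.centralizer ℂ (Set.range U)

/-- The orbit of `h` under `U` spans a dense subspace. -/
def IsCyclicVector {E : Type*} [NormedAddCommGroup E] [NormedSpace ℂ E] (U : G → E →L[ℂ] E)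
    (h : E) : Prop :=
  (Submodule.span ℂ (Set.range fun z => U z h)).topologicalClosure = ⊤

theorem map_mul_eq_of_mem_commutant {U : G → H →L[ℂ] H} {B : H →L[ℂ] H} (hB : B ∈ commutant U)
    (z : G) : U z * B = B * U z :=
  ((StarSubalgebra.mem_centralizer_iff ℂ).1 hB _ ⟨z, rfl⟩).1

theorem commutant_apply {U : G → H →L[ℂ] H} {B : H →L[ℂ] H} (hB : B ∈ commutant U) (z : G)
    (x : H) : B (U z x) = U z (B x) :=
  (DFunLike.congr_fun (map_mul_eq_of_mem_commutant hB z) x).symm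

namespace IsUnitaryRep

section AddGroup

variable [AddGroup G] {U : G → H →L[ℂ] H} (hU : IsUnitaryRep U)
include hU

theorem mem_commutant {B : H →L[ℂ] H} : B ∈ commutant U ↔ ∀ z x, B (U z x) = U z (B x) := by
  refine ⟨commutant_apply, fun h => (StarSubalgebra.mem_centralizer_iff ℂ).2 ?_⟩
  have hcomm : ∀ z, U z * B = B * U z := fun z => ContinuousLinearMap.ext fun x => (h z x).symm
  rintro _ ⟨z, rfl⟩
  rw [hU.star_eq]
  exact ⟨hcomm z, hcomm (-z)⟩

theorem inner_apply_left (z : G) (x y : H) : inner ℂ (U z x) y = inner ℂ x (U (-z) y) := by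
  rw [← hU.star_eq, ContinuousLinearMap.star_eq_adjoint, ContinuousLinearMap.adjoint_inner_right]

theorem inner_apply_right (z : G) (x y : H) : inner ℂ x (U z y) = inner ℂ (U (-z) x) y := by
  rw [hU.inner_apply_left, neg_neg]

theorem star_mul_self (z : G) : star (U z) * U z = 1 := by
  rw [hU.star_eq, ← hU.map_add, neg_add_cancel, hU.map_zero]

theorem norm_map (z : G) (x : H) : ‖U z x‖ = ‖x‖ :=
  (U z).norm_map_iff_adjoint_comp_self.2 (hU.star_mul_self z) x

theorem norm_le_one (z : G) : ‖U z‖ ≤ 1 :=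
  (U z).opNorm_le_bound zero_le_one fun x => by rw [hU.norm_map, one_mul]

end AddGroup

variable [AddCommGroup G] {U : G → H →L[ℂ] H} (hU : IsUnitaryRep U)
include hU

theorem map_mem_commutant (w : G) : U w ∈ commutant U :=
  hU.mem_commutant.2 fun z x => by
    simp only [← mul_apply_eq_comp, ← hU.map_add, add_comm]

theorem isMulCommutative_adjoin_range :
    IsMulCommutative (StarAlgebra.adjoin ℂ (Set.range U)) := by
  refine StarAlgebra.isMulCommutative_adjoin ℂ ?_ ?_
  · rintro _ ⟨z, rfl⟩ _ ⟨w, rfl⟩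
    rw [← hU.map_add, ← hU.map_add, add_comm]
  · rintro _ ⟨z, rfl⟩ _ ⟨w, rfl⟩
    rw [hU.star_eq, ← hU.map_add, ← hU.map_add, add_comm]

theorem isMulCommutative_commutant {h : H} (hh : IsCyclicVector U h) :
    IsMulCommutative (commutant U) := by
  have := hU.isMulCommutative_adjoin_range
  have hle : commutant U ≤ StarSubalgebra.centralizer ℂ
      (StarAlgebra.adjoin ℂ (Set.range U) : Set (H →L[ℂ] H)) := by
    refine fun B hB => (StarSubalgebra.mem_centralizer_iff ℂ).2 fun a ha => ?_
    have hcomm : ∀ b ∈ StarAlgebra.adjoin ℂ (Set.range U), b * B = B * b := fun b hb =>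
      ((StarSubalgebra.mem_centralizer_iff ℂ).1
        (StarAlgebra.adjoin_le_centralizer_centralizer ℂ _ hb) B hB).1.symm
    exact ⟨hcomm a ha, hcomm _ (star_mem ha)⟩
  have hspan : Submodule.span ℂ (Set.range fun z => U z h) ≤
      (StarAlgebra.adjoin ℂ (Set.range U)).toSubalgebra.toSubmodule.map
        (ContinuousLinearMap.apply ℂ H h).toLinearMap := by
    rw [Submodule.span_le]
    rintro _ ⟨z, rfl⟩
    exact ⟨U z, StarAlgebra.subset_adjoin ℂ _ ⟨z, rfl⟩, rfl⟩
  have hdense : DenseRange fun a : StarAlgebra.adjoin ℂ (Set.range U) => (a : H →L[ℂ] H) h := by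
    refine ((Submodule.dense_iff_topologicalClosure_eq_top).2 hh).mono fun x hx => ?_
    obtain ⟨a, ha, rfl⟩ := hspan hx
    exact ⟨⟨a, ha⟩, rfl⟩
  have := isMulCommutative_centralizer_of_cyclic hdense
  exact .of_setLike_mul_comm fun S hS T hT => setLike_mul_comm (hle hS) (hle hT)

end IsUnitaryRep

end UnitaryRep

section Subspaces

variable {G : Type*} {H : Type*} [NormedAddCommGroup H] [InnerProductSpace ℂ H]

/-- `K` is invariant under all `U z`. -/
def Invariant (U : G → H →L[ℂ] H) (K : Submodule ℂ H) : Prop :=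
  ∀ z, ∀ x ∈ K, U z x ∈ K

/-- `K` is invariant under the whole commutant of `U`; for unitary representations of abelian
groups these are the ranges of the spectral projections. -/
def Hyperinvariant [CompleteSpace H] (U : G → H →L[ℂ] H) (K : Submodule ℂ H) : Prop :=
  ∀ B ∈ commutant U, ∀ x ∈ K, B x ∈ K

/-- The restriction of `U` to an invariant subspace. -/
def restrictRep (U : G → H →L[ℂ] H) {K : Submodule ℂ H} (hK : Invariant U K) (z : G) : K →L[ℂ] K :=
  (U z).restrict (hK z)

theorem coe_restrictRep {U : G → H →L[ℂ] H} {K : Submodule ℂ H} (hK : Invariant U K) (z : G)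
    (x : K) : (restrictRep U hK z x : H) = U z x := rfl

theorem starProjection_comm {K : Submodule ℂ H} [K.HasOrthogonalProjection] {B : H →L[ℂ] H}
    (hK : ∀ x ∈ K, B x ∈ K) (hKo : ∀ x ∈ Kᗮ, B x ∈ Kᗮ) (x : H) :
    K.starProjection (B x) = B (K.starProjection x) := by
  refine Submodule.eq_starProjection_of_mem_orthogonal (hK _ (K.starProjection_apply_mem x)) ?_
  rw [← map_sub]
  exact hKo _ (K.sub_starProjection_mem_orthogonal x)

theorem apply_mem_of_mem_closure_span {E : Type*} [NormedAddCommGroup E] [NormedSpace ℂ E]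
    {B : E →L[ℂ] H} {s : Set E} {L : Submodule ℂ H} (hL : IsClosed (L : Set H))
    (h : ∀ x ∈ s, B x ∈ L) {x : E} (hx : x ∈ (Submodule.span ℂ s).topologicalClosure) : B x ∈ L :=
  Submodule.topologicalClosure_minimal (t := L.comap B.toLinearMap) _ (Submodule.span_le.2 h)
    (hL.preimage B.continuous) hx

namespace IsUnitaryRep

variable [CompleteSpace H] {K : Submodule ℂ H}

section AddGroup

variable [AddGroup G] {U : G → H →L[ℂ] H} (hU : IsUnitaryRep U)
include hU

theorem restrictRep [CompleteSpace K] (hK : Invariant U K) :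
    IsUnitaryRep (restrictRep U hK) where
  map_zero := by
    ext x
    rw [coe_restrictRep, hU.map_zero]
    rfl
  map_add z w := by
    ext x
    rw [coe_restrictRep, hU.map_add]
    rfl
  star_eq z := by
    rw [ContinuousLinearMap.star_eq_adjoint, eq_comm, ContinuousLinearMap.eq_adjoint_iff]
    intro x y
    rw [Submodule.coe_inner, Submodule.coe_inner, coe_restrictRep, coe_restrictRep,
      hU.inner_apply_left, neg_neg]

theorem orthogonal_invariant (hK : Invariant U K) : Invariant U Kᗮ := by
  refine fun z x hx => (Submodule.mem_orthogonal _ _).2 fun u hu => ?_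
  rw [hU.inner_apply_right]
  exact (Submodule.mem_orthogonal _ _).1 hx _ (hK _ _ hu)

theorem starProjection_mem_commutant [K.HasOrthogonalProjection] (hK : Invariant U K) :
    K.starProjection ∈ commutant U :=
  hU.mem_commutant.2 fun z => starProjection_comm (hK z) (hU.orthogonal_invariant hK z)

end AddGroup

theorem invariant_of_hyperinvariant [AddCommGroup G] {U : G → H →L[ℂ] H} (hU : IsUnitaryRep U)
    (hK : Hyperinvariant U K) : Invariant U K :=
  fun z x hx => hK _ (hU.map_mem_commutant z) x hx

end IsUnitaryRep

namespace Hyperinvariant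

variable [CompleteSpace H] {U : G → H →L[ℂ] H} {K : Submodule ℂ H}

theorem orthogonal (hK : Hyperinvariant U K) : Hyperinvariant U Kᗮ := by
  refine fun B hB x hx => (Submodule.mem_orthogonal _ _).2 fun u hu => ?_
  rw [← ContinuousLinearMap.adjoint_inner_left, ← ContinuousLinearMap.star_eq_adjoint]
  exact (Submodule.mem_orthogonal _ _).1 hx _ (hK _ (star_mem hB) _ hu)

theorem starProjection_apply_comm [K.HasOrthogonalProjection] (hK : Hyperinvariant U K)
    {B : H →L[ℂ] H} (hB : B ∈ commutant U) (x : H) :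
    K.starProjection (B x) = B (K.starProjection x) :=
  starProjection_comm (hK B hB) (hK.orthogonal B hB) x

end Hyperinvariant

end Subspaces

section Disjointness

variable {H : Type*} [NormedAddCommGroup H] [InnerProductSpace ℂ H] [CompleteSpace H]
  {U : ℤ × ℤ → H →L[ℂ] H} (hU : IsUnitaryRep U) {K M : Submodule ℂ H}
include hU

theorem IsUnitaryRep.disjointOn_of_hyperinvariant (hcl : IsClosed (K : Set H))
    (hK : Hyperinvariant U K) : DisjointOn U K (M ⊓ Kᗮ) := by
  intro J hJ
  have : CompleteSpace K := hcl.completeSpace_coe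
  have hinv := hU.invariant_of_hyperinvariant hK
  let B : H →L[ℂ] H := (M ⊓ Kᗮ).subtypeL ∘L J ∘L K.orthogonalProjectionOnto
  have hB : B ∈ commutant U := hU.mem_commutant.2 fun z x => by
    have hproj : K.orthogonalProjectionOnto (U z x) =
        ⟨U z (K.orthogonalProjectionOnto x), hinv z _ (K.orthogonalProjectionOnto x).2⟩ :=
      Subtype.ext (starProjection_comm (hinv z) (hU.orthogonal_invariant hinv z) x)
    exact (congrArg (fun y : K => (J y : H)) hproj).trans (hJ z _ _)
  ext x
  have hBx : B x = (J x : H) := by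
    simp only [B, ContinuousLinearMap.comp_apply,
      Submodule.orthogonalProjectionOnto_mem_subspace_eq_self, Submodule.subtypeL_apply]
  have hmem : (J x : H) ∈ K ⊓ Kᗮ := ⟨hBx ▸ hK B hB x x.2, (J x).2.2⟩
  rwa [Submodule.inf_orthogonal_eq_bot, Submodule.mem_bot] at hmem

theorem IsUnitaryRep.hyperinvariant_of_disjointOn (hcl : IsClosed (K : Set H))
    (hinv : Invariant U K) (hKM : K ≤ M) (hM : Hyperinvariant U M)
    (hd : DisjointOn U K (M ⊓ Kᗮ)) : Hyperinvariant U K := by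
  intro B hB x hx
  have : CompleteSpace K := hcl.completeSpace_coe
  let B' : H →L[ℂ] H := B - K.starProjection ∘L B
  have hB' : B' ∈ commutant U :=
    sub_mem hB (mul_mem (hU.starProjection_mem_commutant hinv) hB)
  have hmem : ∀ y : K, B' y ∈ M ⊓ Kᗮ := fun y =>
    ⟨sub_mem (hM B hB _ (hKM y.2)) (hKM (K.starProjection_apply_mem _)),
      K.sub_starProjection_mem_orthogonal _⟩
  let J : K →L[ℂ] (M ⊓ Kᗮ : Submodule ℂ H) := (B' ∘L K.subtypeL).codRestrict _ hmem
  have hJ : J = 0 := hd J fun z y _ => commutant_apply hB' z y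
  have hB'x : B x - K.starProjection (B x) = 0 :=
    congrArg (fun A : K →L[ℂ] (M ⊓ Kᗮ : Submodule ℂ H) => (A ⟨x, hx⟩ : H)) hJ
  rw [sub_eq_zero.1 hB'x]
  exact K.starProjection_apply_mem _

end Disjointness

section CyclicSubspaces

variable {H : Type*} [NormedAddCommGroup H] [InnerProductSpace ℂ H]
  {U : ℤ × ℤ → H →L[ℂ] H} {K L M C : Submodule ℂ H}

theorem IsCyclicSubspace.isClosed (hC : IsCyclicSubspace U C) : IsClosed (C : Set H) := by
  obtain ⟨h, rfl⟩ := hC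
  exact Submodule.isClosed_topologicalClosure _

theorem IsUnitaryRep.invariant_of_cyclic [CompleteSpace H] (hU : IsUnitaryRep U)
    (hC : IsCyclicSubspace U C) : Invariant U C := by
  obtain ⟨h, rfl⟩ := hC
  refine fun z x => apply_mem_of_mem_closure_span (Submodule.isClosed_topologicalClosure _) ?_
  rintro _ ⟨w, rfl⟩
  exact Submodule.le_topologicalClosure _ (Submodule.subset_span ⟨z + w, by simp [hU.map_add]⟩)

theorem IsCyclicSubspace.exists_isCyclicVector (hC : IsCyclicSubspace U C) (hU0 : U 0 = 1)
    (hinv : Invariant U C) : ∃ h : C, IsCyclicVector (restrictRep U hinv) h := by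
  obtain ⟨h, rfl⟩ := hC
  have hh : h ∈ (Submodule.span ℂ (Set.range fun z => U z h)).topologicalClosure :=
    Submodule.le_topologicalClosure _ (Submodule.subset_span ⟨0, by simp [hU0]⟩)
  refine ⟨⟨h, hh⟩, eq_top_iff.2 ?_⟩
  rintro ⟨x, hx⟩ -
  set S := Submodule.span ℂ (Set.range fun z => restrictRep U hinv z ⟨h, hh⟩)
  have hS : Submodule.span ℂ (Set.range fun z => U z h) = S.map (Submodule.subtype _) := by
    rw [Submodule.map_span, ← Set.range_comp]
    rfl
  change _ ∈ closure (SetLike.coe S)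
  rw [closure_subtype]
  change x ∈ closure ((S.map (Submodule.subtype _) : Submodule ℂ H) : Set H)
  rwa [← hS]

theorem IsomorphicOn.refl (K : Submodule ℂ H) : IsomorphicOn U K K :=
  ⟨LinearIsometryEquiv.refl ℂ K, fun _ _ _ => rfl⟩

theorem IsomorphicOn.symm (hK : Invariant U K) (h : IsomorphicOn U K L) : IsomorphicOn U L K := by
  obtain ⟨Φ, hΦ⟩ := h
  refine ⟨Φ.symm, fun z x hx => ?_⟩
  have hUx : Φ ⟨U z (Φ.symm x), hK z _ (Φ.symm x).2⟩ = ⟨U z x, hx⟩ :=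
    Subtype.ext (by rw [hΦ z _ _, LinearIsometryEquiv.apply_symm_apply])
  rw [← hUx, LinearIsometryEquiv.symm_apply_apply]

theorem IsomorphicOn.trans (hL : Invariant U L) (h : IsomorphicOn U K L)
    (h' : IsomorphicOn U L M) : IsomorphicOn U K M := by
  obtain ⟨Φ, hΦ⟩ := h
  obtain ⟨Ψ, hΨ⟩ := h'
  refine ⟨Φ.trans Ψ, fun z x hx => ?_⟩
  have hUx : Φ ⟨U z x, hx⟩ = ⟨U z (Φ x), hL z _ (Φ x).2⟩ := Subtype.ext (hΦ z x hx)
  rw [LinearIsometryEquiv.trans_apply, LinearIsometryEquiv.trans_apply, ← hΨ z (Φ x) _, hUx]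

theorem IsomorphicOn.isCyclicSubspace [CompleteSpace H] (hU : IsUnitaryRep U)
    (h : IsomorphicOn U K L) (hK : IsCyclicSubspace U K) (hcl : IsClosed (L : Set H)) :
    IsCyclicSubspace U L := by
  have hinv := hU.invariant_of_cyclic hK
  obtain ⟨v, hv⟩ := hK.exists_isCyclicVector hU.map_zero hinv
  obtain ⟨Φ, hΦ⟩ := h
  have hΦv : ∀ z, (Φ (restrictRep U hinv z v) : H) = U z (Φ v) := fun z => hΦ z v (hinv z v v.2)
  refine ⟨Φ v, le_antisymm ?_ fun x hx => ?_⟩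
  · refine Submodule.topologicalClosure_minimal _ (Submodule.span_le.2 ?_) hcl
    rintro _ ⟨z, rfl⟩
    simp only [← hΦv]
    exact (Φ _).2
  · have hrange : ∀ y : K, (Φ y : H) ∈
        (Submodule.span ℂ (Set.range fun z => U z (Φ v))).topologicalClosure := fun y => by
      refine apply_mem_of_mem_closure_span (x := y)
        (B := L.subtypeL ∘L (Φ.toContinuousLinearEquiv : K →L[ℂ] L))
        (Submodule.isClosed_topologicalClosure _) ?_ (hv ▸ Submodule.mem_top)
      rintro _ ⟨z, rfl⟩
      exact Submodule.le_topologicalClosure _ (Submodule.subset_span ⟨z, (hΦv z).symm⟩)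
    simpa only [LinearIsometryEquiv.apply_symm_apply] using hrange (Φ.symm ⟨x, hx⟩)

end CyclicSubspaces

/-! ### Polar decomposition of intertwiners -/

section Modulus

variable {E F : Type*} [NormedAddCommGroup E] [InnerProductSpace ℂ E] [CompleteSpace E]
  [NormedAddCommGroup F] [InnerProductSpace ℂ F] [CompleteSpace F]

/-- The absolute value `|J| = (J* J)^(1/2)` of a bounded operator between two Hilbert spaces. -/
noncomputable def modulus (J : E →L[ℂ] F) : E →L[ℂ] E := CFC.sqrt (J.adjoint ∘L J)

theorem modulus_mul_self (J : E →L[ℂ] F) : modulus J * modulus J = J.adjoint ∘L J :=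
  CFC.sqrt_mul_sqrt_self _ <| (ContinuousLinearMap.nonneg_iff_isPositive _).2
    (ContinuousLinearMap.isPositive_adjoint_comp_self J)

theorem isSelfAdjoint_modulus (J : E →L[ℂ] F) : IsSelfAdjoint (modulus J) :=
  (CFC.sqrt_nonneg _).isSelfAdjoint

theorem norm_modulus_apply (J : E →L[ℂ] F) (x : E) : ‖modulus J x‖ = ‖J x‖ := by
  have hinner : inner ℂ (modulus J x) (modulus J x) = inner ℂ (J x) (J x) := by
    rw [← ContinuousLinearMap.adjoint_inner_right, ← ContinuousLinearMap.star_eq_adjoint,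
      (isSelfAdjoint_modulus J).star_eq, ← mul_apply_eq_comp, modulus_mul_self,
      ContinuousLinearMap.comp_apply, ContinuousLinearMap.adjoint_inner_right]
  rw [inner_self_eq_norm_sq_to_K, inner_self_eq_norm_sq_to_K] at hinner
  exact (sq_eq_sq₀ (norm_nonneg _) (norm_nonneg _)).1 (by exact_mod_cast hinner)

theorem denseRange_of_adjoint_injective {J : E →L[ℂ] F} (hJ : ∀ y, J.adjoint y = 0 → y = 0) :
    DenseRange J := by
  refine Submodule.dense_iff_topologicalClosure_eq_top.2
    (Submodule.topologicalClosure_eq_top_iff.2 ?_ : J.range.topologicalClosure = ⊤)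
  rw [J.orthogonal_range]
  exact LinearMap.ker_eq_bot'.2 hJ

theorem denseRange_modulus {J : E →L[ℂ] F} (hJ : ∀ x, J x = 0 → x = 0) :
    DenseRange (modulus J) := by
  refine denseRange_of_adjoint_injective fun x hx => hJ x ?_
  rwa [← ContinuousLinearMap.star_eq_adjoint, (isSelfAdjoint_modulus J).star_eq, ← norm_eq_zero,
    norm_modulus_apply, norm_eq_zero] at hx

theorem commute_modulus {J : E →L[ℂ] F} {A : E →L[ℂ] E} (hA : Commute A (J.adjoint ∘L J)) :
    Commute A (modulus J) :=
  (hA.symm.cfcₙ_nnreal _).symm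

/-- The unitary factor of the polar decomposition `J = Φ |J|`. -/
theorem exists_linearIsometryEquiv_modulus {J : E →L[ℂ] F} (hJ : ∀ x, J x = 0 → x = 0)
    (hJd : DenseRange J) : ∃ Φ : E ≃ₗᵢ[ℂ] F, ∀ x, Φ (modulus J x) = J x :=
  ⟨(LinearEquiv.refl ℂ E).extendOfIsometry (modulus J).toLinearMap J.toLinearMap
    (denseRange_modulus hJ) hJd fun x => (norm_modulus_apply J x).symm,
    LinearEquiv.extendOfIsometry_eq _ _ _ _ _ _⟩

end Modulus

section Intertwiners

variable {G : Type*} [AddGroup G]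
  {E F : Type*} [NormedAddCommGroup E] [InnerProductSpace ℂ E] [CompleteSpace E]
  [NormedAddCommGroup F] [InnerProductSpace ℂ F] [CompleteSpace F]
  {V : G → E →L[ℂ] E} {W : G → F →L[ℂ] F} {J : E →L[ℂ] F}

theorem IsUnitaryRep.adjoint_intertwines (hV : IsUnitaryRep V) (hW : IsUnitaryRep W)
    (hJ : ∀ z x, J (V z x) = W z (J x)) (z : G) (y : F) :
    J.adjoint (W z y) = V z (J.adjoint y) := by
  refine ext_inner_left ℂ fun x => ?_
  rw [ContinuousLinearMap.adjoint_inner_right, hW.inner_apply_right, ← hJ, hV.inner_apply_right,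
    ContinuousLinearMap.adjoint_inner_right]

theorem IsUnitaryRep.exists_linearIsometryEquiv (hV : IsUnitaryRep V) (hW : IsUnitaryRep W)
    (hJ : ∀ z x, J (V z x) = W z (J x)) (hinj : ∀ x, J x = 0 → x = 0) (hd : DenseRange J) :
    ∃ Φ : E ≃ₗᵢ[ℂ] F, ∀ z x, Φ (V z x) = W z (Φ x) := by
  obtain ⟨Φ, hΦ⟩ := exists_linearIsometryEquiv_modulus hinj hd
  have hcomm : ∀ z x, V z (modulus J x) = modulus J (V z x) := fun z x =>
    DFunLike.congr_fun (commute_modulus <| ContinuousLinearMap.ext fun x => by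
      simp only [mul_apply_eq_comp, ContinuousLinearMap.comp_apply, hJ,
        hV.adjoint_intertwines hW hJ]).eq x
  refine ⟨Φ, fun z x => (denseRange_modulus hinj).induction_on
    (p := fun x => Φ (V z x) = W z (Φ x)) x (isClosed_eq (by fun_prop) (by fun_prop)) fun y => ?_⟩
  rw [hcomm, hΦ, hΦ, hJ]

end Intertwiners

theorem IsUnitaryRep.isomorphicOn_of_injective {H : Type*} [NormedAddCommGroup H]
    [InnerProductSpace ℂ H] [CompleteSpace H] {U : ℤ × ℤ → H →L[ℂ] H} (hU : IsUnitaryRep U)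
    {K L : Submodule ℂ H} (hKc : IsClosed (K : Set H)) (hLc : IsClosed (L : Set H))
    (hK : Invariant U K) (hL : Invariant U L) {B : H →L[ℂ] H} (hB : B ∈ commutant U)
    (hKL : ∀ x ∈ K, B x ∈ L) (hinj : ∀ x ∈ K, B x = 0 → x = 0)
    (hdense : ∀ y ∈ L, (∀ x ∈ K, inner ℂ (B x) y = 0) → y = 0) : IsomorphicOn U K L := by
  have : CompleteSpace K := hKc.completeSpace_coe
  have : CompleteSpace L := hLc.completeSpace_coe
  let J : K →L[ℂ] L := B.restrict hKL
  have hJd : DenseRange J := denseRange_of_adjoint_injective fun y hy =>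
    Subtype.ext <| hdense y y.2 fun x hx => by
      have hJx : inner ℂ (J ⟨x, hx⟩) y = 0 := by
        rw [← ContinuousLinearMap.adjoint_inner_right, hy, inner_zero_right]
      exact hJx
  obtain ⟨Φ, hΦ⟩ := (hU.restrictRep hK).exists_linearIsometryEquiv (hU.restrictRep hL)
    (J := J) (fun z x => Subtype.ext (commutant_apply hB z x))
    (fun x hx => Subtype.ext (hinj x x.2 (congrArg Subtype.val hx))) hJd
  exact ⟨Φ, fun z x _ => congrArg Subtype.val (hΦ z x)⟩

/-! ### Uniqueness of the multiplicity -/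

theorem pow_card_eq_zero_of_isNilpotent {R ι : Type*} [CommRing R] [IsReduced R] [Fintype ι]
    [DecidableEq ι] {A : Matrix ι ι R} (hA : IsNilpotent A) : A ^ Fintype.card ι = 0 := by
  have hchar : A.charpoly = Polynomial.X ^ Fintype.card ι := by
    have hcoeff := Polynomial.isNilpotent_iff.1
      (Matrix.isNilpotent_charpoly_sub_pow_of_isNilpotent hA)
    exact sub_eq_zero.1 (Polynomial.ext fun i => (hcoeff i).eq_zero)
  simpa only [hchar, map_pow, Polynomial.aeval_X] using Matrix.aeval_self_charpoly A

theorem apply_mem_of_topologicalClosure_iSup_range_eq {𝕜 E F κ : Type*} [NormedField 𝕜]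
    [NormedAddCommGroup E] [NormedSpace 𝕜 E] [NormedAddCommGroup F] [NormedSpace 𝕜 F]
    {f : κ → E →L[𝕜] F} {K : Submodule 𝕜 F} (hK : (⨆ i, (f i).range).topologicalClosure = K)
    (i : κ) (x : E) : f i x ∈ K :=
  hK ▸ Submodule.le_topologicalClosure _ (Submodule.mem_iSup_of_mem i ⟨x, rfl⟩)

section OrthogonalCopies

variable {G : Type*}
  {H : Type*} [NormedAddCommGroup H] [InnerProductSpace ℂ H] [CompleteSpace H]
  {E : Type*} [NormedAddCommGroup E] [InnerProductSpace ℂ E] [CompleteSpace E]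
  {κ : Type*} [DecidableEq κ]

/-- Isometric embeddings `f i` of the representation `V` into the representation `U`, with
pairwise orthogonal ranges. -/
structure OrthogonalCopies (U : G → H →L[ℂ] H) (V : G → E →L[ℂ] E) (f : κ → E →L[ℂ] H) :
    Prop where
  adjoint_comp : ∀ i j, (f i).adjoint ∘L f j = if i = j then 1 else 0
  map_rep : ∀ i z x, f i (V z x) = U z (f i x)

namespace OrthogonalCopies

variable {U : G → H →L[ℂ] H} {V : G → E →L[ℂ] E} {f : κ → E →L[ℂ] H}

theorem adjoint_apply (hf : OrthogonalCopies U V f) (i j : κ) (x : E) :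
    (f i).adjoint (f j x) = if i = j then x else 0 := by
  have happly := DFunLike.congr_fun (hf.adjoint_comp i j) x
  rw [ContinuousLinearMap.comp_apply] at happly
  rw [happly]
  split_ifs <;> rfl

theorem adjoint_apply_self (hf : OrthogonalCopies U V f) (i : κ) (x : E) :
    (f i).adjoint (f i x) = x := by
  rw [hf.adjoint_apply, if_pos rfl]

theorem comp_injective (hf : OrthogonalCopies U V f) {κ' : Type*} [DecidableEq κ'] {e : κ' → κ}
    (he : Function.Injective e) : OrthogonalCopies U V (f ∘ e) where
  adjoint_comp i j := by
    simp only [Function.comp_apply, hf.adjoint_comp, he.eq_iff]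
  map_rep i := hf.map_rep (e i)

theorem comp_adjoint_mem_commutant [AddGroup G] (hf : OrthogonalCopies U V f) (hU : IsUnitaryRep U)
    (hV : IsUnitaryRep V) (i j : κ) : f i ∘L (f j).adjoint ∈ commutant U :=
  hU.mem_commutant.2 fun z x => by
    rw [ContinuousLinearMap.comp_apply, hV.adjoint_intertwines hU (hf.map_rep j), hf.map_rep,
      ContinuousLinearMap.comp_apply]

theorem corner_mem_commutant [AddGroup G] (hf : OrthogonalCopies U V f) (hU : IsUnitaryRep U)
    (hV : IsUnitaryRep V) {y : H →L[ℂ] H} (hy : y ∈ commutant U) (i j : κ) :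
    (f i).adjoint ∘L y ∘L f j ∈ commutant V :=
  hV.mem_commutant.2 fun z x => by
    simp only [ContinuousLinearMap.comp_apply, hf.map_rep, commutant_apply hy,
      hV.adjoint_intertwines hU (hf.map_rep i)]

section CornerMatrix

/-- The matrix of an intertwiner `y` in the decomposition given by the copies `f i`: its entries
`(f i)* y (f j)` are intertwiners of `V`. -/
noncomputable def cornerMatrix [AddGroup G] (hf : OrthogonalCopies U V f) (hU : IsUnitaryRep U)
    (hV : IsUnitaryRep V) {y : H →L[ℂ] H} (hy : y ∈ commutant U) : Matrix κ κ (commutant V) :=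
  fun i j => ⟨(f i).adjoint ∘L y ∘L f j, hf.corner_mem_commutant hU hV hy i j⟩

variable [Fintype κ] {K : Submodule ℂ H}

theorem sum_apply_adjoint (hf : OrthogonalCopies U V f)
    (hK : (⨆ i, (f i).range).topologicalClosure = K) {v : H} (hv : v ∈ K) :
    ∑ i, f i ((f i).adjoint v) = v := by
  have hle : K ≤ LinearMap.eqLocus (∑ i, f i ∘L (f i).adjoint).toLinearMap LinearMap.id := by
    rw [← hK]
    refine Submodule.topologicalClosure_minimal _ (iSup_le ?_)
      (isClosed_eq (ContinuousLinearMap.continuous _) continuous_id)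
    rintro j _ ⟨x, rfl⟩
    rw [LinearMap.mem_eqLocus]
    simp only [ContinuousLinearMap.coe_coe, LinearMap.id_apply, sum_apply,
      ContinuousLinearMap.comp_apply, hf.adjoint_apply, apply_ite (f _), map_zero,
      Finset.sum_ite_eq', Finset.mem_univ, if_true]
  simpa only [LinearMap.mem_eqLocus, ContinuousLinearMap.coe_coe, LinearMap.id_apply, sum_apply,
    ContinuousLinearMap.comp_apply] using hle hv

theorem cornerMatrix_pow_apply [AddGroup G] (hf : OrthogonalCopies U V f) (hU : IsUnitaryRep U)
    (hV : IsUnitaryRep V) (hK : (⨆ i, (f i).range).topologicalClosure = K) {y : H →L[ℂ] H}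
    (hy : y ∈ commutant U) (hyK : ∀ v ∈ K, y v ∈ K) (k : ℕ) (i j : κ) (x : E) :
    ((hf.cornerMatrix hU hV hy ^ k) i j : E →L[ℂ] E) x = (f i).adjoint ((y ^ k) (f j x)) := by
  induction k generalizing j x with
  | zero =>
    simp only [pow_zero, Matrix.one_apply, one_apply_eq_self, hf.adjoint_apply]
    split_ifs <;> rfl
  | succ k ih =>
    rw [pow_succ, Matrix.mul_apply, AddSubmonoidClass.coe_finsetSum, sum_apply, pow_succ,
      mul_apply_eq_comp]
    conv_rhs => rw [← hf.sum_apply_adjoint hK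
      (hyK _ (apply_mem_of_topologicalClosure_iSup_range_eq hK j x))]
    simp only [map_sum]
    exact Finset.sum_congr rfl fun l _ => ih l _

theorem pow_card_apply_eq_zero [AddCommGroup G] (hf : OrthogonalCopies U V f)
    (hU : IsUnitaryRep U) (hV : IsUnitaryRep V) {h : E} (hh : IsCyclicVector V h)
    (hK : (⨆ i, (f i).range).topologicalClosure = K) {y : H →L[ℂ] H}
    (hy : y ∈ commutant U) (hyK : ∀ v ∈ K, y v ∈ K) (hnil : IsNilpotent y) {v : H}
    (hv : v ∈ K) : (y ^ Fintype.card κ) v = 0 := by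
  have : IsMulCommutative (commutant V) := hV.isMulCommutative_commutant hh
  have : IsReduced (commutant V) := isReduced_of_isMulCommutative _
  open scoped IsMulCommutative in
  have hpow : hf.cornerMatrix hU hV hy ^ Fintype.card κ = 0 := by
    obtain ⟨N, hN⟩ := hnil
    refine pow_card_eq_zero_of_isNilpotent ⟨N, Matrix.ext fun i j => Subtype.ext ?_⟩
    ext x
    rw [hf.cornerMatrix_pow_apply hU hV hK hy hyK, hN, _root_.zero_apply, map_zero]
    rfl
  have hyn : ∀ w ∈ K, (y ^ Fintype.card κ) w ∈ K := by
    rw [← ContinuousLinearMap.coe_coe, ContinuousLinearMap.toLinearMap_pow]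
    exact Module.End.pow_apply_mem_of_forall_mem _ hyK
  rw [← hf.sum_apply_adjoint hK hv, map_sum]
  refine Finset.sum_eq_zero fun j _ => ?_
  rw [← hf.sum_apply_adjoint hK
    (hyn _ (apply_mem_of_topologicalClosure_iSup_range_eq hK j _))]
  refine Finset.sum_eq_zero fun i _ => ?_
  rw [← hf.cornerMatrix_pow_apply hU hV hK hy hyK, hpow]
  exact map_zero (f i)

end CornerMatrix

section Shift

variable {n : ℕ} {f : Fin (n + 1) → E →L[ℂ] H}

/-- The operator mapping the `i`-th copy onto the `(i + 1)`-st one and killing the last copy. -/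
noncomputable def shift (f : Fin (n + 1) → E →L[ℂ] H) : H →L[ℂ] H :=
  ∑ i : Fin n, f i.succ ∘L (f i.castSucc).adjoint

theorem shift_apply (f : Fin (n + 1) → E →L[ℂ] H) (v : H) :
    shift f v = ∑ i : Fin n, f i.succ ((f i.castSucc).adjoint v) := by
  simp only [shift, sum_apply, ContinuousLinearMap.comp_apply]

theorem shift_mem_commutant [AddGroup G] (hf : OrthogonalCopies U V f) (hU : IsUnitaryRep U)
    (hV : IsUnitaryRep V) : shift f ∈ commutant U :=
  sum_mem fun _ _ => hf.comp_adjoint_mem_commutant hU hV _ _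

theorem shift_apply_castSucc (hf : OrthogonalCopies U V f) (i : Fin n) (x : E) :
    shift f (f i.castSucc x) = f i.succ x := by
  simp only [shift_apply, hf.adjoint_apply, Fin.castSucc_inj, apply_ite (f _), map_zero,
    Finset.sum_ite_eq', Finset.mem_univ, if_true]

theorem shift_apply_last (hf : OrthogonalCopies U V f) (x : E) :
    shift f (f (Fin.last n) x) = 0 := by
  simp only [shift_apply, hf.adjoint_apply, (Fin.castSucc_lt_last _).ne, if_false, map_zero,
    Finset.sum_const_zero]

theorem shift_pow_apply_zero (hf : OrthogonalCopies U V f) (i : Fin (n + 1)) (x : E) :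
    (shift f ^ (i : ℕ)) (f 0 x) = f i x := by
  induction i using Fin.induction with
  | zero => rfl
  | succ i ih =>
    rw [Fin.val_succ, pow_succ', mul_apply_eq_comp, ← Fin.val_castSucc, ih,
      hf.shift_apply_castSucc]

theorem isNilpotent_shift (hf : OrthogonalCopies U V f) : IsNilpotent (shift f) := by
  have hzero : ∀ x, (shift f ^ (n + 1)) (f 0 x) = 0 := fun x => by
    have hlast := hf.shift_pow_apply_zero (Fin.last n) x
    rw [Fin.val_last] at hlast
    rw [pow_succ', mul_apply_eq_comp, hlast, hf.shift_apply_last]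
  have hcopy : ∀ i x, (shift f ^ (n + 1)) (f i x) = 0 := fun i x => by
    rw [← hf.shift_pow_apply_zero i x, ← mul_apply_eq_comp, ← pow_add, add_comm, pow_add,
      mul_apply_eq_comp, hzero, map_zero]
  refine ⟨n + 2, ContinuousLinearMap.ext fun v => ?_⟩
  rw [pow_succ, mul_apply_eq_comp, shift_apply, map_sum]
  exact Finset.sum_eq_zero fun i _ => hcopy _ _

end Shift

end OrthogonalCopies

end OrthogonalCopies

section Homogeneous

variable {H : Type*} [NormedAddCommGroup H] [InnerProductSpace ℂ H]
  {U : ℤ × ℤ → H →L[ℂ] H} {K K' : Submodule ℂ H}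

theorem HomogeneousOn.isClosed {n : ℕ∞} (hK : HomogeneousOn U K n) : IsClosed (K : Set H) := by
  obtain ⟨C, -, -, -, rfl⟩ := hK
  exact Submodule.isClosed_topologicalClosure _

theorem HomogeneousOn.eq_bot (hK : HomogeneousOn U K 0) : K = ⊥ := by
  obtain ⟨C, -, -, -, rfl⟩ := hK
  have : IsEmpty {i : ℕ // (i : ℕ∞) < 0} := ⟨fun i => not_lt_zero i.2⟩
  rw [iSup_of_empty]
  exact IsClosed.submodule_topologicalClosure_eq isClosed_singleton

variable [CompleteSpace H]

theorem HomogeneousOn.invariant {n : ℕ∞} (hK : HomogeneousOn U K n) (hU : IsUnitaryRep U) :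
    Invariant U K := by
  obtain ⟨C, hcyc, -, -, rfl⟩ := hK
  intro z x hx
  rw [Submodule.iSup_eq_span] at hx ⊢
  refine apply_mem_of_mem_closure_span (Submodule.isClosed_topologicalClosure _) (fun y hy => ?_) hx
  obtain ⟨i, hi⟩ := Set.mem_iUnion.1 hy
  exact Submodule.le_topologicalClosure _ <|
    Submodule.subset_span <| Set.mem_iUnion.2 ⟨i, hU.invariant_of_cyclic (hcyc i) z y hi⟩

theorem HomogeneousOn.exists_orthogonalCopies {n : ℕ∞} (hK : HomogeneousOn U K n)
    (hU : IsUnitaryRep U) (hn : n ≠ 0) :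
    ∃ (C : Submodule ℂ H) (_ : CompleteSpace C) (hinv : Invariant U C) (h : C)
      (f : {i : ℕ // (i : ℕ∞) < n} → C →L[ℂ] H),
      IsCyclicVector (restrictRep U hinv) h ∧ OrthogonalCopies U (restrictRep U hinv) f ∧
      (⨆ i, (f i).range).topologicalClosure = K := by
  obtain ⟨C, hcyc, horth, hiso, hsup⟩ := hK
  let i₀ : {i : ℕ // (i : ℕ∞) < n} := ⟨0, by simpa using hn.bot_lt⟩
  have hinv := hU.invariant_of_cyclic (hcyc i₀)
  have hcomp : CompleteSpace (C i₀) := (hcyc i₀).isClosed.completeSpace_coe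
  obtain ⟨h, hh⟩ := (hcyc i₀).exists_isCyclicVector hU.map_zero hinv
  choose Φ hΦ using fun i => hiso i₀ i
  let f : {i : ℕ // (i : ℕ∞) < n} → C i₀ →L[ℂ] H := fun i =>
    (C i).subtypeL ∘L ((Φ i).toContinuousLinearEquiv : C i₀ →L[ℂ] C i)
  have hf : ∀ i x, f i x = (Φ i x : H) := fun i x => rfl
  refine ⟨C i₀, hcomp, hinv, h, f, hh, ⟨fun i j => ?_, fun i z x => hΦ i z x (hinv z x x.2)⟩, ?_⟩
  · ext x
    refine congrArg Subtype.val (ext_inner_left ℂ fun y => ?_)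
    rw [ContinuousLinearMap.comp_apply, ContinuousLinearMap.adjoint_inner_right, hf, hf]
    split_ifs with hij
    · subst hij
      rw [← Submodule.coe_inner, LinearIsometryEquiv.inner_map_map, one_apply_eq_self]
    · rw [_root_.zero_apply, inner_zero_right]
      exact (horth i j hij).inner_eq (Φ i y).2 (Φ j x).2
  · rw [← hsup]
    congr 1
    refine iSup_congr fun i => le_antisymm ?_ fun x hx => ⟨(Φ i).symm ⟨x, hx⟩, ?_⟩
    · rintro _ ⟨y, rfl⟩
      exact (Φ i y).2
    · exact congrArg Subtype.val ((Φ i).apply_symm_apply ⟨x, hx⟩)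

theorem HomogeneousOn.pow_apply_eq_zero {m : ℕ} (hK : HomogeneousOn U K m)
    (hU : IsUnitaryRep U) (hyp : Hyperinvariant U K) {y : H →L[ℂ] H} (hy : y ∈ commutant U)
    (hnil : IsNilpotent y) {v : H} (hv : v ∈ K) : (y ^ m) v = 0 := by
  rcases eq_or_ne m 0 with rfl | hm
  · rw [(Submodule.eq_bot_iff K).1 hK.eq_bot v hv, map_zero]
  obtain ⟨C, _, hinv, h, f, hh, hf, hfK⟩ := hK.exists_orthogonalCopies hU (by exact_mod_cast hm)
  let e : Fin m ≃ {i : ℕ // (i : ℕ∞) < (m : ℕ∞)} :=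
    Fin.equivSubtype.trans (Equiv.subtypeEquivRight fun i => by simp)
  have hfe : (⨆ i, ((f ∘ e) i).range).topologicalClosure = K := by
    rw [← hfK, ← e.iSup_comp (g := fun i => (f i).range)]
    rfl
  simpa only [Fintype.card_fin] using (hf.comp_injective e.injective).pow_card_apply_eq_zero hU
    (hU.restrictRep hinv) hh hfe hy (hyp y hy) hnil hv

theorem HomogeneousOn.orthogonal_of_lt {n n' : ℕ∞} (hK : HomogeneousOn U K n)
    (hK' : HomogeneousOn U K' n') (hU : IsUnitaryRep U) (hlt : n < n')
    (hyp : Hyperinvariant U K) : K ⟂ K' := by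
  obtain ⟨m, rfl⟩ := ENat.ne_top_iff_exists.1 hlt.ne_top
  obtain ⟨C, _, hinv, h, f, -, hf, hfK'⟩ := hK'.exists_orthogonalCopies hU (ne_bot_of_gt hlt)
  have hV := hU.restrictRep hinv
  have : CompleteSpace K := hK.isClosed.completeSpace_coe
  let e : Fin (m + 1) → {i : ℕ // (i : ℕ∞) < n'} := fun i =>
    ⟨i, lt_of_le_of_lt (by exact_mod_cast Nat.lt_succ_iff.1 i.2) hlt⟩
  have hg : OrthogonalCopies U (restrictRep U hinv) (f ∘ e) :=
    hf.comp_injective fun i j hij => Fin.ext (congrArg Subtype.val hij)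
  have hlast : ∀ v, K.starProjection (f (e (Fin.last m)) v) = 0 := fun v => by
    have hpow := hg.shift_pow_apply_zero (Fin.last m) v
    rw [Fin.val_last] at hpow
    exact (congrArg K.starProjection hpow).symm.trans <|
      (hyp.starProjection_apply_comm (pow_mem (hg.shift_mem_commutant hU hV) m) _).trans <|
      hK.pow_apply_eq_zero hU hyp (hg.shift_mem_commutant hU hV) hg.isNilpotent_shift
        (K.starProjection_apply_mem _)
  have hcopy : ∀ i v, K.starProjection (f i v) = 0 := fun i v => by
    have hv : f i v = (f i ∘L (f (e (Fin.last m))).adjoint) (f (e (Fin.last m)) v) := by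
      rw [ContinuousLinearMap.comp_apply, hf.adjoint_apply_self]
    rw [hv, hyp.starProjection_apply_comm (hf.comp_adjoint_mem_commutant hU hV _ _), hlast,
      map_zero]
  refine (Submodule.isOrtho_iff_le.2 (?_ : K' ≤ Kᗮ)).symm
  rw [← hfK']
  refine Submodule.topologicalClosure_minimal _ (iSup_le ?_) (Submodule.isClosed_orthogonal _)
  rintro i _ ⟨v, rfl⟩
  exact (Submodule.starProjection_apply_eq_zero_iff K).1 (hcopy i v)

theorem HomogeneousOn.multiplicity_eq {n n' : ℕ∞} (hK : HomogeneousOn U K n)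
    (hK' : HomogeneousOn U K' n') (hU : IsUnitaryRep U) (hyp : Hyperinvariant U K)
    (hyp' : Hyperinvariant U K') {x : H} (hx : x ∈ K) (hx' : x ∈ K') (hx0 : x ≠ 0) : n = n' := by
  by_contra hne
  refine hx0 (inner_self_eq_zero (𝕜 := ℂ).1 ?_)
  obtain hlt | hlt := lt_or_gt_of_ne hne
  · exact (hK.orthogonal_of_lt hK' hU hlt hyp).inner_eq hx hx'
  · exact (hK'.orthogonal_of_lt hK hU hlt hyp').inner_eq hx' hx

end Homogeneous

/-! ### Weak limits and fixed vectors -/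

section FixedSpace

variable {H : Type*} [NormedAddCommGroup H] [InnerProductSpace ℂ H]

/-- The vectors fixed by `q`. -/
def fixedSpace (q : H →L[ℂ] H) : Submodule ℂ H :=
  LinearMap.eqLocus q.toLinearMap (1 : H →L[ℂ] H).toLinearMap

theorem mem_fixedSpace {q : H →L[ℂ] H} {x : H} : x ∈ fixedSpace q ↔ q x = x := Iff.rfl

theorem isClosed_fixedSpace (q : H →L[ℂ] H) : IsClosed (fixedSpace q : Set H) :=
  isClosed_eq q.continuous continuous_id

variable [CompleteSpace H]

instance (q : H →L[ℂ] H) : CompleteSpace (fixedSpace q) :=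
  (isClosed_fixedSpace q).completeSpace_coe

/-- The orthogonal projection onto the vectors fixed by `q`. -/
noncomputable def fixProj (q : H →L[ℂ] H) : H →L[ℂ] H := (fixedSpace q).starProjection

theorem fixProj_apply_eq_self {q : H →L[ℂ] H} {x : H} : fixProj q x = x ↔ q x = x :=
  Submodule.starProjection_eq_self_iff

theorem apply_fixProj (q : H →L[ℂ] H) (x : H) : q (fixProj q x) = fixProj q x :=
  mem_fixedSpace.1 ((fixedSpace q).starProjection_apply_mem x)

theorem star_fixProj (q : H →L[ℂ] H) : star (fixProj q) = fixProj q :=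
  (isStarProjection_starProjection (U := fixedSpace q)).isSelfAdjoint

theorem fixProj_fixProj (q : H →L[ℂ] H) (x : H) : fixProj q (fixProj q x) = fixProj q x :=
  fixProj_apply_eq_self.2 (apply_fixProj q x)

theorem fixProj_comm {q B : H →L[ℂ] H} (hB : ∀ x, B (q x) = q (B x))
    (hB' : ∀ x, star B (q x) = q (star B x)) (x : H) : fixProj q (B x) = B (fixProj q x) := by
  refine starProjection_comm (fun x hx => ?_)
    (fun x hx => (Submodule.mem_orthogonal _ _).2 fun u hu => ?_) x
  · rw [mem_fixedSpace] at hx ⊢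
    rw [← hB, hx]
  · rw [← ContinuousLinearMap.adjoint_inner_left, ← ContinuousLinearMap.star_eq_adjoint]
    refine (Submodule.mem_orthogonal _ _).1 hx _ ?_
    rw [mem_fixedSpace] at hu ⊢
    rw [← hB', hu]

theorem tendsto_fixProj {q : H →L[ℂ] H} (hq : ‖q‖ ≤ 1) (x : H) :
    Tendsto (fun N : ℕ => (N : ℂ)⁻¹ • ∑ n ∈ Finset.range N, (q ^ n) x) atTop
      (𝓝 (fixProj q x)) := by
  refine (q.tendsto_birkhoffAverage_orthogonalProjection hq x).congr fun N => ?_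
  simp only [birkhoffAverage, birkhoffSum, id, FunLike.coe_pow_eq_iterate]

end FixedSpace

section DenseConvergence

variable {ι 𝕜 H F : Type*} {l : Filter ι} [NormedField 𝕜] [SeminormedAddCommGroup H]
  [NormedSpace 𝕜 H] [SeminormedAddCommGroup F] [NormedSpace 𝕜 F]

theorem tendsto_apply_of_dense_span {φ : ι → H →L[𝕜] F} {ψ : H →L[𝕜] F} {C : NNReal}
    (hφ : ∀ n, LipschitzWith C (φ n)) {s : Set H}
    (hs : (Submodule.span 𝕜 s).topologicalClosure = ⊤)
    (h : ∀ x ∈ s, Tendsto (fun n => φ n x) l (𝓝 (ψ x))) (x : H) :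
    Tendsto (fun n => φ n x) l (𝓝 (ψ x)) := by
  let S : Submodule 𝕜 H :=
    { carrier := {x | Tendsto (fun n => φ n x) l (𝓝 (ψ x))}
      add_mem' := fun {x y} hx hy => by
        simp only [Set.mem_ofPred_eq, map_add] at hx hy ⊢
        exact hx.add hy
      zero_mem' := by simp only [Set.mem_ofPred_eq, map_zero, tendsto_const_nhds]
      smul_mem' := fun c x hx => by
        simp only [Set.mem_ofPred_eq, map_smul] at hx ⊢
        exact hx.const_smul c }
  have hS : IsClosed (S : Set H) := Equicontinuous.isClosed_setOfPred_tendsto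
    (LipschitzWith.uniformEquicontinuous _ C hφ).equicontinuous ψ.continuous
  have htop : (⊤ : Submodule 𝕜 H) ≤ S :=
    hs ▸ Submodule.topologicalClosure_minimal _ (Submodule.span_le.2 h) hS
  exact htop Submodule.mem_top

end DenseConvergence

section WeakLimits

variable {H : Type*} [NormedAddCommGroup H] [InnerProductSpace ℂ H]
  {A : ℕ → H →L[ℂ] H} {B : H →L[ℂ] H}

theorem weakLimit_of_dense_span (hA : ∀ n, ‖A n‖ ≤ 1) {s : Set H}
    (hs : (Submodule.span ℂ s).topologicalClosure = ⊤)
    (h : ∀ x ∈ s, ∀ y ∈ s, Tendsto (fun n => inner ℂ y (A n x)) atTop (𝓝 (inner ℂ y (B x)))) :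
    WeakLimit A B := by
  have hleft : ∀ x, ∀ y ∈ s,
      Tendsto (fun n => inner ℂ y (A n x)) atTop (𝓝 (inner ℂ y (B x))) := fun x y hy =>
    tendsto_apply_of_dense_span (φ := fun n => innerSL ℂ y ∘L A n) (ψ := innerSL ℂ y ∘L B)
      (C := ‖y‖₊) (fun n => (innerSL ℂ y ∘L A n).lipschitzWith_of_opNorm_le <| by
        simpa using (ContinuousLinearMap.opNorm_comp_le _ _).trans
          (mul_le_mul_of_nonneg_left (hA n) (norm_nonneg (innerSL ℂ y))))
      hs (fun x hx => h x hx y hy) x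
  refine fun x y => ?_
  have hconj := tendsto_apply_of_dense_span (φ := fun n => innerSL ℂ (A n x))
    (ψ := innerSL ℂ (B x)) (C := ‖x‖₊)
    (fun n => (innerSL ℂ (A n x)).lipschitzWith_of_opNorm_le <| by
      simpa using (A n).le_of_opNorm_le (hA n) x)
    hs (fun y hy => by simpa using (hleft x y hy).star) y
  simpa using hconj.star

theorem WeakLimit.commute [CompleteSpace H] {C : H →L[ℂ] H} (h : WeakLimit A B)
    (hC : ∀ n, Commute (A n) C) : Commute B C := by
  refine ContinuousLinearMap.ext fun x => ext_inner_left ℂ fun y => ?_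
  have hright := h x (star C y)
  rw [ContinuousLinearMap.star_eq_adjoint, ContinuousLinearMap.adjoint_inner_left] at hright
  refine tendsto_nhds_unique (h (C x) y) (hright.congr fun n => ?_)
  rw [ContinuousLinearMap.adjoint_inner_left, ← mul_apply_eq_comp, ← (hC n).eq,
    mul_apply_eq_comp]

end WeakLimits

section PositiveFactor

variable {A : Type*} [CStarAlgebra A] [PartialOrder A] [StarOrderedRing A]

/-- `P` is the absolute value of `P * R`, so it commutes with whatever commutes with `P * R` and
its adjoint. -/
theorem commute_of_commute_nonneg_mul {P P' R B : A} (hP : 0 ≤ P) (hP' : P' * P = 1)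
    (hR : star R * R = 1) (hPR : Commute P R) (hB : Commute (P * R) B)
    (hB' : Commute (star (P * R)) B) : Commute R B := by
  have habs : star (P * R) * (P * R) = P * P := by
    rw [hPR.eq, star_mul, (IsSelfAdjoint.of_nonneg hP).star_eq, mul_assoc, ← mul_assoc (star R),
      hR, one_mul]
  have hPB : Commute P B := by
    have hsqrt := (habs ▸ hB'.mul_left hB : Commute (P * P) B).cfcₙ_nnreal NNReal.sqrt
    rwa [show cfcₙ NNReal.sqrt (P * P) = P from CFC.sqrt_mul_self _ hP] at hsqrt
  calc R * B = P' * (P * R * B) := by rw [mul_assoc, ← mul_assoc P', hP', one_mul]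
    _ = P' * (P * B * R) := by rw [hB.eq, ← mul_assoc B, ← hPB.eq]
    _ = B * R := by rw [mul_assoc, ← mul_assoc P', hP', one_mul]

end PositiveFactor

/-! ### Hilbert space tensor products -/

section HilbertTensor

variable {ι : Type*} {E : ι → Type*} [∀ i, NormedAddCommGroup (E i)]
  [∀ i, InnerProductSpace ℂ (E i)]
  {H : Type*} [NormedAddCommGroup H] [InnerProductSpace ℂ H]

/-- `τ` exhibits `H` as the Hilbert space tensor product of the spaces `E i`: the values of `τ` are
the pure tensors. -/
structure IsHilbertTensor [Fintype ι] (τ : MultilinearMap ℂ E H) : Prop where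
  inner_map : ∀ f g, inner ℂ (τ f) (τ g) = ∏ i, inner ℂ (f i) (g i)
  dense : (Submodule.span ℂ (Set.range τ)).topologicalClosure = ⊤

/-- `B` is the tensor product of the operators `b i`. -/
def IsTensor (τ : MultilinearMap ℂ E H) (B : H →L[ℂ] H) (b : ∀ i, E i →L[ℂ] E i) : Prop :=
  ∀ f, B (τ f) = τ fun i => b i (f i)

/-- `B` acts as `b` on the tensor factor `i` and as the identity on the others. -/
def ActsAt [DecidableEq ι] (τ : MultilinearMap ℂ E H) (i : ι) (B : H →L[ℂ] H)
    (b : E i →L[ℂ] E i) : Prop :=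
  ∀ f, B (τ f) = τ (Function.update f i (b (f i)))

variable {τ : MultilinearMap ℂ E H}

namespace IsTensor

variable {B B' : H →L[ℂ] H} {b b' : ∀ i, E i →L[ℂ] E i}

theorem one : IsTensor τ 1 1 := fun _ => rfl

theorem mul (h : IsTensor τ B b) (h' : IsTensor τ B' b') : IsTensor τ (B * B') (b * b') :=
  fun f => by
    rw [mul_apply_eq_comp, h', h]
    rfl

theorem pow (h : IsTensor τ B b) (n : ℕ) : IsTensor τ (B ^ n) (b ^ n) := by
  induction n with
  | zero => exact one
  | succ n ih => rw [pow_succ, pow_succ]; exact ih.mul h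

end IsTensor

namespace ActsAt

variable [DecidableEq ι] {i : ι} {B B' : H →L[ℂ] H} {b b' : E i →L[ℂ] E i}

theorem isTensor (h : ActsAt τ i B b) : IsTensor τ B (Function.update 1 i b) := fun f => by
  rw [h]
  congr 1
  ext j
  obtain rfl | hj := eq_or_ne j i
  · simp
  · simp [hj]

theorem one (i : ι) : ActsAt τ i 1 1 := fun f => by simp

theorem add (h : ActsAt τ i B b) (h' : ActsAt τ i B' b') : ActsAt τ i (B + B') (b + b') :=
  fun f => by rw [_root_.add_apply, _root_.add_apply, h, h', MultilinearMap.map_update_add]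

theorem sub (h : ActsAt τ i B b) (h' : ActsAt τ i B' b') : ActsAt τ i (B - B') (b - b') :=
  fun f => by rw [_root_.sub_apply, _root_.sub_apply, h, h', MultilinearMap.map_update_sub]

theorem smul (c : ℂ) (h : ActsAt τ i B b) : ActsAt τ i (c • B) (c • b) :=
  fun f => by rw [_root_.smul_apply, _root_.smul_apply, h, MultilinearMap.map_update_smul]

theorem mul (h : ActsAt τ i B b) (h' : ActsAt τ i B' b') : ActsAt τ i (B * B') (b * b') :=
  fun f => by
    rw [mul_apply_eq_comp, mul_apply_eq_comp, h', h, Function.update_idem, Function.update_self]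

theorem pow (h : ActsAt τ i B b) (n : ℕ) : ActsAt τ i (B ^ n) (b ^ n) := by
  induction n with
  | zero => exact one i
  | succ n ih => rw [pow_succ, pow_succ]; exact ih.mul h

end ActsAt

theorem exists_isTensor [Finite ι] [DecidableEq ι] {b : ∀ i, E i →L[ℂ] E i}
    (h : ∀ i, ∃ B, ActsAt τ i B (b i)) : ∃ B, IsTensor τ B b := by
  have := Fintype.ofFinite ι
  have partialTensor (s : Finset ι) : ∃ B, IsTensor τ B fun i => if i ∈ s then b i else 1 := by
    induction s using Finset.induction_on with
    | empty => exact ⟨1, fun f => by simp⟩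
    | insert i s hi ih =>
      obtain ⟨B, hB⟩ := ih
      obtain ⟨B', hB'⟩ := h i
      refine ⟨B' * B, fun f => ?_⟩
      rw [mul_apply_eq_comp, hB, hB']
      congr 1
      ext j
      obtain rfl | hj := eq_or_ne j i
      · simp [hi]
      · simp [hj]
  simpa using partialTensor Finset.univ

namespace IsHilbertTensor

variable [Fintype ι] (hτ : IsHilbertTensor τ)

include hτ

theorem norm_map (f : ∀ i, E i) : ‖τ f‖ = ∏ i, ‖f i‖ := by
  have h := hτ.inner_map f f
  simp only [inner_self_eq_norm_sq_to_K, Finset.prod_pow] at h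
  exact (sq_eq_sq₀ (norm_nonneg _) (Finset.prod_nonneg fun _ _ => norm_nonneg _)).1
    (by exact_mod_cast h)

theorem continuous_update [DecidableEq ι] (f : ∀ i, E i) (i : ι) :
    Continuous fun v => τ (Function.update f i v) :=
  (τ.mkContinuous 1 fun f => by rw [hτ.norm_map, one_mul]).cont.comp
    (continuous_const.update i continuous_id)

theorem ext {B B' : H →L[ℂ] H} (h : ∀ f, B (τ f) = B' (τ f)) : B = B' :=
  ContinuousLinearMap.ext_on ((Submodule.dense_iff_topologicalClosure_eq_top).2 hτ.dense)
    (Set.forall_mem_range.2 h)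

theorem eq_zero {x : H} (h : ∀ f, inner ℂ (τ f) x = 0) : x = 0 := by
  have hx : Submodule.span ℂ (Set.range τ) ≤ (ℂ ∙ x)ᗮ :=
    Submodule.span_le.2 <| Set.range_subset_iff.2 fun f =>
      Submodule.mem_orthogonal_singleton_iff_inner_left.2 (h f)
  have htop := Submodule.topologicalClosure_minimal _ hx (Submodule.isClosed_orthogonal _)
  rw [hτ.dense] at htop
  exact inner_self_eq_zero.1 <|
    Submodule.mem_orthogonal_singleton_iff_inner_left.1 (htop Submodule.mem_top)

theorem isTensor_unique {B B' : H →L[ℂ] H} {b : ∀ i, E i →L[ℂ] E i} (h : IsTensor τ B b)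
    (h' : IsTensor τ B' b) : B = B' :=
  hτ.ext fun f => by rw [h, h']

theorem actsAt_unique [DecidableEq ι] {i : ι} {B B' : H →L[ℂ] H} {b : E i →L[ℂ] E i}
    (h : ActsAt τ i B b) (h' : ActsAt τ i B' b) : B = B' :=
  hτ.isTensor_unique h.isTensor h'.isTensor

theorem actsAt_comm_of_ne [DecidableEq ι] {i j : ι} (hij : i ≠ j) {B B' : H →L[ℂ] H}
    {b : E i →L[ℂ] E i} {b' : E j →L[ℂ] E j} (h : ActsAt τ i B b) (h' : ActsAt τ j B' b') :
    B * B' = B' * B :=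
  hτ.ext fun f => by
    rw [mul_apply_eq_comp, mul_apply_eq_comp, h', h, h, h', Function.update_of_ne hij,
      Function.update_of_ne hij.symm, Function.update_comm hij]

theorem actsAt_comm [DecidableEq ι] {i : ι} {B B' : H →L[ℂ] H} {b b' : E i →L[ℂ] E i}
    (h : ActsAt τ i B b) (h' : ActsAt τ i B' b') (hb : b * b' = b' * b) : B * B' = B' * B :=
  hτ.actsAt_unique (h.mul h') (hb ▸ h'.mul h)

theorem weakLimit {A : ℕ → H →L[ℂ] H} {B : H →L[ℂ] H} {a : ℕ → ∀ i, E i →L[ℂ] E i}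
    {b : ∀ i, E i →L[ℂ] E i} (hA : ∀ n, IsTensor τ (A n) (a n)) (hB : IsTensor τ B b)
    (hnorm : ∀ n, ‖A n‖ ≤ 1) (h : ∀ i, WeakLimit (fun n => a n i) (b i)) : WeakLimit A B := by
  refine weakLimit_of_dense_span hnorm hτ.dense ?_
  rintro _ ⟨f, rfl⟩ _ ⟨g, rfl⟩
  simp only [hA _ f, hB f, hτ.inner_map]
  exact tendsto_finsetProd _ fun i _ => h i (f i) (g i)

section UnitVectors

variable [DecidableEq ι] {e : ∀ i, E i} (he : ∀ i, ‖e i‖ = 1)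

include he

theorem norm_map_update (i : ι) (v : E i) : ‖τ (Function.update e i v)‖ = ‖v‖ := by
  rw [hτ.norm_map, Finset.prod_eq_single i (fun j _ hj => by rw [Function.update_of_ne hj, he])
    (fun hi => absurd (Finset.mem_univ i) hi), Function.update_self]

theorem inner_map_update (i : ι) (v : E i) :
    inner ℂ (τ e) (τ (Function.update e i v)) = inner ℂ (e i) v := by
  rw [hτ.inner_map, Finset.prod_eq_single i
    (fun j _ hj => by rw [Function.update_of_ne hj, inner_self_eq_norm_sq_to_K, he]; simp)
    (fun hi => absurd (Finset.mem_univ i) hi), Function.update_self]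

omit [DecidableEq ι] in
theorem fixedSpace_eq_span {B : H →L[ℂ] H} {b : ∀ i, E i →L[ℂ] E i} (hB : IsTensor τ B b)
    (hbe : ∀ i, b i (e i) = e i) (hfix : fixedSpace B = ℂ ∙ τ e) (i : ι) :
    fixedSpace (b i) = ℂ ∙ e i := by
  classical
  have hspan : ℂ ∙ e i ≤ fixedSpace (b i) := (Submodule.span_singleton_le_iff_mem _ _).2 (hbe i)
  refine le_antisymm (fun v hv => ?_) hspan
  set p := (ℂ ∙ e i).starProjection v with hp
  have hperp : v - p ∈ (ℂ ∙ e i)ᗮ := Submodule.sub_starProjection_mem_orthogonal v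
  have hfixed : v - p ∈ fixedSpace (b i) :=
    sub_mem hv (hspan (Submodule.starProjection_apply_mem _ v))
  have hτfixed : τ (Function.update e i (v - p)) ∈ ℂ ∙ τ e := by
    rw [← hfix, mem_fixedSpace, hB]
    congr 1
    ext j
    obtain rfl | hj := eq_or_ne j i
    · simp [mem_fixedSpace.1 hfixed]
    · simp [hj, hbe]
  have hτperp : τ (Function.update e i (v - p)) ∈ (ℂ ∙ τ e)ᗮ := by
    rw [Submodule.mem_orthogonal_singleton_iff_inner_right] at hperp ⊢
    rw [hτ.inner_map_update he, hperp]
  have hzero := Submodule.disjoint_def.1 (Submodule.orthogonal_disjoint _) _ hτfixed hτperp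
  rw [← norm_eq_zero, hτ.norm_map_update he, norm_eq_zero, sub_eq_zero] at hzero
  exact hzero ▸ Submodule.starProjection_apply_mem _ v

end UnitVectors

section Adjoints

variable [∀ i, CompleteSpace (E i)] [CompleteSpace H]

theorem isTensor_star {B B' : H →L[ℂ] H} {b : ∀ i, E i →L[ℂ] E i} (h : IsTensor τ B b)
    (h' : IsTensor τ B' fun i => star (b i)) : star B = B' := by
  refine hτ.ext fun f => sub_eq_zero.1 (hτ.eq_zero fun g => ?_)
  rw [inner_sub_right, ContinuousLinearMap.star_eq_adjoint,
    ContinuousLinearMap.adjoint_inner_right, h, h', hτ.inner_map, hτ.inner_map, sub_eq_zero]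
  simp only [ContinuousLinearMap.star_eq_adjoint, ContinuousLinearMap.adjoint_inner_right]

theorem star_mul_self_eq_one {B : H →L[ℂ] H} {b : ∀ i, E i →L[ℂ] E i} (h : IsTensor τ B b)
    (hb : ∀ i, star (b i) * b i = 1) : star B * B = 1 := by
  refine hτ.ext fun f => sub_eq_zero.1 (hτ.eq_zero fun g => ?_)
  have hb' (i : ι) (x y : E i) : inner ℂ (b i x) (b i y) = inner ℂ x y := by
    rw [← ContinuousLinearMap.adjoint_inner_right, ← ContinuousLinearMap.star_eq_adjoint,
      ← mul_apply_eq_comp, hb, one_apply_eq_self]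
  rw [inner_sub_right, mul_apply_eq_comp, ContinuousLinearMap.star_eq_adjoint,
    ContinuousLinearMap.adjoint_inner_right, h, h, one_apply_eq_self, hτ.inner_map, hτ.inner_map]
  simp only [hb', sub_self]

theorem actsAt_star [DecidableEq ι] {i : ι} {B B' : H →L[ℂ] H} {b : E i →L[ℂ] E i}
    (h : ActsAt τ i B b) (h' : ActsAt τ i B' (star b)) : star B = B' := by
  refine hτ.isTensor_star h.isTensor ?_
  convert h'.isTensor using 1
  ext1 j
  obtain rfl | hj := eq_or_ne j i
  · simp
  · simp [hj]

theorem actsAt_fixProj [DecidableEq ι] {i : ι} {B : H →L[ℂ] H} {b : E i →L[ℂ] E i}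
    (h : ActsAt τ i B b) (hB : ‖B‖ ≤ 1) (hb : ‖b‖ ≤ 1) : ActsAt τ i (fixProj B) (fixProj b) := by
  intro f
  have hlim := ((hτ.continuous_update f i).tendsto _).comp (tendsto_fixProj hb (f i))
  refine tendsto_nhds_unique (tendsto_fixProj hB (τ f)) (hlim.congr fun N => ?_)
  rw [Function.comp_apply, MultilinearMap.map_update_smul, MultilinearMap.map_update_sum]
  exact congrArg _ (Finset.sum_congr rfl fun n _ => ((h.pow n) f).symm)

theorem commute_of_weakLimit [DecidableEq ι] {G : Type*} [AddGroup G] {U : G → H →L[ℂ] H}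
    (hU : IsUnitaryRep U) {Q : ∀ i, G → E i →L[ℂ] E i} (hQ : ∀ i, IsUnitaryRep (Q i))
    (hUQ : ∀ z, IsTensor τ (U z) fun i => Q i z) {w : ℕ → G} {s s' : ∀ j, E j →L[ℂ] E j}
    (hs : ∀ j, ∃ S, ActsAt τ j S (s j)) (hs' : ∀ j, ∃ S, ActsAt τ j S (s' j))
    (hstar : ∀ j, star (s j) = s j) (hinv : ∀ j, s' j * s j = 1) {z : ι → G}
    (hcomm : ∀ j, s j * Q j (z j) = Q j (z j) * s j)
    (hlim : ∀ j, WeakLimit (fun n => Q j (w n)) (s j * s j * Q j (z j))) {R : H →L[ℂ] H}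
    (hR : IsTensor τ R fun j => Q j (z j)) {B : H →L[ℂ] H} (hB : B ∈ commutant U) :
    Commute R B := by
  obtain ⟨S, hS⟩ := exists_isTensor hs
  obtain ⟨S', hS'⟩ := exists_isTensor hs'
  have hSsa : star S = S := hτ.isTensor_star hS (by simpa only [hstar] using hS)
  have hinv' : S' * S = 1 := hτ.isTensor_unique (hS'.mul hS) fun f => by simp [hinv]
  have hSR : Commute S R := by
    refine hτ.isTensor_unique (hS.mul hR) ?_
    rw [show (s * fun j => Q j (z j)) = (fun j => Q j (z j)) * s from funext hcomm]
    exact hR.mul hS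
  have hRR : star R * R = 1 := hτ.star_mul_self_eq_one hR fun j => (hQ j).star_mul_self _
  have hweak : WeakLimit (fun n => U (w n)) (S * S * R) :=
    hτ.weakLimit (fun n => hUQ (w n)) ((hS.mul hS).mul hR) (fun n => hU.norm_le_one _) hlim
  have hcommutant {C : H →L[ℂ] H} (hC : C ∈ commutant U) : Commute (S * S * R) C :=
    hweak.commute fun n =>
      ContinuousLinearMap.ext fun x => ((hU.mem_commutant.1 hC) (w n) x).symm
  refine commute_of_commute_nonneg_mul (P' := S' * S') ?_ ?_ hRR (hSR.mul_left hSR)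
    (hcommutant hB) (by simpa using (hcommutant (star_mem hB)).star_star)
  · simpa only [hSsa] using star_mul_self_nonneg S
  · rw [mul_assoc, ← mul_assoc S' S, hinv', one_mul, hinv']

end Adjoints

end IsHilbertTensor

end HilbertTensor

/-! ### Koopman operators on product spaces -/

section Koop

variable {X : Type*} [MeasurableSpace X] {μ : Measure X} {g h : X → X}

/-- Composition with a measure preserving map, as an operator on `L²`. -/
noncomputable def koop (g : X → X) (hg : MeasurePreserving g μ μ) : Lp ℂ 2 μ →L[ℂ] Lp ℂ 2 μ :=
  (Lp.compMeasurePreservingₗᵢ ℂ g hg).toContinuousLinearMap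

theorem coeFn_koop (hg : MeasurePreserving g μ μ) (f : Lp ℂ 2 μ) : koop g hg f =ᵐ[μ] f ∘ g :=
  Lp.coeFn_compMeasurePreserving f hg

theorem norm_koop_le (hg : MeasurePreserving g μ μ) : ‖koop g hg‖ ≤ 1 :=
  ContinuousLinearMap.opNorm_le_bound _ zero_le_one fun f =>
    (Lp.norm_compMeasurePreserving f hg).le.trans_eq (one_mul _).symm

theorem koop_mul (hg : MeasurePreserving g μ μ) (hh : MeasurePreserving h μ μ) :
    koop g hg * koop h hh = koop (h ∘ g) (hh.comp hg) := by
  refine ContinuousLinearMap.ext fun f => Lp.ext ?_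
  rw [mul_apply_eq_comp]
  filter_upwards [coeFn_koop hg (koop h hh f), coeFn_koop (hh.comp hg) f,
    hg.quasiMeasurePreserving.ae (coeFn_koop hh f)] with x hleft hcomp hright
  rw [hleft, hcomp, Function.comp_apply, hright]
  rfl

theorem koop_congr (hg : MeasurePreserving g μ μ) (hh : MeasurePreserving h μ μ)
    (hgh : ∀ x, g x = h x) : koop g hg = koop h hh := by
  obtain rfl : g = h := funext hgh
  rfl

theorem koop_mul_congr {g' h' : X → X} (hg : MeasurePreserving g μ μ)
    (hh : MeasurePreserving h μ μ) (hg' : MeasurePreserving g' μ μ)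
    (hh' : MeasurePreserving h' μ μ) (hcomp : ∀ x, h (g x) = h' (g' x)) :
    koop g hg * koop h hh = koop g' hg' * koop h' hh' := by
  rw [koop_mul, koop_mul]
  exact koop_congr _ _ hcomp

theorem koop_id : koop (id : X → X) (MeasurePreserving.id μ) = 1 :=
  ContinuousLinearMap.ext fun f => Lp.ext (coeFn_koop (MeasurePreserving.id μ) f)

theorem koop_mul_eq_one (hg : MeasurePreserving g μ μ) (hh : MeasurePreserving h μ μ)
    (hhg : Function.LeftInverse h g) : koop g hg * koop h hh = 1 :=
  (koop_mul hg hh).trans <| (koop_congr _ (MeasurePreserving.id μ) hhg).trans koop_id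

theorem inner_koop (hg : MeasurePreserving g μ μ) (f f' : Lp ℂ 2 μ) :
    inner ℂ (koop g hg f) (koop g hg f') = inner ℂ f f' :=
  (Lp.compMeasurePreservingₗᵢ ℂ g hg).inner_map_map f f'

theorem star_koop (hg : MeasurePreserving g μ μ) (hh : MeasurePreserving h μ μ)
    (hhg : Function.LeftInverse h g) : star (koop g hg) = koop h hh := by
  rw [ContinuousLinearMap.star_eq_adjoint, eq_comm, ContinuousLinearMap.eq_adjoint_iff]
  intro x y
  rw [← inner_koop hg, ← mul_apply_eq_comp, koop_mul_eq_one hg hh hhg, one_apply_eq_self]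

end Koop

theorem ae_eq_zero_of_setIntegral_eq_zero_of_isPiSystem {Ω E : Type*} [m : MeasurableSpace Ω]
    {P : Measure Ω} [NormedAddCommGroup E] [NormedSpace ℝ E] [CompleteSpace E] {C : Set (Set Ω)}
    (hC : m = MeasurableSpace.generateFrom C) (hpi : IsPiSystem C) {f : Ω → E}
    (hf : Integrable f P) (hzero : ∀ s ∈ C, ∫ ω in s, f ω ∂P = 0) (huniv : ∫ ω, f ω ∂P = 0) :
    f =ᵐ[P] 0 := by
  suffices hset : ∀ s, MeasurableSet s → ∫ ω in s, f ω ∂P = 0 from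
    hf.ae_eq_zero_of_forall_setIntegral_eq_zero fun s hs _ => hset s hs
  intro s hs
  induction s, hs using MeasurableSpace.induction_on_inter hC hpi with
  | empty => simp
  | basic s hs => exact hzero s hs
  | compl s hs ih => rw [← huniv, ← integral_add_compl hs hf, ih, zero_add]
  | iUnion s hd hs ih => simp [integral_iUnion hs hd hf.integrableOn, ih]

/-- The indicator function of `s`, as a vector of `L²`. -/
noncomputable def indicatorL2 {Ω : Type*} [MeasurableSpace Ω] (P : Measure Ω) [IsFiniteMeasure P]
    {s : Set Ω} (hs : MeasurableSet s) : Lp ℂ 2 P :=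
  indicatorConstLp 2 hs (measure_ne_top P s) (1 : ℂ)

theorem coeFn_indicatorL2 {Ω : Type*} [MeasurableSpace Ω] {P : Measure Ω} [IsFiniteMeasure P]
    {s : Set Ω} (hs : MeasurableSet s) : indicatorL2 P hs =ᵐ[P] s.indicator 1 :=
  indicatorConstLp_coeFn

theorem eq_zero_of_inner_indicatorL2_eq_zero {Ω : Type*} [m : MeasurableSpace Ω] {P : Measure Ω}
    [IsFiniteMeasure P] {C : Set (Set Ω)} (hC : m = MeasurableSpace.generateFrom C)
    (hpi : IsPiSystem C) (huniv : Set.univ ∈ C) {x : Lp ℂ 2 P}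
    (hx : ∀ s ∈ C, ∀ hs : MeasurableSet s, inner ℂ (indicatorL2 P hs) x = 0) : x = 0 := by
  have hzero : ∀ s ∈ C, ∫ ω in s, x ω ∂P = 0 := fun s hs => by
    have hsm : MeasurableSet s := hC ▸ MeasurableSpace.measurableSet_generateFrom hs
    rw [← hx s hs hsm, indicatorL2, L2.inner_indicatorConstLp_one]
  refine Lp.ext ((ae_eq_zero_of_setIntegral_eq_zero_of_isPiSystem hC hpi
    ((Lp.memLp x).integrable one_le_two) hzero ?_).trans (Lp.coeFn_zero ℂ 2 P).symm)
  simpa using hzero _ huniv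

section Pi

variable {ι : Type*} [Fintype ι] {Y : ι → Type*} [∀ i, MeasurableSpace (Y i)]
  {ν : ∀ i, Measure (Y i)} [∀ i, IsProbabilityMeasure (ν i)]

theorem memLp_prod_eval (f : ∀ i, Lp ℂ 2 (ν i)) :
    MemLp (fun y : ∀ i, Y i => ∏ i, f i (y i)) 2 (Measure.pi ν) := by
  have hm : AEStronglyMeasurable (fun y : ∀ i, Y i => ∏ i, f i (y i)) (Measure.pi ν) :=
    Finset.aestronglyMeasurable_fun_prod _ fun i _ =>
      (Lp.aestronglyMeasurable (f i)).comp_quasiMeasurePreserving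
        (Measure.quasiMeasurePreserving_eval ν i)
  rw [memLp_two_iff_integrable_sq_norm hm]
  simp only [norm_prod, ← Finset.prod_pow]
  exact Integrable.fintype_prod_dep fun i =>
    (memLp_two_iff_integrable_sq_norm (Lp.aestronglyMeasurable (f i))).1 (Lp.memLp (f i))

theorem ae_pi_eval {i : ι} {p : Y i → Prop} (h : ∀ᵐ x ∂(ν i), p x) :
    ∀ᵐ y ∂(Measure.pi ν), p (y i) :=
  (Measure.quasiMeasurePreserving_eval ν i).ae h

omit [Fintype ι] [∀ i, IsProbabilityMeasure (ν i)] in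
theorem update_coeFn_apply [DecidableEq ι] (f : ∀ i, Lp ℂ 2 (ν i)) (i : ι) (u : Lp ℂ 2 (ν i))
    (y : ∀ i, Y i) (j : ι) : (Function.update f i u j : Y j → ℂ) (y j) =
      Function.update (fun j => f j (y j)) i (u (y i)) j :=
  Function.apply_update (fun j (f : Lp ℂ 2 (ν j)) => f (y j)) f i u j

variable (ν) in
/-- The map taking `f` to the function `y ↦ ∏ i, f i (y i)`, which exhibits `L²(∏ Y i)` as the
tensor product of the spaces `L²(Y i)`. -/
noncomputable def piTensor : MultilinearMap ℂ (fun i => Lp ℂ 2 (ν i)) (Lp ℂ 2 (Measure.pi ν)) where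
  toFun f := (memLp_prod_eval f).toLp
  map_update_add' := by
    refine fun f i u v => Lp.ext ?_
    filter_upwards [(memLp_prod_eval (Function.update f i (u + v))).coeFn_toLp,
      (memLp_prod_eval (Function.update f i u)).coeFn_toLp,
      (memLp_prod_eval (Function.update f i v)).coeFn_toLp,
      Lp.coeFn_add (memLp_prod_eval (Function.update f i u)).toLp
        (memLp_prod_eval (Function.update f i v)).toLp,
      ae_pi_eval (Lp.coeFn_add u v)] with y huv hu hv hadd huvi
    rw [hadd, Pi.add_apply, huv, hu, hv]
    simp only [update_coeFn_apply, Finset.prod_update_of_mem (Finset.mem_univ i), huvi,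
      Pi.add_apply, add_mul]
  map_update_smul' := by
    refine fun f i c u => Lp.ext ?_
    filter_upwards [(memLp_prod_eval (Function.update f i (c • u))).coeFn_toLp,
      (memLp_prod_eval (Function.update f i u)).coeFn_toLp,
      Lp.coeFn_smul c (memLp_prod_eval (Function.update f i u)).toLp,
      ae_pi_eval (Lp.coeFn_smul c u)] with y hcu hu hsmul hcui
    rw [hsmul, Pi.smul_apply, hcu, hu]
    simp only [update_coeFn_apply, Finset.prod_update_of_mem (Finset.mem_univ i), hcui,
      Pi.smul_apply, smul_eq_mul, mul_assoc]

theorem coeFn_piTensor (f : ∀ i, Lp ℂ 2 (ν i)) :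
    piTensor ν f =ᵐ[Measure.pi ν] fun y => ∏ i, f i (y i) :=
  (memLp_prod_eval f).coeFn_toLp

theorem piTensor_indicatorL2 {s : ∀ i, Set (Y i)} (hs : ∀ i, MeasurableSet (s i)) :
    piTensor ν (fun i => indicatorL2 (ν i) (hs i)) =
      indicatorL2 (Measure.pi ν) (MeasurableSet.univ_pi hs) := by
  refine Lp.ext ?_
  have hcoe : ∀ᵐ y ∂(Measure.pi ν), ∀ i,
      (indicatorL2 (ν i) (hs i) : Y i → ℂ) (y i) = (s i).indicator 1 (y i) :=
    ae_all_iff.2 fun i => ae_pi_eval (coeFn_indicatorL2 (hs i))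
  filter_upwards [coeFn_piTensor fun i => indicatorL2 (ν i) (hs i), hcoe,
    coeFn_indicatorL2 (P := Measure.pi ν) (MeasurableSet.univ_pi hs)] with y htensor hfactor hbox
  rw [htensor, hbox, ← Finset.coe_univ, Set.indicator_pi_one_apply]
  simp only [hfactor]

theorem isHilbertTensor_piTensor : IsHilbertTensor (piTensor ν) where
  inner_map f g := by
    simp only [L2.inner_def]
    rw [← integral_fintype_prod_eq_prod]
    refine integral_congr_ae ?_
    filter_upwards [coeFn_piTensor f, coeFn_piTensor g] with y hf hg
    rw [hf, hg]
    simp only [RCLike.inner_apply, map_prod, Finset.prod_mul_distrib]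
  dense := by
    rw [Submodule.topologicalClosure_eq_top_iff, eq_bot_iff]
    refine fun x hx => (Submodule.mem_bot ℂ).2 <| eq_zero_of_inner_indicatorL2_eq_zero
      generateFrom_pi.symm isPiSystem_pi
      ⟨fun _ => Set.univ, fun _ _ => MeasurableSet.univ, Set.pi_univ _⟩ ?_
    rintro _ ⟨s, hs, rfl⟩ _
    have hbox := piTensor_indicatorL2 (ν := ν) fun i => hs i (Set.mem_univ i)
    exact hbox ▸ (Submodule.mem_orthogonal _ _).1 hx _ (Submodule.subset_span ⟨_, rfl⟩)

theorem isTensor_koop {g : ∀ i, Y i → Y i} (hg : ∀ i, MeasurePreserving (g i) (ν i) (ν i)) :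
    IsTensor (piTensor ν) (koop (fun y i => g i (y i)) (measurePreserving_pi ν ν hg))
      fun i => koop (g i) (hg i) := by
  refine fun f => Lp.ext ?_
  have hfactor : ∀ᵐ y ∂(Measure.pi ν), ∀ i,
      (koop (g i) (hg i) (f i) : Y i → ℂ) (y i) = f i (g i (y i)) :=
    ae_all_iff.2 fun i => ae_pi_eval (coeFn_koop (hg i) (f i))
  filter_upwards [coeFn_koop (measurePreserving_pi ν ν hg) (piTensor ν f),
    coeFn_piTensor fun i => koop (g i) (hg i) (f i), hfactor,
    (measurePreserving_pi ν ν hg).quasiMeasurePreserving.ae (coeFn_piTensor f)]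
    with y hkoop htensor hfactor htensor'
  rw [hkoop, htensor, Function.comp_apply, htensor']
  simp only [hfactor]

variable [DecidableEq ι] {i : ι} {g : Y i → Y i} (hg : MeasurePreserving g (ν i) (ν i))

include hg in
theorem measurePreserving_update :
    MeasurePreserving (fun y => Function.update y i (g (y i))) (Measure.pi ν) (Measure.pi ν) := by
  have hfactor (j : ι) :
      MeasurePreserving (Function.update (fun j => (id : Y j → Y j)) i g j) (ν j) (ν j) := by
    obtain rfl | hj := eq_or_ne j i
    · simpa using hg
    · simpa [hj] using MeasurePreserving.id (ν j)
  convert measurePreserving_pi ν ν hfactor using 1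
  funext y j
  obtain rfl | hj := eq_or_ne j i
  · simp
  · simp [hj]

/-- The Koopman operator of the map applying `g` to the coordinate `i` of a product. -/
noncomputable def koopAt : Lp ℂ 2 (Measure.pi ν) →L[ℂ] Lp ℂ 2 (Measure.pi ν) :=
  koop _ (measurePreserving_update hg)

theorem norm_koopAt_le : ‖koopAt hg‖ ≤ 1 := norm_koop_le _

theorem actsAt_koopAt : ActsAt (piTensor ν) i (koopAt hg) (koop g hg) := by
  refine fun f => Lp.ext ?_
  filter_upwards [coeFn_koop (measurePreserving_update hg) (piTensor ν f),
    coeFn_piTensor (Function.update f i (koop g hg (f i))),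
    ae_pi_eval (coeFn_koop hg (f i)),
    (measurePreserving_update hg).quasiMeasurePreserving.ae (coeFn_piTensor f)]
    with y hkoop htensor hfactor htensor'
  rw [koopAt, hkoop, htensor, Function.comp_apply, htensor']
  simp only [update_coeFn_apply, Function.apply_update (fun j x => (f j : Y j → ℂ) x), hfactor,
    Function.comp_apply]

end Pi

theorem IsHilbertTensor.comp_linearIsometry {ι : Type*} [Fintype ι] {E : ι → Type*}
    [∀ i, NormedAddCommGroup (E i)] [∀ i, InnerProductSpace ℂ (E i)] {H H' : Type*}
    [NormedAddCommGroup H] [InnerProductSpace ℂ H] [NormedAddCommGroup H'] [InnerProductSpace ℂ H']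
    {τ : MultilinearMap ℂ E H} (hτ : IsHilbertTensor τ) {Φ : H →ₗᵢ[ℂ] H'} (hΦ : DenseRange Φ) :
    IsHilbertTensor (Φ.toLinearMap.compMultilinearMap τ) where
  inner_map f g := (Φ.inner_map_map _ _).trans (hτ.inner_map f g)
  dense := by
    rw [LinearMap.coe_compMultilinearMap, Set.range_comp, Submodule.span_image,
      ← Submodule.dense_iff_topologicalClosure_eq_top, Submodule.map_coe]
    exact hΦ.dense_image Φ.continuous (Submodule.dense_iff_topologicalClosure_eq_top.2 hτ.dense)

section Prod

variable {X : Type*} [MeasurableSpace X] {μ : Measure X}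

variable {p : X → Prop}

theorem ae_prod_fst (h : ∀ᵐ x ∂μ, p x) : ∀ᵐ y ∂(μ.prod μ), p y.1 :=
  Measure.quasiMeasurePreserving_fst.ae h

theorem ae_prod_snd (h : ∀ᵐ x ∂μ, p x) : ∀ᵐ y ∂(μ.prod μ), p y.2 :=
  Measure.quasiMeasurePreserving_snd.ae h

variable [IsProbabilityMeasure μ]

variable (μ) in
/-- The map taking `f` to the function `(x, y) ↦ f 0 x * f 1 y`, which exhibits `L²(X × X)` as the
tensor square of `L²(X)`; it is obtained from `piTensor` by identifying `Fin 2 → X` with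
`X × X`. -/
noncomputable def prodTensor :
    MultilinearMap ℂ (fun _ : Fin 2 => Lp ℂ 2 μ) (Lp ℂ 2 (μ.prod μ)) :=
  (Lp.compMeasurePreservingₗᵢ ℂ _ (measurePreserving_finTwoArrow μ).symm
    ).toLinearMap.compMultilinearMap (piTensor fun _ => μ)

theorem coeFn_prodTensor (f : Fin 2 → Lp ℂ 2 μ) :
    prodTensor μ f =ᵐ[μ.prod μ] fun p => f 0 p.1 * f 1 p.2 := by
  have harrow := (measurePreserving_finTwoArrow μ).symm
  filter_upwards [Lp.coeFn_compMeasurePreserving (piTensor (fun _ => μ) f) harrow,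
    harrow.quasiMeasurePreserving.ae (coeFn_piTensor f)] with p hcomp htensor
  exact hcomp.trans (htensor.trans (Fin.prod_univ_two _))

theorem isHilbertTensor_prodTensor : IsHilbertTensor (prodTensor μ) := by
  refine isHilbertTensor_piTensor.comp_linearIsometry (Function.Surjective.denseRange fun F => ?_)
  have harrow := measurePreserving_finTwoArrow μ
  refine ⟨Lp.compMeasurePreserving _ harrow F, Lp.ext ?_⟩
  filter_upwards [Lp.coeFn_compMeasurePreserving (Lp.compMeasurePreserving _ harrow F) harrow.symm,
    harrow.symm.quasiMeasurePreserving.ae (Lp.coeFn_compMeasurePreserving F harrow)] with p h h'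
  exact h.trans h'

variable {g h : X → X}

theorem isTensor_koop_prodMap (hg : MeasurePreserving g μ μ) (hh : MeasurePreserving h μ μ) :
    IsTensor (prodTensor μ) (koop (Prod.map g h) (hg.prod hh)) ![koop g hg, koop h hh] := by
  refine fun f => Lp.ext ?_
  filter_upwards [coeFn_koop (hg.prod hh) (prodTensor μ f),
    coeFn_prodTensor fun i => (![koop g hg, koop h hh] : Fin 2 → _) i (f i),
    ae_prod_fst (coeFn_koop hg (f 0)), ae_prod_snd (coeFn_koop hh (f 1)),
    (hg.prod hh).quasiMeasurePreserving.ae (coeFn_prodTensor f)] with p hkoop htensor hfst hsnd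
    htensor'
  rw [hkoop, htensor, Function.comp_apply, htensor']
  simp [hfst, hsnd]

theorem actsAt_koop_fst (hg : MeasurePreserving g μ μ) :
    ActsAt (prodTensor μ) 0 (koop (Prod.map g id) (hg.prod (MeasurePreserving.id μ)))
      (koop g hg) := by
  intro f
  rw [isTensor_koop_prodMap hg (MeasurePreserving.id μ)]
  congr 1
  ext1 i
  fin_cases i <;> simp [koop_id]

theorem actsAt_koop_snd (hg : MeasurePreserving g μ μ) :
    ActsAt (prodTensor μ) 1 (koop (Prod.map id g) ((MeasurePreserving.id μ).prod hg))
      (koop g hg) := by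
  intro f
  rw [isTensor_koop_prodMap (MeasurePreserving.id μ) hg]
  congr 1
  ext1 i
  fin_cases i <;> simp [koop_id]

end Prod

section Constants

variable {X : Type*} [MeasurableSpace X] (μ : Measure X) [IsProbabilityMeasure μ] {g : X → X}

/-- The constant function `1`, as a vector of `L²`. -/
noncomputable def oneL2 : Lp ℂ 2 μ := Lp.const 2 μ (1 : ℂ)

theorem coeFn_oneL2 : oneL2 μ =ᵐ[μ] fun _ => (1 : ℂ) := Lp.coeFn_const 2 μ 1

theorem norm_oneL2 : ‖oneL2 μ‖ = 1 := by
  simp [oneL2, Lp.norm_const']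

theorem constants_eq_span_oneL2 : L2.constants μ = ℂ ∙ oneL2 μ := rfl

theorem Theta_apply (v : Lp ℂ 2 μ) : L2.Theta μ v = inner ℂ (oneL2 μ) v • oneL2 μ :=
  Submodule.starProjection_unit_singleton ℂ (norm_oneL2 μ) v

theorem star_Theta : star (L2.Theta μ) = L2.Theta μ :=
  (isStarProjection_starProjection (U := L2.constants μ)).isSelfAdjoint

theorem Theta_mul_Theta : L2.Theta μ * L2.Theta μ = L2.Theta μ :=
  (L2.constants μ).isIdempotentElem_starProjection

variable {μ}

theorem fixProj_eq_Theta {B : Lp ℂ 2 μ →L[ℂ] Lp ℂ 2 μ} (h : fixedSpace B = L2.constants μ) :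
    fixProj B = L2.Theta μ := by
  unfold fixProj L2.Theta
  congr

theorem koop_oneL2 (hg : MeasurePreserving g μ μ) : koop g hg (oneL2 μ) = oneL2 μ := by
  refine Lp.ext ?_
  filter_upwards [coeFn_koop hg (oneL2 μ), coeFn_oneL2 μ,
    hg.quasiMeasurePreserving.ae (coeFn_oneL2 μ)] with x hkoop hone hone'
  rw [hkoop, hone, Function.comp_apply, hone']

theorem constants_le_fixedSpace_koop (hg : MeasurePreserving g μ μ) :
    L2.constants μ ≤ fixedSpace (koop g hg) := by
  rw [constants_eq_span_oneL2, Submodule.span_singleton_le_iff_mem]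
  exact koop_oneL2 hg

theorem koop_mul_Theta (hg : MeasurePreserving g μ μ) :
    koop g hg * L2.Theta μ = L2.Theta μ := by
  ext1 v
  rw [mul_apply_eq_comp, Theta_apply, map_smul, koop_oneL2]

theorem Theta_mul_koop (hg : MeasurePreserving g μ μ) :
    L2.Theta μ * koop g hg = L2.Theta μ := by
  ext1 v
  rw [mul_apply_eq_comp, Theta_apply, Theta_apply]
  conv_lhs => rw [← koop_oneL2 hg, inner_koop, koop_oneL2]

theorem fixedSpace_koop_of_ergodic (hg : Ergodic g μ) :
    fixedSpace (koop g hg.toMeasurePreserving) = L2.constants μ := by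
  refine le_antisymm (fun f hf => ?_) (constants_le_fixedSpace_koop hg.toMeasurePreserving)
  have hinvariant : f ∘ g =ᵐ[μ] f := by
    have hkoop := coeFn_koop hg.toMeasurePreserving f
    rw [mem_fixedSpace.1 hf] at hkoop
    exact hkoop.symm
  obtain ⟨c, hc⟩ := hg.ae_eq_const_of_ae_eq_comp_ae (Lp.aestronglyMeasurable f) hinvariant
  refine Submodule.mem_span_singleton.2 ⟨c, Lp.ext ?_⟩
  filter_upwards [hc, Lp.coeFn_smul c (oneL2 μ), coeFn_oneL2 μ] with x hfx hsmul hone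
  rw [hfx, Function.const_apply]
  exact hsmul.trans (by rw [Pi.smul_apply, hone, smul_eq_mul, mul_one])

variable (μ) in
theorem prodTensor_oneL2 : prodTensor μ (fun _ => oneL2 μ) = oneL2 (μ.prod μ) := by
  refine Lp.ext ?_
  filter_upwards [coeFn_prodTensor fun _ => oneL2 μ, coeFn_oneL2 (μ.prod μ),
    ae_prod_fst (coeFn_oneL2 μ), ae_prod_snd (coeFn_oneL2 μ)] with p htensor hone hfst hsnd
  rw [htensor, hone, hfst, hsnd, one_mul]

theorem piTensor_oneL2 {ι : Type*} [Fintype ι] {Y : ι → Type*} [∀ i, MeasurableSpace (Y i)]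
    (ν : ∀ i, Measure (Y i)) [∀ i, IsProbabilityMeasure (ν i)] :
    piTensor ν (fun i => oneL2 (ν i)) = oneL2 (Measure.pi ν) := by
  refine Lp.ext ?_
  have hfactor : ∀ᵐ y ∂(Measure.pi ν), ∀ i, (oneL2 (ν i) : Y i → ℂ) (y i) = 1 :=
    ae_all_iff.2 fun i => ae_pi_eval (coeFn_oneL2 (ν i))
  filter_upwards [coeFn_piTensor fun i => oneL2 (ν i), coeFn_oneL2 (Measure.pi ν), hfactor]
    with y htensor hone hfactor
  rw [htensor, hone]
  exact Finset.prod_eq_one fun i _ => hfactor i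

end Constants

section Conjugation

variable {X : Type*} [MeasurableSpace X] {μ : Measure X} {g g' : X → X}

theorem inner_star_star (f h : Lp ℂ 2 μ) : inner ℂ (star f) (star h) = inner ℂ h f := by
  rw [L2.inner_def, L2.inner_def]
  refine integral_congr_ae ?_
  filter_upwards [Lp.coeFn_star f, Lp.coeFn_star h] with x hf hh
  rw [hf, hh, Pi.star_apply, Pi.star_apply, RCLike.inner_apply', RCLike.inner_apply,
    Complex.star_def, Complex.conj_conj]

theorem koop_star (hg : MeasurePreserving g μ μ) (f : Lp ℂ 2 μ) :
    koop g hg (star f) = star (koop g hg f) := by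
  refine Lp.ext ?_
  filter_upwards [coeFn_koop hg (star f), coeFn_koop hg f, Lp.coeFn_star (koop g hg f),
    hg.quasiMeasurePreserving.ae (Lp.coeFn_star f)] with x hkoop hkoop' hstar hstar'
  rw [hkoop, hstar, Function.comp_apply, hstar', Pi.star_apply, Pi.star_apply, hkoop',
    Function.comp_apply]

theorem koop_pow_star (hg : MeasurePreserving g μ μ) (n : ℕ) (f : Lp ℂ 2 μ) :
    (koop g hg ^ n) (star f) = star ((koop g hg ^ n) f) := by
  induction n with
  | zero => rfl
  | succ n ih => rw [pow_succ', mul_apply_eq_comp, mul_apply_eq_comp, ih, koop_star]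

variable [IsProbabilityMeasure μ]

theorem star_oneL2 : star (oneL2 μ) = oneL2 μ := by
  refine Lp.ext ?_
  filter_upwards [Lp.coeFn_star (oneL2 μ), coeFn_oneL2 μ] with x hstar hone
  rw [hstar, Pi.star_apply, hone, star_one]

/-- Complex conjugation on the second factor exchanges `g` with its inverse. -/
theorem inner_koop_prodMap_inv_pow (hg : MeasurePreserving g μ μ) (hg' : MeasurePreserving g' μ μ)
    (hinv : Function.LeftInverse g' g) (n : ℕ) (f₁ h₁ f₂ h₂ : Lp ℂ 2 μ) :
    inner ℂ (prodTensor μ ![f₁, h₁])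
        ((koop (Prod.map g g') (hg.prod hg') ^ n) (prodTensor μ ![f₂, h₂])) =
      inner ℂ (prodTensor μ ![f₁, star h₂])
        ((koop (Prod.map g g) (hg.prod hg) ^ n) (prodTensor μ ![f₂, star h₁])) := by
  have hconj : inner ℂ h₁ ((koop g' hg' ^ n) h₂) =
      inner ℂ (star h₂) ((koop g hg ^ n) (star h₁)) := by
    rw [koop_pow_star, inner_star_star, ← star_koop hg hg' hinv, ← star_pow,
      ContinuousLinearMap.star_eq_adjoint, ContinuousLinearMap.adjoint_inner_right]
  rw [(isTensor_koop_prodMap hg hg').pow n, (isTensor_koop_prodMap hg hg).pow n,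
    isHilbertTensor_prodTensor.inner_map, isHilbertTensor_prodTensor.inner_map,
    Fin.prod_univ_two, Fin.prod_univ_two]
  exact congrArg _ hconj

theorem inner_prodTensor_Theta (f₁ h₁ f₂ h₂ : Lp ℂ 2 μ) :
    inner ℂ (prodTensor μ ![f₁, h₁]) (L2.Theta (μ.prod μ) (prodTensor μ ![f₂, h₂])) =
      inner ℂ (oneL2 μ) f₂ * inner ℂ (oneL2 μ) h₂ *
        (inner ℂ f₁ (oneL2 μ) * inner ℂ h₁ (oneL2 μ)) := by
  rw [Theta_apply, inner_smul_right, ← prodTensor_oneL2, isHilbertTensor_prodTensor.inner_map,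
    isHilbertTensor_prodTensor.inner_map, Fin.prod_univ_two, Fin.prod_univ_two]
  rfl

theorem fixProj_koop_prodMap_inv (hg : MeasurePreserving g μ μ) (hg' : MeasurePreserving g' μ μ)
    (hinv : Function.LeftInverse g' g)
    (hfix : fixedSpace (koop (Prod.map g g) (hg.prod hg)) = L2.constants (μ.prod μ)) :
    fixProj (koop (Prod.map g g') (hg.prod hg')) = L2.Theta (μ.prod μ) := by
  have hlim {V : Lp ℂ 2 (μ.prod μ) →L[ℂ] Lp ℂ 2 (μ.prod μ)} (hV : ‖V‖ ≤ 1)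
      (x y : Lp ℂ 2 (μ.prod μ)) :
      Tendsto (fun N : ℕ => (N : ℂ)⁻¹ * ∑ n ∈ Finset.range N, inner ℂ y ((V ^ n) x)) atTop
        (𝓝 (inner ℂ y (fixProj V x))) := by
    refine (tendsto_const_nhds.inner (𝕜 := ℂ) (tendsto_fixProj hV x)).congr fun N => ?_
    rw [inner_smul_right, inner_sum]
  have hswap (f₁ h₁ f₂ h₂ : Lp ℂ 2 μ) :
      inner ℂ (prodTensor μ ![f₁, h₁])
          (fixProj (koop (Prod.map g g') (hg.prod hg')) (prodTensor μ ![f₂, h₂])) =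
        inner ℂ (prodTensor μ ![f₁, h₁]) (L2.Theta (μ.prod μ) (prodTensor μ ![f₂, h₂])) := calc
    _ = inner ℂ (prodTensor μ ![f₁, star h₂])
          (fixProj (koop (Prod.map g g) (hg.prod hg)) (prodTensor μ ![f₂, star h₁])) := by
      refine tendsto_nhds_unique ((hlim (norm_koop_le _) _ _).congr fun N => ?_)
        (hlim (norm_koop_le _) _ _)
      simp only [inner_koop_prodMap_inv_pow hg hg' hinv]
    _ = _ := by
      rw [fixProj_eq_Theta hfix, inner_prodTensor_Theta, inner_prodTensor_Theta, ← star_oneL2,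
        inner_star_star, inner_star_star, star_oneL2]
      ring
  have hpair (f : Fin 2 → Lp ℂ 2 μ) : ![f 0, f 1] = f := FinVec.etaExpand_eq f
  refine isHilbertTensor_prodTensor.ext fun f =>
    sub_eq_zero.1 (isHilbertTensor_prodTensor.eq_zero fun e => ?_)
  rw [inner_sub_right, sub_eq_zero, ← hpair e, ← hpair f]
  exact hswap _ _ _ _

theorem fixedSpace_koop_prodMap_inv (hg : MeasurePreserving g μ μ)
    (hg' : MeasurePreserving g' μ μ) (hinv : Function.LeftInverse g' g)
    (hfix : fixedSpace (koop (Prod.map g g) (hg.prod hg)) = L2.constants (μ.prod μ)) :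
    fixedSpace (koop (Prod.map g g') (hg.prod hg')) = L2.constants (μ.prod μ) := by
  refine le_antisymm (fun F hF => ?_) (constants_le_fixedSpace_koop (hg.prod hg'))
  rw [← fixProj_apply_eq_self.2 (mem_fixedSpace.1 hF), fixProj_koop_prodMap_inv hg hg' hinv hfix]
  exact Submodule.starProjection_apply_mem _ F

end Conjugation

section Dilate

variable {A : Type*} [Ring A] [Algebra ℂ A] {t u : A}

/-- For an idempotent `t`, the operator equal to the identity on the range of `t` and to
multiplication by `r` on its kernel. -/
noncomputable def dilate (r : ℝ) (t : A) : A := t + (r : ℂ) • (1 - t)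

theorem dilate_one (t : A) : dilate 1 t = 1 := by simp [dilate]

theorem dilate_mul_dilate (r s : ℝ) (ht : IsIdempotentElem t) :
    dilate r t * dilate s t = dilate (r * s) t := by
  simp only [dilate, mul_add, add_mul, smul_mul_assoc, mul_smul_comm, ht.eq, ht.mul_one_sub_self,
    ht.one_sub_mul_self, ht.one_sub.eq, smul_zero, add_zero, zero_add, smul_smul,
    Complex.ofReal_mul, mul_comm (s : ℂ)]

theorem star_dilate [StarRing A] [StarModule ℂ A] (r : ℝ) (ht : star t = t) :
    star (dilate r t) = dilate r t := by
  simp [dilate, ht]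

theorem commute_dilate (r : ℝ) (h : Commute t u) : Commute (dilate r t) u :=
  h.add_left (((Commute.one_left u).sub_left h).smul_left _)

theorem ActsAt.dilate {ι : Type*} [DecidableEq ι] {E : ι → Type*} [∀ i, NormedAddCommGroup (E i)]
    [∀ i, InnerProductSpace ℂ (E i)] {H : Type*} [NormedAddCommGroup H] [InnerProductSpace ℂ H]
    {τ : MultilinearMap ℂ E H} {i : ι} {B : H →L[ℂ] H} {b : E i →L[ℂ] E i} (h : ActsAt τ i B b)
    (r : ℝ) : ActsAt τ i (dilate r B) (dilate r b) :=
  h.add (((ActsAt.one i).sub h).smul _)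

end Dilate

end Z2Spectral

namespace Z2Action

open Z2Spectral

section Basic

variable {X : Type*} [MeasurableSpace X] {μ : Measure X} (T : Z2Action X μ)

theorem map_zero (x : X) : T.map 0 x = x :=
  (T.map 0).injective <| by rw [← T.map_add, add_zero]

theorem leftInverse_map_neg (z : ℤ × ℤ) : Function.LeftInverse (T.map (-z)) (T.map z) := fun x => by
  rw [← T.map_add, neg_add_cancel, T.map_zero]

theorem map_comm (z w : ℤ × ℤ) (x : X) : T.map z (T.map w x) = T.map w (T.map z x) := by
  rw [← T.map_add, ← T.map_add, add_comm]

theorem isUnitaryRep : IsUnitaryRep T.koopman where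
  map_zero := (koop_congr (T.measurePreserving 0) (MeasurePreserving.id μ) T.map_zero).trans koop_id
  map_add z w := by
    refine .trans (koop_congr (T.measurePreserving _)
      ((T.measurePreserving w).comp (T.measurePreserving z)) fun x => ?_)
      (koop_mul (T.measurePreserving z) (T.measurePreserving w)).symm
    rw [add_comm, T.map_add, Function.comp_apply]
  star_eq z := star_koop _ _ (T.leftInverse_map_neg z)

end Basic

section Square

variable {X : Type*} [MeasurableSpace X] {μ : Measure X} [IsProbabilityMeasure μ]
  (T : Z2Action X μ)

theorem isTensor_square (z : ℤ × ℤ) :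
    IsTensor (prodTensor μ) (T.square.koopman z) fun _ => T.koopman z := by
  have hpair : (fun _ : Fin 2 => T.koopman z) = ![T.koopman z, T.koopman z] :=
    funext fun i => by fin_cases i <;> rfl
  rw [hpair]
  exact isTensor_koop_prodMap (T.measurePreserving z) (T.measurePreserving z)

/-- The Koopman operator `T̂^z ⊗ I` of `T^z × id`. -/
noncomputable def koopFst (z : ℤ × ℤ) : Lp ℂ 2 (μ.prod μ) →L[ℂ] Lp ℂ 2 (μ.prod μ) :=
  koop (Prod.map (T.map z) id) ((T.measurePreserving z).prod (MeasurePreserving.id μ))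

/-- The Koopman operator `I ⊗ T̂^z` of `id × T^z`. -/
noncomputable def koopSnd (z : ℤ × ℤ) : Lp ℂ 2 (μ.prod μ) →L[ℂ] Lp ℂ 2 (μ.prod μ) :=
  koop (Prod.map id (T.map z)) ((MeasurePreserving.id μ).prod (T.measurePreserving z))

variable (μ) in
/-- The Koopman operator of the flip of the two coordinates, whose fixed vectors are the symmetric
functions. -/
noncomputable def koopSwap : Lp ℂ 2 (μ.prod μ) →L[ℂ] Lp ℂ 2 (μ.prod μ) :=
  koop Prod.swap Measure.measurePreserving_swap

theorem commute_koopFst_square (z w : ℤ × ℤ) : Commute (T.koopFst z) (T.square.koopman w) :=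
  koop_mul_congr _ (T.square.measurePreserving w) (T.square.measurePreserving w) _
    fun _ => Prod.ext (T.map_comm _ _ _) rfl

theorem commute_koopSnd_square (z w : ℤ × ℤ) : Commute (T.koopSnd z) (T.square.koopman w) :=
  koop_mul_congr _ (T.square.measurePreserving w) (T.square.measurePreserving w) _
    fun _ => Prod.ext rfl (T.map_comm _ _ _)

theorem koopSnd_mul_koopFst (z w : ℤ × ℤ) :
    T.koopSnd w * T.koopFst z = koop (Prod.map (T.map z) (T.map w))
      ((T.measurePreserving z).prod (T.measurePreserving w)) :=
  (koop_mul _ _).trans (koop_congr _ _ fun _ => rfl)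

theorem commute_koopFst_koopSnd (z w : ℤ × ℤ) : Commute (T.koopFst z) (T.koopSnd w) :=
  koop_mul_congr _ _ _ _ fun _ => rfl

theorem koopSwap_mul_koopSwap : koopSwap μ * koopSwap μ = 1 :=
  koop_mul_eq_one _ _ Prod.swap_swap

theorem star_koopSwap : star (koopSwap μ) = koopSwap μ :=
  star_koop _ _ Prod.swap_swap

theorem commute_koopSwap_square (z : ℤ × ℤ) : Commute (koopSwap μ) (T.square.koopman z) :=
  koop_mul_congr _ (T.square.measurePreserving z) (T.square.measurePreserving z) _ fun _ => rfl

theorem koopSwap_mul_koopFst (z : ℤ × ℤ) : koopSwap μ * T.koopFst z = T.koopSnd z * koopSwap μ :=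
  koop_mul_congr _ _ _ _ fun _ => rfl

theorem koopSwap_mul_koopSnd (z : ℤ × ℤ) : koopSwap μ * T.koopSnd z = T.koopFst z * koopSwap μ :=
  koop_mul_congr _ _ _ _ fun _ => rfl

theorem star_koopFst (z : ℤ × ℤ) : star (T.koopFst z) = T.koopFst (-z) :=
  star_koop _ _ fun x => Prod.ext (T.leftInverse_map_neg z x.1) rfl

theorem star_koopSnd (z : ℤ × ℤ) : star (T.koopSnd z) = T.koopSnd (-z) :=
  star_koop _ _ fun x => Prod.ext rfl (T.leftInverse_map_neg z x.2)

theorem commute_Theta_koopman (z : ℤ × ℤ) : Commute (L2.Theta μ) (T.koopman z) :=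
  (Theta_mul_koop (T.measurePreserving z)).trans (koop_mul_Theta (T.measurePreserving z)).symm

theorem dilate_Theta_mul_koopman (r : ℝ) (z : ℤ × ℤ) :
    dilate r (L2.Theta μ) * T.koopman z =
      (r : ℂ) • T.koopman z + (1 - (r : ℂ)) • L2.Theta μ := by
  have hΘ : L2.Theta μ * T.koopman z = L2.Theta μ := Theta_mul_koop (T.measurePreserving z)
  rw [dilate, add_mul, smul_mul_assoc, sub_mul, hΘ, one_mul]
  module

/-- The tensor square of `Θ + r (1 - Θ)`, for `T` with `T^z₀` ergodic. It is built from the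
Koopman operators of the two factors so that it can be shifted into one factor of a larger
product. -/
noncomputable def dilateSquare (z₀ : ℤ × ℤ) (r : ℝ) : Lp ℂ 2 (μ.prod μ) →L[ℂ] Lp ℂ 2 (μ.prod μ) :=
  dilate r (fixProj (T.koopFst z₀)) * dilate r (fixProj (T.koopSnd z₀))

theorem dilateSquare_one (z₀ : ℤ × ℤ) : T.dilateSquare z₀ 1 = 1 := by
  rw [dilateSquare, dilate_one, dilate_one, one_mul]

variable {T} {z₀ : ℤ × ℤ} (hT : fixedSpace (T.koopman z₀) = L2.constants μ)
include hT

theorem isTensor_dilateSquare (r : ℝ) :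
    IsTensor (prodTensor μ) (T.dilateSquare z₀ r) fun _ => dilate r (L2.Theta μ) := by
  have hfst : ActsAt (prodTensor μ) 0 (fixProj (T.koopFst z₀)) (L2.Theta μ) :=
    fixProj_eq_Theta hT ▸ isHilbertTensor_prodTensor.actsAt_fixProj
      (actsAt_koop_fst (T.measurePreserving z₀)) (norm_koop_le _) (norm_koop_le _)
  have hsnd : ActsAt (prodTensor μ) 1 (fixProj (T.koopSnd z₀)) (L2.Theta μ) :=
    fixProj_eq_Theta hT ▸ isHilbertTensor_prodTensor.actsAt_fixProj
      (actsAt_koop_snd (T.measurePreserving z₀)) (norm_koop_le _) (norm_koop_le _)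
  intro f
  rw [dilateSquare, mul_apply_eq_comp, hsnd.dilate, hfst.dilate]
  congr 1
  ext1 i
  fin_cases i <;> rfl

theorem star_dilateSquare (r : ℝ) : star (T.dilateSquare z₀ r) = T.dilateSquare z₀ r :=
  isHilbertTensor_prodTensor.isTensor_star (isTensor_dilateSquare hT r) <| by
    simpa only [star_dilate r (star_Theta μ)] using isTensor_dilateSquare hT r

theorem dilateSquare_mul (r s : ℝ) :
    T.dilateSquare z₀ r * T.dilateSquare z₀ s = T.dilateSquare z₀ (r * s) := by
  have hmul : ((fun _ => dilate r (L2.Theta μ)) * fun _ => dilate s (L2.Theta μ) :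
      Fin 2 → Lp ℂ 2 μ →L[ℂ] Lp ℂ 2 μ) = fun _ => dilate (r * s) (L2.Theta μ) :=
    funext fun i => (Pi.mul_apply _ _ i).trans <| dilate_mul_dilate r s (Theta_mul_Theta μ)
  have htensor := (isTensor_dilateSquare hT r).mul (isTensor_dilateSquare hT s)
  rw [hmul] at htensor
  exact isHilbertTensor_prodTensor.isTensor_unique htensor (isTensor_dilateSquare hT (r * s))

theorem commute_dilateSquare_square (r : ℝ) (z : ℤ × ℤ) :
    Commute (T.dilateSquare z₀ r) (T.square.koopman z) := by
  have hcomm : ((fun _ => dilate r (L2.Theta μ)) * fun _ => T.koopman z :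
      Fin 2 → Lp ℂ 2 μ →L[ℂ] Lp ℂ 2 μ) = (fun _ => T.koopman z) * fun _ => dilate r (L2.Theta μ) :=
    funext fun _ => (commute_dilate r (T.commute_Theta_koopman z)).eq
  have htensor := (isTensor_dilateSquare hT r).mul (T.isTensor_square z)
  rw [hcomm] at htensor
  exact isHilbertTensor_prodTensor.isTensor_unique htensor
    ((T.isTensor_square z).mul (isTensor_dilateSquare hT r))

theorem weakLimit_square {w : ℕ → ℤ × ℤ} {a : ℝ} (ha : 0 < a) {z : ℤ × ℤ}
    (h : WeakLimit (fun n => T.koopman (w n))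
      ((a : ℂ) • T.koopman z + (1 - (a : ℂ)) • L2.Theta μ)) :
    WeakLimit (fun n => T.square.koopman (w n))
      (T.dilateSquare z₀ √a * T.dilateSquare z₀ √a * T.square.koopman z) := by
  rw [dilateSquare_mul hT, Real.mul_self_sqrt ha.le]
  rw [← dilate_Theta_mul_koopman] at h
  exact isHilbertTensor_prodTensor.weakLimit (fun n => T.isTensor_square (w n))
    ((isTensor_dilateSquare hT a).mul (T.isTensor_square z))
    (fun n => T.square.isUnitaryRep.norm_le_one (w n)) fun _ => h

end Square

section Pi

theorem isTensor_pi {ι : Type*} [Fintype ι] {Y : ι → Type*} [∀ i, MeasurableSpace (Y i)]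
    {ν : ∀ i, Measure (Y i)} [∀ i, IsProbabilityMeasure (ν i)] (S : ∀ i, Z2Action (Y i) (ν i))
    (z : ℤ × ℤ) : IsTensor (piTensor ν) ((Z2Action.pi S).koopman z) fun i => (S i).koopman z :=
  isTensor_koop fun i => (S i).measurePreserving z

theorem fixedSpace_koopman_of_ergodic_pi {ι : Type*} [Fintype ι] {Y : ι → Type*}
    [∀ i, MeasurableSpace (Y i)] {ν : ∀ i, Measure (Y i)} [∀ i, IsProbabilityMeasure (ν i)]
    (S : ∀ i, Z2Action (Y i) (ν i)) {z : ℤ × ℤ}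
    (h : Ergodic ((Z2Action.pi S).map z) (Measure.pi ν)) (i : ι) :
    fixedSpace ((S i).koopman z) = L2.constants (ν i) := by
  classical
  have hfix : fixedSpace ((Z2Action.pi S).koopman z) = L2.constants (Measure.pi ν) :=
    fixedSpace_koop_of_ergodic h
  rw [constants_eq_span_oneL2, ← piTensor_oneL2] at hfix
  rw [constants_eq_span_oneL2]
  exact isHilbertTensor_piTensor.fixedSpace_eq_span (fun i => norm_oneL2 (ν i)) (isTensor_pi S z)
    (fun i => koop_oneL2 ((S i).measurePreserving z)) hfix i

theorem fixedSpace_koopman_of_square {X : Type*} [MeasurableSpace X] {μ : Measure X}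
    [IsProbabilityMeasure μ] {T : Z2Action X μ} {z : ℤ × ℤ}
    (h : fixedSpace (T.square.koopman z) = L2.constants (μ.prod μ)) :
    fixedSpace (T.koopman z) = L2.constants μ := by
  rw [constants_eq_span_oneL2, ← prodTensor_oneL2] at h
  rw [constants_eq_span_oneL2]
  exact isHilbertTensor_prodTensor.fixedSpace_eq_span (fun _ => norm_oneL2 μ) (T.isTensor_square z)
    (fun _ => koop_oneL2 (T.measurePreserving z)) h 0

end Pi

end Z2Action

/-! ### Square systems -/

namespace Z2Spectral

variable {ι : Type*} [Fintype ι] [DecidableEq ι]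
  {E : ι → Type*} [∀ i, NormedAddCommGroup (E i)] [∀ i, InnerProductSpace ℂ (E i)]
  [∀ i, CompleteSpace (E i)]
  {H : Type*} [NormedAddCommGroup H] [InnerProductSpace ℂ H] [CompleteSpace H]

/-- A tensor product `U` of representations `Q i`, each commuting with an involution `σ i` and with
the multiples of a unit vector `e i` as its only vectors fixed by `Q i z₀`, such that the factor
actions `rep i` commute with the commutant of `U`. The operator `diff i` acts on the factor `i` as
an intertwiner anticommuting with `σ i`, whose kernel and cokernel consist of the vectors fixed
there. -/
structure SquareSystem (τ : MultilinearMap ℂ E H) (Q : ∀ i, ℤ × ℤ → E i →L[ℂ] E i)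
    (z₀ : ℤ × ℤ) (e : ∀ i, E i) (σ : ∀ i, E i →L[ℂ] E i) (U : ℤ × ℤ → H →L[ℂ] H) where
  rep : ι → ℤ × ℤ → H →L[ℂ] H
  swap : ι → H →L[ℂ] H
  diff : ι → H →L[ℂ] H
  isHilbertTensor : IsHilbertTensor τ
  isUnitaryRep : IsUnitaryRep U
  isUnitaryRep_factor : ∀ i, IsUnitaryRep (Q i)
  isTensor : ∀ z, IsTensor τ (U z) fun i => Q i z
  norm_unit : ∀ i, ‖e i‖ = 1
  map_unit : ∀ i z, Q i z (e i) = e i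
  fixedSpace_factor : ∀ i, fixedSpace (Q i z₀) = ℂ ∙ e i
  actsAt_rep : ∀ i z, ActsAt τ i (rep i z) (Q i z)
  norm_rep_le : ∀ i z, ‖rep i z‖ ≤ 1
  commute_rep : ∀ i z, ∀ B ∈ commutant U, Commute (rep i z) B
  actsAt_swap : ∀ i, ActsAt τ i (swap i) (σ i)
  involution_mul_self : ∀ i, σ i * σ i = 1
  star_involution : ∀ i, star (σ i) = σ i
  involution_unit : ∀ i, σ i (e i) = e i
  commute_involution : ∀ i z, Commute (σ i) (Q i z)
  actsAt_diff : ∀ i, ∃ d, ActsAt τ i (diff i) d ∧ (∀ z, Commute d (Q i z)) ∧ σ i * d = -(d * σ i)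
  diff_eq_zero : ∀ i x, diff i x = 0 ↔ rep i z₀ x = x
  star_diff_eq_zero : ∀ i x, star (diff i) x = 0 ↔ rep i z₀ x = x

namespace SquareSystem

variable {τ : MultilinearMap ℂ E H} {Q : ∀ i, ℤ × ℤ → E i →L[ℂ] E i}
    {z₀ : ℤ × ℤ} {e : ∀ i, E i} {σ : ∀ i, E i →L[ℂ] E i} {U : ℤ × ℤ → H →L[ℂ] H}
    (S : SquareSystem τ Q z₀ e σ U)

/-- The projection to the vectors fixed by the `i`-th factor; it acts there as the projection
to `ℂ ∙ e i`. -/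
noncomputable def Theta (i : ι) : H →L[ℂ] H := fixProj (S.rep i z₀)

section Operators

include S

theorem mem_commutant_of_actsAt {i : ι} {B : H →L[ℂ] H} {b : E i →L[ℂ] E i} (hB : ActsAt τ i B b)
    (hb : ∀ z, Commute b (Q i z)) : B ∈ commutant U := by
  refine S.isUnitaryRep.mem_commutant.2 fun z => DFunLike.congr_fun (?_ : B * U z = U z * B)
  refine S.isHilbertTensor.ext fun f => ?_
  rw [mul_apply_eq_comp, mul_apply_eq_comp, hB, S.isTensor, S.isTensor, hB]
  congr 1
  ext1 j
  obtain rfl | hj := eq_or_ne j i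
  · rw [Function.update_self, Function.update_self]
    exact DFunLike.congr_fun (hb z).eq (f j)
  · rw [Function.update_of_ne hj, Function.update_of_ne hj]

theorem starProjection_unit (i : ι) (v : E i) :
    (ℂ ∙ e i).starProjection v = inner ℂ (e i) v • e i :=
  Submodule.starProjection_unit_singleton ℂ (S.norm_unit i) v

theorem tensor_unit_fixed (z : ℤ × ℤ) : U z (τ e) = τ e := by
  simp only [S.isTensor z e, S.map_unit]

end Operators

theorem rep_apply_mem {C : Submodule ℂ H} (hC : Invariant U C) (hcl : IsClosed (C : Set H)) (i : ι)
    (z : ℤ × ℤ) {x : H} (hx : x ∈ C) : S.rep i z x ∈ C := by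
  have := hcl.completeSpace_coe
  have hcomm := DFunLike.congr_fun
    (S.commute_rep i z _ (S.isUnitaryRep.starProjection_mem_commutant hC)).eq x
  rw [mul_apply_eq_comp, Submodule.starProjection_eq_self_iff.2 hx] at hcomm
  exact hcomm ▸ C.starProjection_apply_mem _

theorem swap_mem_commutant (i : ι) : S.swap i ∈ commutant U :=
  S.mem_commutant_of_actsAt (S.actsAt_swap i) (S.commute_involution i)

theorem diff_mem_commutant (i : ι) : S.diff i ∈ commutant U := by
  obtain ⟨d, hd, hdQ, -⟩ := S.actsAt_diff i
  exact S.mem_commutant_of_actsAt hd hdQ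

theorem actsAt_Theta (i : ι) : ActsAt τ i (S.Theta i) (ℂ ∙ e i).starProjection := by
  have hfix : fixProj (Q i z₀) = (ℂ ∙ e i).starProjection := by
    simp only [fixProj, S.fixedSpace_factor]
  exact hfix ▸ S.isHilbertTensor.actsAt_fixProj (S.actsAt_rep i _) (S.norm_rep_le i _)
    ((S.isUnitaryRep_factor i).norm_le_one _)

theorem Theta_apply_comm {B : H →L[ℂ] H} (hB : B ∈ commutant U) (i : ι) (x : H) :
    S.Theta i (B x) = B (S.Theta i x) := by
  have hcomm {C : H →L[ℂ] H} (hC : C ∈ commutant U) (y : H) :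
      C (S.rep i z₀ y) = S.rep i z₀ (C y) :=
    (DFunLike.congr_fun (S.commute_rep i z₀ C hC).eq y).symm
  exact fixProj_comm (hcomm hB) (hcomm (star_mem hB)) x

theorem Theta_mem_commutant (i : ι) : S.Theta i ∈ commutant U :=
  S.isUnitaryRep.mem_commutant.2 fun z x =>
    S.Theta_apply_comm (S.isUnitaryRep.map_mem_commutant z) i x

theorem star_Theta (i : ι) : star (S.Theta i) = S.Theta i := star_fixProj _

theorem Theta_Theta (i : ι) (x : H) : S.Theta i (S.Theta i x) = S.Theta i x := fixProj_fixProj _ x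

theorem Theta_eq_self {i : ι} {x : H} : S.Theta i x = x ↔ S.rep i z₀ x = x :=
  fixProj_apply_eq_self

theorem swap_swap (i : ι) (x : H) : S.swap i (S.swap i x) = x := by
  have hone : S.swap i * S.swap i = 1 :=
    S.isHilbertTensor.actsAt_unique ((S.actsAt_swap i).mul (S.actsAt_swap i)) <| by
      rw [S.involution_mul_self]
      exact .one i
  exact DFunLike.congr_fun hone x

theorem star_swap (i : ι) : star (S.swap i) = S.swap i :=
  S.isHilbertTensor.actsAt_star (S.actsAt_swap i)
    ((S.star_involution i).symm ▸ S.actsAt_swap i)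

theorem swap_comm (i j : ι) (x : H) : S.swap i (S.swap j x) = S.swap j (S.swap i x) := by
  obtain rfl | hij := eq_or_ne i j
  · rfl
  · exact DFunLike.congr_fun
      (S.isHilbertTensor.actsAt_comm_of_ne hij (S.actsAt_swap i) (S.actsAt_swap j)) x

theorem commute_swap_diff {i j : ι} (hij : i ≠ j) : Commute (S.swap i) (S.diff j) := by
  obtain ⟨d, hd, -⟩ := S.actsAt_diff j
  exact S.isHilbertTensor.actsAt_comm_of_ne hij (S.actsAt_swap i) hd

theorem swap_mul_diff (i : ι) : S.swap i * S.diff i = -(S.diff i * S.swap i) := by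
  obtain ⟨d, hd, -, hσ⟩ := S.actsAt_diff i
  have hneg := (hd.mul (S.actsAt_swap i)).smul (-1)
  rw [neg_one_smul, neg_one_smul, ← hσ] at hneg
  exact S.isHilbertTensor.actsAt_unique ((S.actsAt_swap i).mul hd) hneg

/-- The joint eigenspace of the projections `Theta i` on which the vectors are fixed by exactly the
factors outside `A`. -/
noncomputable def sector (A : Finset ι) : Submodule ℂ H :=
  ⨅ i, Module.End.eigenspace (S.Theta i).toLinearMap (if i ∈ A then 0 else 1)

theorem mem_sector {A : Finset ι} {x : H} :
    x ∈ S.sector A ↔ ∀ i, S.Theta i x = (if i ∈ A then 0 else 1 : ℂ) • x := by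
  simp only [sector, Submodule.mem_iInf, Module.End.mem_eigenspace_iff,
    ContinuousLinearMap.coe_coe]

theorem isClosed_sector (A : Finset ι) : IsClosed (S.sector A : Set H) := by
  have hinter : (S.sector A : Set H) =
      ⋂ i, {x | S.Theta i x = (if i ∈ A then 0 else 1 : ℂ) • x} := by
    ext x
    simp only [SetLike.mem_coe, mem_sector, Set.mem_iInter, Set.mem_ofPred_eq]
  rw [hinter]
  exact isClosed_iInter fun i => isClosed_eq (S.Theta i).continuous (continuous_const_smul _)

theorem sector_hyperinvariant (A : Finset ι) : Hyperinvariant U (S.sector A) := by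
  intro B hB x hx
  rw [mem_sector] at hx ⊢
  intro i
  rw [S.Theta_apply_comm hB, hx, map_smul]

theorem sector_orthogonal {A A' : Finset ι} (hne : A ≠ A') : S.sector A ⟂ S.sector A' := by
  obtain ⟨i, hi⟩ : ∃ i, ¬(i ∈ A ↔ i ∈ A') := by
    simpa only [ne_eq, Finset.ext_iff, not_forall] using hne
  have hsymm : (S.Theta i).IsSymmetric := (show IsSelfAdjoint _ from S.star_Theta i).isSymmetric
  refine (hsymm.orthogonalFamily_eigenspaces.isOrtho ?_).mono (iInf_le _ i) (iInf_le _ i)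
  split_ifs <;> simp_all

theorem exists_mem_sector {K : Submodule ℂ H} (hK : Hyperinvariant U K) (hne : K ≠ ⊥) :
    ∃ A : Finset ι, ∃ x ∈ K, x ∈ S.sector A ∧ x ≠ 0 := by
  have partialSector (t : Finset ι) : ∃ A : Finset ι, ∃ x ∈ K, x ≠ 0 ∧
      ∀ i ∈ t, S.Theta i x = (if i ∈ A then 0 else 1 : ℂ) • x := by
    induction t using Finset.induction_on with
    | empty =>
      obtain ⟨x, hx, hx0⟩ := K.ne_bot_iff.1 hne
      exact ⟨∅, x, hx, hx0, by simp⟩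
    | insert j t hj ih =>
      obtain ⟨A, x, hx, hx0, hA⟩ := ih
      have hne : ∀ i ∈ t, i ≠ j := fun i hi hij => hj (hij ▸ hi)
      by_cases hΘ : S.Theta j x = 0
      · refine ⟨insert j A, x, hx, hx0, Finset.forall_mem_insert _ _ _ |>.2 ⟨?_, fun i hi => ?_⟩⟩
        · simp [hΘ]
        · simpa [hne i hi] using hA i hi
      · refine ⟨A.erase j, S.Theta j x, hK _ (S.Theta_mem_commutant j) x hx, hΘ,
          Finset.forall_mem_insert _ _ _ |>.2 ⟨?_, fun i hi => ?_⟩⟩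
        · simp [S.Theta_Theta]
        · rw [S.Theta_apply_comm (S.Theta_mem_commutant j), hA i hi, map_smul]
          simp [hne i hi]
  obtain ⟨A, x, hx, hx0, hA⟩ := partialSector Finset.univ
  exact ⟨A, x, hx, S.mem_sector.2 fun i => hA i (Finset.mem_univ i), hx0⟩

omit [Fintype ι] in
/-- The character `i ↦ ±1` with value `-1` on `s`. -/
def sign (s : Finset ι) (i : ι) : ℂ := if i ∈ s then -1 else 1

omit [Fintype ι] in
theorem sign_empty (i : ι) : sign ∅ i = 1 := if_neg (Finset.notMem_empty i)

omit [Fintype ι] in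
theorem sign_ne {s s' : Finset ι} {i : ι} (hi : ¬(i ∈ s ↔ i ∈ s')) : sign s i ≠ sign s' i := by
  by_cases h : i ∈ s <;> by_cases h' : i ∈ s' <;> simp only [h, h', iff_self, not_true] at hi <;>
    norm_num [sign, h, h']

omit [Fintype ι] in
theorem sign_symmDiff_singleton_self (s : Finset ι) (j : ι) :
    sign (symmDiff s {j}) j = -sign s j := by
  by_cases hj : j ∈ s <;> simp [sign, Finset.mem_symmDiff, hj]

omit [Fintype ι] in
theorem sign_symmDiff_singleton_of_ne (s : Finset ι) {i j : ι} (hij : i ≠ j) :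
    sign (symmDiff s {j}) i = sign s i := by
  simp [sign, Finset.mem_symmDiff, hij]

/-- The part of a sector where `swap i = -1` for `i ∈ s` and `swap i = 1` for `i ∈ A \ s`. -/
noncomputable def cell (A s : Finset ι) : Submodule ℂ H :=
  S.sector A ⊓ ⨅ i ∈ A, Module.End.eigenspace (S.swap i).toLinearMap (sign s i)

theorem mem_cell {A s : Finset ι} {x : H} :
    x ∈ S.cell A s ↔ x ∈ S.sector A ∧ ∀ i ∈ A, S.swap i x = sign s i • x := by
  simp only [cell, Submodule.mem_inf, Submodule.mem_iInf, Module.End.mem_eigenspace_iff,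
    ContinuousLinearMap.coe_coe]

theorem isClosed_cell (A s : Finset ι) : IsClosed (S.cell A s : Set H) := by
  have hinter : (S.cell A s : Set H) =
      (S.sector A : Set H) ∩ ⋂ i ∈ A, {x | S.swap i x = sign s i • x} := by
    ext x
    simp only [SetLike.mem_coe, mem_cell, Set.mem_inter_iff, Set.mem_iInter, Set.mem_ofPred_eq]
  rw [hinter]
  exact (S.isClosed_sector A).inter <| isClosed_biInter fun i _ =>
    isClosed_eq (S.swap i).continuous (continuous_const_smul _)

theorem cell_invariant (A s : Finset ι) : Invariant U (S.cell A s) := by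
  intro z x hx
  rw [mem_cell] at hx ⊢
  refine ⟨S.sector_hyperinvariant A _ (S.isUnitaryRep.map_mem_commutant z) x hx.1, fun i hi => ?_⟩
  rw [commutant_apply (S.swap_mem_commutant i), hx.2 i hi, map_smul]

theorem cell_orthogonal {A s s' : Finset ι} (hs : s ⊆ A) (hs' : s' ⊆ A) (hne : s ≠ s') :
    S.cell A s ⟂ S.cell A s' := by
  obtain ⟨i, hi⟩ : ∃ i, ¬(i ∈ s ↔ i ∈ s') := by
    simpa only [ne_eq, Finset.ext_iff, not_forall] using hne
  have hiA : i ∈ A := by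
    by_contra hiA
    exact hi (iff_of_false (fun h => hiA (hs h)) fun h => hiA (hs' h))
  have hsymm : (S.swap i).IsSymmetric := (show IsSelfAdjoint _ from S.star_swap i).isSymmetric
  have hle (s : Finset ι) :
      S.cell A s ≤ Module.End.eigenspace (S.swap i).toLinearMap (sign s i) :=
    inf_le_right.trans (iInf₂_le i hiA)
  exact (hsymm.orthogonalFamily_eigenspaces.isOrtho (sign_ne hi)).mono (hle s) (hle s')

theorem mem_iSup_cell {A : Finset ι} (t : Finset ι) {s : Finset ι} (ht : t ⊆ A) (hs : s ⊆ A) {x : H}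
    (hx : x ∈ S.sector A) (hsign : ∀ i ∈ A \ t, S.swap i x = sign s i • x) :
    x ∈ ⨆ s : A.powerset, S.cell A s := by
  induction t using Finset.induction_on generalizing s x with
  | empty =>
    rw [Finset.sdiff_empty] at hsign
    exact Submodule.mem_iSup_of_mem ⟨s, Finset.mem_powerset.2 hs⟩ (S.mem_cell.2 ⟨hx, hsign⟩)
  | insert j t hj ih =>
    obtain ⟨hjA, htA⟩ := Finset.insert_subset_iff.1 ht
    have hpart (c : ℂ) (hc : c * c = 1) {s' : Finset ι} (hs' : s' ⊆ A) (hsj : sign s' j = c)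
        (hsne : ∀ i ≠ j, sign s' i = sign s i) :
        x + c • S.swap j x ∈ ⨆ s : A.powerset, S.cell A s := by
      refine ih htA hs' (add_mem hx (Submodule.smul_mem _ c
        (S.sector_hyperinvariant A _ (S.swap_mem_commutant j) x hx))) fun i hi => ?_
      rw [Finset.mem_sdiff] at hi
      obtain rfl | hij := eq_or_ne i j
      · rw [hsj, map_add, map_smul, S.swap_swap, smul_add, smul_smul, hc, one_smul, add_comm]
      · have hi' : i ∈ A \ insert j t := by simp [hi.1, hi.2, hij]
        rw [hsne i hij, map_add, map_smul, S.swap_comm, hsign i hi', map_smul, smul_add,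
          smul_comm c]
    have hplus := hpart 1 (by norm_num) (s' := s.erase j) ((Finset.erase_subset _ _).trans hs)
      (by simp [sign]) fun i hij => by simp [sign, hij]
    have hminus := hpart (-1) (by norm_num) (s' := insert j s) (Finset.insert_subset hjA hs)
      (by simp [sign]) fun i hij => by simp [sign, hij]
    have hsplit : x = (2⁻¹ : ℂ) • ((x + (1 : ℂ) • S.swap j x) + (x + (-1 : ℂ) • S.swap j x)) := by
      module
    rw [hsplit]
    exact Submodule.smul_mem _ _ (add_mem hplus hminus)

theorem iSup_cell (A : Finset ι) : ⨆ s : A.powerset, S.cell A s = S.sector A :=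
  le_antisymm (iSup_le fun _ => inf_le_left) fun _ hx =>
    S.mem_iSup_cell A subset_rfl (Finset.empty_subset A) hx (by simp)

theorem apply_mem_cell_symmDiff {A s : Finset ι} {j : ι} {B : H →L[ℂ] H} (hB : B ∈ commutant U)
    (hcomm : ∀ i ≠ j, Commute (S.swap i) B) (hanti : S.swap j * B = -(B * S.swap j)) {x : H}
    (hx : x ∈ S.cell A s) : B x ∈ S.cell A (symmDiff s {j}) := by
  rw [mem_cell] at hx ⊢
  refine ⟨S.sector_hyperinvariant A B hB x hx.1, fun i hi => ?_⟩
  obtain rfl | hij := eq_or_ne i j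
  · rw [← mul_apply_eq_comp, hanti, _root_.neg_apply, mul_apply_eq_comp, hx.2 i hi, map_smul,
      sign_symmDiff_singleton_self, neg_smul]
  · rw [← mul_apply_eq_comp, (hcomm i hij).eq, mul_apply_eq_comp, hx.2 i hi, map_smul,
      sign_symmDiff_singleton_of_ne s hij]

theorem diff_apply_mem_cell {A s : Finset ι} (j : ι) {x : H} (hx : x ∈ S.cell A s) :
    S.diff j x ∈ S.cell A (symmDiff s {j}) :=
  S.apply_mem_cell_symmDiff (S.diff_mem_commutant j) (fun _ hij => S.commute_swap_diff hij)
    (S.swap_mul_diff j) hx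

theorem star_diff_apply_mem_cell {A s : Finset ι} (j : ι) {x : H} (hx : x ∈ S.cell A s) :
    star (S.diff j) x ∈ S.cell A (symmDiff s {j}) := by
  refine S.apply_mem_cell_symmDiff (star_mem (S.diff_mem_commutant j))
    (fun i hij => by simpa only [S.star_swap] using (S.commute_swap_diff hij).star_star) ?_ hx
  have hstar := congrArg star (S.swap_mul_diff j)
  rw [star_neg, star_mul, star_mul, S.star_swap] at hstar
  rw [hstar, neg_neg]

theorem eq_zero_of_mem_sector {A : Finset ι} {j : ι} (hj : j ∈ A) {x : H} (hx : x ∈ S.sector A)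
    (hfix : S.rep j z₀ x = x) : x = 0 := by
  have hΘ := S.mem_sector.1 hx j
  rwa [S.Theta_eq_self.2 hfix, if_pos hj, zero_smul] at hΘ

theorem isomorphicOn_symmDiff {A : Finset ι} (s : Finset ι) {j : ι} (hj : j ∈ A) :
    IsomorphicOn U (S.cell A s) (S.cell A (symmDiff s {j})) := by
  refine S.isUnitaryRep.isomorphicOn_of_injective (S.isClosed_cell A s) (S.isClosed_cell A _)
    (S.cell_invariant A s) (S.cell_invariant A _) (S.diff_mem_commutant j)
    (fun x hx => S.diff_apply_mem_cell j hx) (fun x hx hzero => ?_) fun y hy horth => ?_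
  · exact S.eq_zero_of_mem_sector hj (S.mem_cell.1 hx).1 ((S.diff_eq_zero j x).1 hzero)
  · refine S.eq_zero_of_mem_sector hj (S.mem_cell.1 hy).1 ((S.star_diff_eq_zero j y).1 ?_)
    have hmem := S.star_diff_apply_mem_cell j hy
    rw [symmDiff_symmDiff_cancel_right] at hmem
    rw [← inner_self_eq_zero (𝕜 := ℂ), ContinuousLinearMap.star_eq_adjoint,
      ContinuousLinearMap.adjoint_inner_right, ← ContinuousLinearMap.star_eq_adjoint]
    exact horth _ hmem

theorem isomorphicOn_empty {A : Finset ι} {s : Finset ι} (hs : s ⊆ A) :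
    IsomorphicOn U (S.cell A ∅) (S.cell A s) := by
  induction s using Finset.induction_on with
  | empty => exact .refl _
  | insert j s hj ih =>
    obtain ⟨hjA, hsA⟩ := Finset.insert_subset_iff.1 hs
    have hinsert : insert j s = symmDiff s {j} := by
      rw [(Finset.disjoint_singleton_right.2 hj).symmDiff_eq_sup, Finset.sup_eq_union,
        Finset.union_singleton]
    rw [hinsert]
    exact (ih hsA).trans (S.cell_invariant A s) (S.isomorphicOn_symmDiff s hjA)

section CyclicCells

include S

theorem closure_span_unit (i : ι) :
    (Submodule.span ℂ (Set.range fun z => Q i z (e i))).topologicalClosure = ℂ ∙ e i := by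
  simp only [S.map_unit, Set.range_const]
  exact (Submodule.closed_of_finiteDimensional _).submodule_topologicalClosure_eq

theorem map_mem_of_mem_closure_span {C : Submodule ℂ H} (hC : Invariant U C)
    (hcl : IsClosed (C : Set H)) {f g : ∀ i, E i} (hg : τ g ∈ C)
    (hf : ∀ i, f i ∈ (Submodule.span ℂ (Set.range fun z => Q i z (g i))).topologicalClosure) :
    τ f ∈ C := by
  have hpiecewise (t : Finset ι) : τ (t.piecewise f g) ∈ C := by
    induction t using Finset.induction_on with
    | empty => rwa [Finset.piecewise_empty]
    | insert j t hj ih =>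
      have hle : (Submodule.span ℂ (Set.range fun z => Q j z (g j))).topologicalClosure ≤
          C.comap (τ.toLinearMap (t.piecewise f g) j) := by
        refine Submodule.topologicalClosure_minimal _ (Submodule.span_le.2 ?_)
          (hcl.preimage (S.isHilbertTensor.continuous_update _ j))
        rintro _ ⟨z, rfl⟩
        have hmem := S.rep_apply_mem hC hcl j z ih
        rwa [S.actsAt_rep, Finset.piecewise_eq_of_notMem _ _ _ hj] at hmem
      rw [Finset.piecewise_insert]
      exact hle (hf j)
  simpa only [Finset.piecewise_univ] using hpiecewise Finset.univ

end CyclicCells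

/-- The `i`-th factor of the cell `A, ∅`. -/
noncomputable def factorSpace (σ : ∀ i, E i →L[ℂ] E i) (e : ∀ i, E i) (A : Finset ι) (i : ι) :
    Submodule ℂ (E i) :=
  if i ∈ A then fixedSpace (σ i) ⊓ (ℂ ∙ e i)ᗮ else ℂ ∙ e i

theorem map_mem_sector {A : Finset ι} {f : ∀ i, E i} (hA : ∀ i ∈ A, f i ∈ (ℂ ∙ e i)ᗮ)
    (hAc : ∀ i ∉ A, f i ∈ ℂ ∙ e i) : τ f ∈ S.sector A := by
  refine S.mem_sector.2 fun i => ?_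
  rw [S.actsAt_Theta]
  split_ifs with hi
  · rw [(Submodule.starProjection_apply_eq_zero_iff _).2 (hA i hi), MultilinearMap.map_update_zero,
      zero_smul]
  · rw [Submodule.starProjection_eq_self_iff.2 (hAc i hi), Function.update_eq_self, one_smul]

theorem map_mem_cell_empty {A : Finset ι} {f : ∀ i, E i} (hf : ∀ i, f i ∈ factorSpace σ e A i) :
    τ f ∈ S.cell A ∅ := by
  have hA (i) (hi : i ∈ A) : f i ∈ fixedSpace (σ i) ⊓ (ℂ ∙ e i)ᗮ := by
    simpa only [factorSpace, if_pos hi] using hf i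
  have hAc (i) (hi : i ∉ A) : f i ∈ ℂ ∙ e i := by
    simpa only [factorSpace, if_neg hi] using hf i
  refine S.mem_cell.2 ⟨S.map_mem_sector (fun i hi => (hA i hi).2) hAc, fun i hi => ?_⟩
  rw [S.actsAt_swap, mem_fixedSpace.1 (hA i hi).1, Function.update_eq_self, sign_empty, one_smul]

theorem exists_actsAt_factorSpace (A : Finset ι) (i : ι) : ∃ P p, ActsAt τ i P p ∧
    (∀ v, p v ∈ factorSpace σ e A i) ∧ ∀ x ∈ S.cell A ∅, star P x = x := by
  by_cases hi : i ∈ A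
  · refine ⟨_, _, ((ActsAt.one i).sub (S.actsAt_Theta i)).mul
      (((ActsAt.one i).add (S.actsAt_swap i)).smul 2⁻¹), fun v => ?_, fun x hx => ?_⟩
    · have hσσ : σ i (σ i v) = v := DFunLike.congr_fun (S.involution_mul_self i) v
      simp only [factorSpace, if_pos hi, mul_apply_eq_comp, _root_.sub_apply, one_apply_eq_self,
        _root_.smul_apply, _root_.add_apply]
      refine ⟨?_, Submodule.sub_starProjection_mem_orthogonal _⟩
      rw [SetLike.mem_coe, mem_fixedSpace, S.starProjection_unit, map_sub, map_smul, map_smul,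
        map_add, hσσ, S.involution_unit, add_comm (σ i v)]
    · have hΘ := S.mem_sector.1 (S.mem_cell.1 hx).1 i
      have hswap := (S.mem_cell.1 hx).2 i hi
      rw [if_pos hi, zero_smul] at hΘ
      rw [sign_empty, one_smul] at hswap
      rw [star_mul, star_smul, star_add, star_sub, star_one, S.star_Theta, S.star_swap,
        mul_apply_eq_comp, _root_.sub_apply, one_apply_eq_self, hΘ, sub_zero, _root_.smul_apply,
        _root_.add_apply, one_apply_eq_self, hswap, ← two_smul ℂ x, smul_smul]
      norm_num
  · refine ⟨_, _, S.actsAt_Theta i, fun v => ?_, fun x hx => ?_⟩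
    · rw [factorSpace, if_neg hi]
      exact Submodule.starProjection_apply_mem _ _
    · rw [S.star_Theta, S.mem_sector.1 (S.mem_cell.1 hx).1 i, if_neg hi, one_smul]

theorem eq_zero_of_mem_cell_empty {A : Finset ι} {x : H} (hx : x ∈ S.cell A ∅)
    (horth : ∀ f, (∀ i, f i ∈ factorSpace σ e A i) → inner ℂ (τ f) x = 0) : x = 0 := by
  choose P p hPp hp hPx using S.exists_actsAt_factorSpace A
  refine S.isHilbertTensor.eq_zero fun f => ?_
  have hpiecewise (t : Finset ι) :
      inner ℂ (τ (t.piecewise (fun i => p i (f i)) f)) x = inner ℂ (τ f) x := by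
    induction t using Finset.induction_on with
    | empty => rw [Finset.piecewise_empty]
    | insert j t hj ih =>
      have hPτ := hPp j (t.piecewise (fun i => p i (f i)) f)
      rw [Finset.piecewise_eq_of_notMem _ _ _ hj] at hPτ
      rw [Finset.piecewise_insert, ← hPτ, ← ContinuousLinearMap.adjoint_inner_right,
        ← ContinuousLinearMap.star_eq_adjoint, hPx j x hx, ih]
  rw [← hpiecewise Finset.univ, Finset.piecewise_univ]
  exact horth _ fun i => hp i _

theorem closure_span_eq_cell {A : Finset ι} {g : ∀ i, E i}
    (hg : ∀ i, (Submodule.span ℂ (Set.range fun z => Q i z (g i))).topologicalClosure =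
      factorSpace σ e A i) :
    (Submodule.span ℂ (Set.range fun z => U z (τ g))).topologicalClosure = S.cell A ∅ := by
  set C := (Submodule.span ℂ (Set.range fun z => U z (τ g))).topologicalClosure with hC
  have hcl : IsClosed (C : Set H) := Submodule.isClosed_topologicalClosure _
  have := hcl.completeSpace_coe
  have hgC : τ g ∈ C := Submodule.le_topologicalClosure _ <| Submodule.subset_span
    ⟨0, DFunLike.congr_fun S.isUnitaryRep.map_zero _⟩
  have hgA (i) : g i ∈ factorSpace σ e A i := hg i ▸ Submodule.le_topologicalClosure _
    (Submodule.subset_span ⟨0, DFunLike.congr_fun (S.isUnitaryRep_factor i).map_zero _⟩)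
  have hle : C ≤ S.cell A ∅ := by
    refine Submodule.topologicalClosure_minimal _ (Submodule.span_le.2 ?_) (S.isClosed_cell A ∅)
    rintro _ ⟨z, rfl⟩
    exact S.cell_invariant A ∅ z _ (S.map_mem_cell_empty hgA)
  refine le_antisymm hle fun x hx => ?_
  have hzero : x - C.starProjection x = 0 :=
    S.eq_zero_of_mem_cell_empty (sub_mem hx (hle (C.starProjection_apply_mem x))) fun f hf =>
      C.sub_starProjection_mem_orthogonal x _ <|
        S.map_mem_of_mem_closure_span (S.isUnitaryRep.invariant_of_cyclic ⟨_, hC.symm⟩) hcl hgC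
          fun i => (hg i).symm ▸ hf i
  rw [sub_eq_zero.1 hzero]
  exact C.starProjection_apply_mem x

theorem sector_empty : S.sector ∅ = ℂ ∙ τ e := by
  have hcell : S.cell ∅ ∅ = S.sector ∅ := by simp [cell]
  rw [← hcell, ← S.closure_span_eq_cell (A := ∅) (g := e) fun i =>
    (S.closure_span_unit i).trans (if_neg (Finset.notMem_empty i)).symm]
  simp only [S.tensor_unit_fixed, Set.range_const]
  exact (Submodule.closed_of_finiteDimensional _).submodule_topologicalClosure_eq

theorem isCyclicSubspace_cell_empty
    (hcyc : ∀ i, IsCyclicSubspace (Q i) (fixedSpace (σ i) ⊓ (ℂ ∙ e i)ᗮ)) (A : Finset ι) :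
    IsCyclicSubspace U (S.cell A ∅) := by
  have hfactor (i) : IsCyclicSubspace (Q i) (factorSpace σ e A i) := by
    unfold factorSpace
    split_ifs
    · exact hcyc i
    · exact ⟨e i, S.closure_span_unit i⟩
  choose g hg using hfactor
  exact ⟨τ g, S.closure_span_eq_cell hg⟩

theorem homogeneousOn_sector
    (hcyc : ∀ i, IsCyclicSubspace (Q i) (fixedSpace (σ i) ⊓ (ℂ ∙ e i)ᗮ)) (A : Finset ι) :
    HomogeneousOn U (S.sector A) (2 ^ A.card : ℕ) := by
  have hiso (s : A.powerset) : IsomorphicOn U (S.cell A ∅) (S.cell A s) :=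
    S.isomorphicOn_empty (Finset.mem_powerset.1 s.2)
  let enum : {i : ℕ // (i : ℕ∞) < (2 ^ A.card : ℕ)} ≃ A.powerset :=
    ((Equiv.subtypeEquivRight fun i => by rw [Nat.cast_lt]).trans Fin.equivSubtype.symm).trans
      (A.powerset.equivFinOfCardEq (Finset.card_powerset A)).symm
  refine ⟨fun i => S.cell A (enum i), fun i => ?_, fun i j hij => ?_, fun i j => ?_, ?_⟩
  · exact (hiso _).isCyclicSubspace S.isUnitaryRep (S.isCyclicSubspace_cell_empty hcyc A)
      (S.isClosed_cell A _)
  · exact S.cell_orthogonal (Finset.mem_powerset.1 (enum i).2) (Finset.mem_powerset.1 (enum j).2)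
      fun heq => hij (enum.injective (Subtype.ext heq))
  · exact ((hiso _).symm (S.cell_invariant A ∅)).trans (S.cell_invariant A ∅) (hiso _)
  · rw [enum.iSup_comp (g := fun s : A.powerset => S.cell A s), S.iSup_cell]
    exact (S.isClosed_sector A).submodule_topologicalClosure_eq

theorem sector_ne_bot (hne : ∀ i, ∃ v : E i, v ≠ 0 ∧ inner ℂ (e i) v = 0) (A : Finset ι) :
    S.sector A ≠ ⊥ := by
  choose v hv0 hv using hne
  have hmem : τ (A.piecewise v e) ∈ S.sector A := by
    refine S.map_mem_sector (fun i hi => ?_) fun i hi => ?_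
    · rw [Finset.piecewise_eq_of_mem _ _ _ hi]
      exact Submodule.mem_orthogonal_singleton_iff_inner_right.2 (hv i)
    · rw [Finset.piecewise_eq_of_notMem _ _ _ hi]
      exact Submodule.mem_span_singleton_self _
  refine (Submodule.ne_bot_iff _).2 ⟨_, hmem, ?_⟩
  rw [← norm_ne_zero_iff, S.isHilbertTensor.norm_map, Finset.prod_ne_zero_iff]
  intro i _
  by_cases hi : i ∈ A
  · rw [Finset.piecewise_eq_of_mem _ _ _ hi]
    exact norm_ne_zero_iff.2 (hv0 i)
  · rw [Finset.piecewise_eq_of_notMem _ _ _ hi, S.norm_unit]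
    exact one_ne_zero

theorem sector_le_orthogonal_unit {A : Finset ι} (hA : A.Nonempty) :
    S.sector A ≤ (ℂ ∙ τ e)ᗮ := by
  rw [← S.sector_empty]
  exact S.sector_orthogonal hA.ne_empty

include S in
theorem exists_multiplicity_eq_two_pow
    (hcyc : ∀ i, IsCyclicSubspace (Q i) (fixedSpace (σ i) ⊓ (ℂ ∙ e i)ᗮ))
    {K : Submodule ℂ H} (hK : Hyperinvariant U K) (hK0 : K ≠ ⊥) (hKe : K ≤ (ℂ ∙ τ e)ᗮ) {n : ℕ∞}
    (hhom : HomogeneousOn U K n) : ∃ A : Finset ι, A.Nonempty ∧ n = (2 ^ A.card : ℕ) := by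
  obtain ⟨A, x, hxK, hxA, hx0⟩ := S.exists_mem_sector hK hK0
  refine ⟨A, Finset.nonempty_iff_ne_empty.2 ?_, hhom.multiplicity_eq (S.homogeneousOn_sector hcyc A)
    S.isUnitaryRep hK (S.sector_hyperinvariant A) hxK hxA hx0⟩
  rintro rfl
  rw [S.sector_empty] at hxA
  exact hx0 (inner_self_eq_zero.1 (hKe hxK x hxA))

include S in
theorem multiplicities_eq
    (hcyc : ∀ i, IsCyclicSubspace (Q i) (fixedSpace (σ i) ⊓ (ℂ ∙ e i)ᗮ))
    (hne : ∀ i, ∃ v : E i, v ≠ 0 ∧ inner ℂ (e i) v = 0) :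
    multiplicities U (ℂ ∙ τ e)ᗮ = (fun j : ℕ => (2 : ℕ∞) ^ j) '' Set.Icc 1 (Fintype.card ι) := by
  have hyp : Hyperinvariant U (ℂ ∙ τ e)ᗮ := by
    rw [← S.sector_empty]
    exact (S.sector_hyperinvariant ∅).orthogonal
  ext n
  constructor
  · rintro ⟨K, hKe, hK0, hdisj, hhom⟩
    obtain ⟨A, hA, rfl⟩ := S.exists_multiplicity_eq_two_pow hcyc
      (S.isUnitaryRep.hyperinvariant_of_disjointOn hhom.isClosed (hhom.invariant S.isUnitaryRep)
        hKe hyp hdisj) hK0 hKe hhom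
    exact ⟨A.card, ⟨hA.card_pos, Finset.card_le_univ A⟩, by push_cast; rfl⟩
  · rintro ⟨j, ⟨hj1, hj⟩, rfl⟩
    obtain ⟨A, -, rfl⟩ := Finset.exists_subset_card_eq (s := (Finset.univ : Finset ι)) hj
    refine ⟨S.sector A, S.sector_le_orthogonal_unit (Finset.card_pos.1 hj1), S.sector_ne_bot hne A,
      S.isUnitaryRep.disjointOn_of_hyperinvariant (S.isClosed_sector A)
        (S.sector_hyperinvariant A), ?_⟩
    exact_mod_cast S.homogeneousOn_sector hcyc A

end SquareSystem

end Z2Spectral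

/-! ### The square system of a product of actions -/

namespace Z2Spectral

section NonAtomic

variable {X : Type*} [MeasurableSpace X] {μ : Measure X} [IsProbabilityMeasure μ]

theorem ae_mem_or_ae_notMem_of_indicatorL2_eq_smul {s : Set X} (hs : MeasurableSet s) {c : ℂ}
    (h : indicatorL2 μ hs = c • oneL2 μ) : (∀ᵐ x ∂μ, x ∈ s) ∨ ∀ᵐ x ∂μ, x ∉ s := by
  have hconst : ∀ᵐ x ∂μ, s.indicator 1 x = c := by
    filter_upwards [Lp.coeFn_smul c (oneL2 μ), coeFn_oneL2 μ, coeFn_indicatorL2 (P := μ) hs]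
      with x hsmul hone hind
    rw [← hind, h, hsmul, Pi.smul_apply, hone, smul_eq_mul, mul_one]
  by_cases hc : c = 0
  · refine .inr (hconst.mono fun x hx hxs => ?_)
    rw [Set.indicator_of_mem hxs, hc] at hx
    exact one_ne_zero hx
  · refine .inl (hconst.mono fun x hx => ?_)
    by_contra hxs
    exact hc (hx.symm.trans (Set.indicator_of_notMem hxs 1))

theorem exists_ne_zero_inner_oneL2_eq_zero (μ : Measure X) [IsProbabilityMeasure μ]
    [MeasurableSpace.CountablySeparated X] [NullSingletonClass μ] :
    ∃ f : Lp ℂ 2 μ, f ≠ 0 ∧ inner ℂ (oneL2 μ) f = 0 := by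
  by_contra! hone
  have hconst (f : Lp ℂ 2 μ) : f = inner ℂ (oneL2 μ) f • oneL2 μ := by
    rw [← Theta_apply, ← sub_eq_zero]
    by_contra hne
    refine hone _ hne ?_
    rw [Theta_apply, inner_sub_right, inner_smul_right, inner_self_eq_norm_sq_to_K, norm_oneL2]
    simp
  have htrivial (s : Set X) (hs : MeasurableSet s) : (∀ᵐ x ∂μ, x ∈ s) ∨ ∀ᵐ x ∂μ, x ∉ s :=
    ae_mem_or_ae_notMem_of_indicatorL2_eq_smul hs (hconst _)
  have : Nonempty X := nonempty_of_isProbabilityMeasure μ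
  obtain ⟨a, ha⟩ := exists_eventuallyEq_const_of_forall_separating (l := ae μ) (f := id)
    MeasurableSet htrivial
  have hnotMem : ∀ᵐ x ∂μ, x ∉ ({a} : Set X) := measure_eq_zero_iff_ae_notMem.1 (measure_singleton a)
  obtain ⟨x, hxa, hx⟩ := (ha.and hnotMem).exists
  exact hx hxa

theorem exists_ne_zero_inner_oneL2_prod_eq_zero (μ : Measure X) [IsProbabilityMeasure μ]
    [MeasurableSpace.CountablySeparated X] [NullSingletonClass μ] :
    ∃ F : Lp ℂ 2 (μ.prod μ), F ≠ 0 ∧ inner ℂ (oneL2 (μ.prod μ)) F = 0 := by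
  obtain ⟨f, hf, hf0⟩ := exists_ne_zero_inner_oneL2_eq_zero μ
  refine ⟨prodTensor μ ![f, oneL2 μ], ?_, ?_⟩
  · rw [← norm_ne_zero_iff, isHilbertTensor_prodTensor.norm_map, Fin.prod_univ_two]
    simpa [norm_oneL2] using hf
  · rw [← prodTensor_oneL2, isHilbertTensor_prodTensor.inner_map, Fin.prod_univ_two]
    simp [hf0]

end NonAtomic

section KoopAt

variable {ι : Type*} [Fintype ι] [DecidableEq ι] {Y : ι → Type*} [∀ i, MeasurableSpace (Y i)]
  {ν : ∀ i, Measure (Y i)} [∀ i, IsProbabilityMeasure (ν i)] {i : ι} {g h : Y i → Y i}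

theorem koopAt_mul_eq_one (hg : MeasurePreserving g (ν i) (ν i))
    (hh : MeasurePreserving h (ν i) (ν i)) (hhg : Function.LeftInverse h g) :
    koopAt hg * koopAt hh = 1 :=
  isHilbertTensor_piTensor.actsAt_unique
    (koop_mul_eq_one hg hh hhg ▸ (actsAt_koopAt hg).mul (actsAt_koopAt hh)) (ActsAt.one i)

theorem star_koopAt (hg : MeasurePreserving g (ν i) (ν i)) (hh : MeasurePreserving h (ν i) (ν i))
    (hhg : Function.LeftInverse h g) : star (koopAt hg) = koopAt hh :=
  isHilbertTensor_piTensor.actsAt_star (actsAt_koopAt hg)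
    (star_koop hg hh hhg ▸ actsAt_koopAt hh)

theorem actsAt_fixProj_koopAt (hg : MeasurePreserving g (ν i) (ν i)) :
    ActsAt (piTensor ν) i (fixProj (koopAt hg)) (fixProj (koop g hg)) :=
  isHilbertTensor_piTensor.actsAt_fixProj (actsAt_koopAt hg) (norm_koopAt_le hg) (norm_koop_le hg)

end KoopAt

theorem IsUnitaryRep.commute_of_commute_basis {H : Type*} [NormedAddCommGroup H]
    [InnerProductSpace ℂ H] [CompleteSpace H] {R : ℤ × ℤ → H →L[ℂ] H} (hR : IsUnitaryRep R)
    {B : H →L[ℂ] H} (h₁ : Commute (R (1, 0)) B) (h₂ : Commute (R (0, 1)) B) (z : ℤ × ℤ) :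
    Commute (R z) B := by
  let commuting : AddSubgroup (ℤ × ℤ) :=
    { carrier := {z | Commute (R z) B}
      zero_mem' := by
        rw [Set.mem_ofPred_eq, hR.map_zero]
        exact Commute.one_left B
      add_mem' := fun {z w} hz hw => by
        rw [Set.mem_ofPred_eq, hR.map_add]
        exact hz.mul_left hw
      neg_mem' := fun {z} hz => by
        have hinv : R (-z) * R z = 1 := by rw [← hR.map_add, neg_add_cancel, hR.map_zero]
        have hinv' : R z * R (-z) = 1 := by rw [← hR.map_add, add_neg_cancel, hR.map_zero]
        exact (Commute.units_inv_left (u := ⟨R z, R (-z), hinv', hinv⟩) hz :) }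
  have hz : z = z.1 • ((1, 0) : ℤ × ℤ) + z.2 • ((0, 1) : ℤ × ℤ) := by ext <;> simp
  rw [hz]
  exact commuting.add_mem (commuting.zsmul_mem h₁ _) (commuting.zsmul_mem h₂ _)

theorem sub_apply_eq_zero_iff_mul_apply_eq {H : Type*} [NormedAddCommGroup H]
    [InnerProductSpace ℂ H] {A B B' : H →L[ℂ] H} (hB : B' * B = 1) (hB' : B * B' = 1) (x : H) :
    (A - B) x = 0 ↔ (B' * A) x = x := by
  rw [_root_.sub_apply, sub_eq_zero, mul_apply_eq_comp]
  constructor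
  · intro h
    rw [h]
    exact DFunLike.congr_fun hB x
  · intro h
    conv_rhs => rw [← h]
    exact (DFunLike.congr_fun hB' (A x)).symm

end Z2Spectral

namespace Z2Action

open Z2Spectral

section Factor

variable {ι : Type*} [Fintype ι] [DecidableEq ι] {Y : ι → Type*} [∀ i, MeasurableSpace (Y i)]
  {ν : ∀ i, Measure (Y i)} [∀ i, IsProbabilityMeasure (ν i)] (S : ∀ i, Z2Action (Y i) (ν i))

/-- The Koopman operators of the action of `S i` on the coordinate `i` of the product. -/
noncomputable def koopmanAt (i : ι) (z : ℤ × ℤ) :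
    Lp ℂ 2 (Measure.pi ν) →L[ℂ] Lp ℂ 2 (Measure.pi ν) :=
  koopAt ((S i).measurePreserving z)

theorem actsAt_koopmanAt (i : ι) (z : ℤ × ℤ) :
    ActsAt (piTensor ν) i (koopmanAt S i z) ((S i).koopman z) :=
  actsAt_koopAt _

theorem isUnitaryRep_koopmanAt (i : ι) : IsUnitaryRep (koopmanAt S i) where
  map_zero := isHilbertTensor_piTensor.actsAt_unique
    ((S i).isUnitaryRep.map_zero ▸ actsAt_koopmanAt S i 0) (ActsAt.one i)
  map_add z w := isHilbertTensor_piTensor.actsAt_unique (actsAt_koopmanAt S i (z + w))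
    ((S i).isUnitaryRep.map_add z w ▸ (actsAt_koopmanAt S i z).mul (actsAt_koopmanAt S i w))
  star_eq z := star_koopAt _ _ ((S i).leftInverse_map_neg z)

theorem isTensor_koopmanAt (i : ι) (z : ℤ × ℤ) :
    IsTensor (piTensor ν) (koopmanAt S i z) fun j => (S j).koopman (if j = i then z else 0) := by
  intro f
  rw [actsAt_koopmanAt]
  congr 1
  ext1 j
  obtain rfl | hj := eq_or_ne j i
  · simp only [Function.update_self, if_pos]
  · beta_reduce
    rw [Function.update_of_ne hj, if_neg hj, (S j).isUnitaryRep.map_zero, one_apply_eq_self]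

end Factor

section SquareFactor

variable {ι : Type*} [Fintype ι] [DecidableEq ι] {X : ι → Type*} [∀ i, MeasurableSpace (X i)]
  {μ : ∀ i, Measure (X i)} [∀ i, IsProbabilityMeasure (μ i)] (T : ∀ i, Z2Action (X i) (μ i))

theorem exists_actsAt_dilateSquare (i : ι) (z₀ : ℤ × ℤ) (r : ℝ) :
    ∃ S, ActsAt (piTensor fun i => (μ i).prod (μ i)) i S ((T i).dilateSquare z₀ r) :=
  ⟨_, ((actsAt_fixProj_koopAt _).dilate r).mul ((actsAt_fixProj_koopAt _).dilate r)⟩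

theorem commute_koopmanAt_of_weakLimit
    {z₀ : ℤ × ℤ} (hT : ∀ i, fixedSpace ((T i).koopman z₀) = L2.constants (μ i))
    {i : ι} {z : ℤ × ℤ} {w : ℕ → ℤ × ℤ} {a : ι → ℝ} (ha : ∀ j, 0 < a j)
    (hi : WeakLimit (fun n => (T i).koopman (w n))
      ((a i : ℂ) • (T i).koopman z + (1 - (a i : ℂ)) • L2.Theta (μ i)))
    (hj : ∀ j, j ≠ i → WeakLimit (fun n => (T j).koopman (w n))
      ((a j : ℂ) • ContinuousLinearMap.id ℂ (Lp ℂ 2 (μ j)) +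
        (1 - (a j : ℂ)) • L2.Theta (μ j)))
    {B : Lp ℂ 2 (Measure.pi fun i => (μ i).prod (μ i)) →L[ℂ]
      Lp ℂ 2 (Measure.pi fun i => (μ i).prod (μ i))}
    (hB : B ∈ commutant (Z2Action.pi fun i => (T i).square).koopman) :
    Commute (koopmanAt (fun i => (T i).square) i z) B := by
  have hlim (j : ι) : WeakLimit (fun n => (T j).koopman (w n))
      ((a j : ℂ) • (T j).koopman (if j = i then z else 0) +
        (1 - (a j : ℂ)) • L2.Theta (μ j)) := by
    obtain rfl | hji := eq_or_ne j i
    · rwa [if_pos rfl]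
    · rw [if_neg hji, (T j).isUnitaryRep.map_zero]
      exact hj j hji
  have hinv (j : ι) : (T j).dilateSquare z₀ (√(a j))⁻¹ * (T j).dilateSquare z₀ √(a j) = 1 := by
    rw [dilateSquare_mul (hT j), inv_mul_cancel₀ (Real.sqrt_ne_zero'.2 (ha j)), dilateSquare_one]
  exact isHilbertTensor_piTensor.commute_of_weakLimit (Z2Action.isUnitaryRep _)
    (fun j => (T j).square.isUnitaryRep) (isTensor_pi _)
    (fun j => exists_actsAt_dilateSquare T j z₀ _) (fun j => exists_actsAt_dilateSquare T j z₀ _)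
    (fun j => star_dilateSquare (hT j) _) hinv (fun j => commute_dilateSquare_square (hT j) _ _)
    (fun j => weakLimit_square (hT j) (ha j) (hlim j))
    (isTensor_koopmanAt (fun i => (T i).square) i z) hB

/-- The Koopman operators of the action of `T i` on the first entry of the coordinate `i`. -/
noncomputable def koopFstAt (i : ι) (z : ℤ × ℤ) :
    Lp ℂ 2 (Measure.pi fun i => (μ i).prod (μ i)) →L[ℂ]
      Lp ℂ 2 (Measure.pi fun i => (μ i).prod (μ i)) :=
  koopAt (((T i).measurePreserving z).prod (MeasurePreserving.id (μ i)))

/-- The Koopman operators of the action of `T i` on the second entry of the coordinate `i`. -/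
noncomputable def koopSndAt (i : ι) (z : ℤ × ℤ) :
    Lp ℂ 2 (Measure.pi fun i => (μ i).prod (μ i)) →L[ℂ]
      Lp ℂ 2 (Measure.pi fun i => (μ i).prod (μ i)) :=
  koopAt ((MeasurePreserving.id (μ i)).prod ((T i).measurePreserving z))

theorem actsAt_koopFstAt (i : ι) (z : ℤ × ℤ) :
    ActsAt (piTensor fun i => (μ i).prod (μ i)) i (koopFstAt T i z) ((T i).koopFst z) :=
  actsAt_koopAt _

theorem actsAt_koopSndAt (i : ι) (z : ℤ × ℤ) :
    ActsAt (piTensor fun i => (μ i).prod (μ i)) i (koopSndAt T i z) ((T i).koopSnd z) :=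
  actsAt_koopAt _

theorem commute_koopFstAt_koopSndAt (i : ι) (z w : ℤ × ℤ) :
    Commute (koopFstAt T i z) (koopSndAt T i w) :=
  isHilbertTensor_piTensor.actsAt_comm (actsAt_koopFstAt T i z) (actsAt_koopSndAt T i w)
    ((T i).commute_koopFst_koopSnd z w)

theorem star_koopFstAt (i : ι) (z : ℤ × ℤ) : star (koopFstAt T i z) = koopFstAt T i (-z) :=
  isHilbertTensor_piTensor.actsAt_star (actsAt_koopFstAt T i z)
    ((T i).star_koopFst z ▸ actsAt_koopFstAt T i (-z))

theorem star_koopSndAt (i : ι) (z : ℤ × ℤ) : star (koopSndAt T i z) = koopSndAt T i (-z) :=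
  isHilbertTensor_piTensor.actsAt_star (actsAt_koopSndAt T i z)
    ((T i).star_koopSnd z ▸ actsAt_koopSndAt T i (-z))

theorem koopFstAt_mul_neg (i : ι) (z : ℤ × ℤ) : koopFstAt T i z * koopFstAt T i (-z) = 1 :=
  koopAt_mul_eq_one _ _ fun x => Prod.ext ((T i).leftInverse_map_neg z x.1) rfl

theorem koopFstAt_neg_mul_self (i : ι) (z : ℤ × ℤ) : koopFstAt T i (-z) * koopFstAt T i z = 1 := by
  simpa only [neg_neg] using koopFstAt_mul_neg T i (-z)

theorem koopSndAt_mul_neg (i : ι) (z : ℤ × ℤ) : koopSndAt T i z * koopSndAt T i (-z) = 1 :=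
  koopAt_mul_eq_one _ _ fun x => Prod.ext rfl ((T i).leftInverse_map_neg z x.2)

theorem koopSndAt_neg_mul_self (i : ι) (z : ℤ × ℤ) : koopSndAt T i (-z) * koopSndAt T i z = 1 := by
  simpa only [neg_neg] using koopSndAt_mul_neg T i (-z)

theorem fixProj_koopSndAt_neg_mul_koopFstAt {i : ι} {z : ℤ × ℤ}
    (hQ : fixedSpace ((T i).square.koopman z) = L2.constants ((μ i).prod (μ i))) :
    fixProj (koopSndAt T i (-z) * koopFstAt T i z) =
      fixProj (koopmanAt (fun i => (T i).square) i z) := by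
  have hfix : fixedSpace ((T i).koopSnd (-z) * (T i).koopFst z) =
      L2.constants ((μ i).prod (μ i)) := by
    rw [koopSnd_mul_koopFst]
    exact fixedSpace_koop_prodMap_inv ((T i).measurePreserving z)
      ((T i).measurePreserving (-z)) ((T i).leftInverse_map_neg z) hQ
  have hnorm : ‖koopSndAt T i (-z) * koopFstAt T i z‖ ≤ 1 := (norm_mul_le _ _).trans
    (mul_le_one₀ (norm_koopAt_le _) (norm_nonneg _) (norm_koopAt_le _))
  have hacts := isHilbertTensor_piTensor.actsAt_fixProj
    ((actsAt_koopSndAt T i (-z)).mul (actsAt_koopFstAt T i z)) hnorm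
    (koopSnd_mul_koopFst (T i) z (-z) ▸ norm_koop_le _)
  refine isHilbertTensor_piTensor.actsAt_unique hacts ?_
  rw [fixProj_eq_Theta hfix, ← fixProj_eq_Theta hQ]
  exact actsAt_fixProj_koopAt _

theorem koopFstAt_sub_koopSndAt_apply_eq_zero_iff {i : ι} {z : ℤ × ℤ}
    (hQ : fixedSpace ((T i).square.koopman z) = L2.constants ((μ i).prod (μ i)))
    (x : Lp ℂ 2 (Measure.pi fun i => (μ i).prod (μ i))) :
    (koopFstAt T i z - koopSndAt T i z) x = 0 ↔ koopmanAt (fun i => (T i).square) i z x = x := by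
  rw [sub_apply_eq_zero_iff_mul_apply_eq (koopSndAt_neg_mul_self T i z) (koopSndAt_mul_neg T i z),
    ← fixProj_apply_eq_self, fixProj_koopSndAt_neg_mul_koopFstAt T hQ, fixProj_apply_eq_self]

theorem star_koopFstAt_sub_koopSndAt_apply_eq_zero_iff {i : ι} {z : ℤ × ℤ}
    (hQ : fixedSpace ((T i).square.koopman z) = L2.constants ((μ i).prod (μ i)))
    (x : Lp ℂ 2 (Measure.pi fun i => (μ i).prod (μ i))) :
    star (koopFstAt T i z - koopSndAt T i z) x = 0 ↔
      koopmanAt (fun i => (T i).square) i z x = x := by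
  rw [star_sub, star_koopFstAt, star_koopSndAt, ← neg_sub, _root_.neg_apply, neg_eq_zero,
    sub_apply_eq_zero_iff_mul_apply_eq (koopFstAt_mul_neg T i z) (koopFstAt_neg_mul_self T i z),
    (commute_koopFstAt_koopSndAt T i z (-z)).eq, ← fixProj_apply_eq_self,
    fixProj_koopSndAt_neg_mul_koopFstAt T hQ, fixProj_apply_eq_self]

/-- The square system of the product of the actions `T i × T i`. -/
noncomputable def squareSystem {z₀ : ℤ × ℤ}
    (hQ : ∀ i, fixedSpace ((T i).square.koopman z₀) = L2.constants ((μ i).prod (μ i)))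
    (hcomm : ∀ i, ∀ B ∈ commutant (Z2Action.pi fun i => (T i).square).koopman,
      Commute (koopmanAt (fun i => (T i).square) i (1, 0)) B ∧
        Commute (koopmanAt (fun i => (T i).square) i (0, 1)) B) :
    SquareSystem (piTensor fun i => (μ i).prod (μ i)) (fun i => (T i).square.koopman) z₀
      (fun i => oneL2 ((μ i).prod (μ i))) (fun i => koopSwap (μ i))
      (Z2Action.pi fun i => (T i).square).koopman where
  rep := koopmanAt fun i => (T i).square
  swap i := koopAt (Measure.measurePreserving_swap (μ := μ i) (ν := μ i))
  diff i := koopFstAt T i z₀ - koopSndAt T i z₀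
  isHilbertTensor := isHilbertTensor_piTensor
  isUnitaryRep := Z2Action.isUnitaryRep _
  isUnitaryRep_factor i := (T i).square.isUnitaryRep
  isTensor := isTensor_pi _
  norm_unit i := norm_oneL2 _
  map_unit i z := koop_oneL2 ((T i).square.measurePreserving z)
  fixedSpace_factor := hQ
  actsAt_rep := actsAt_koopmanAt _
  norm_rep_le i := (isUnitaryRep_koopmanAt _ i).norm_le_one
  commute_rep i z B hB :=
    (isUnitaryRep_koopmanAt _ i).commute_of_commute_basis (hcomm i B hB).1 (hcomm i B hB).2 z
  actsAt_swap i := actsAt_koopAt _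
  involution_mul_self i := koopSwap_mul_koopSwap
  star_involution i := star_koopSwap
  involution_unit i := koop_oneL2 _
  commute_involution i := (T i).commute_koopSwap_square
  actsAt_diff i := ⟨_, (actsAt_koopFstAt T i z₀).sub (actsAt_koopSndAt T i z₀),
    fun z => ((T i).commute_koopFst_square _ z).sub_left ((T i).commute_koopSnd_square _ z),
    by rw [mul_sub, koopSwap_mul_koopFst, koopSwap_mul_koopSnd, sub_mul, neg_sub]⟩
  diff_eq_zero i := koopFstAt_sub_koopSndAt_apply_eq_zero_iff T (hQ i)
  star_diff_eq_zero i := star_koopFstAt_sub_koopSndAt_apply_eq_zero_iff T (hQ i)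

end SquareFactor

end Z2Action

open Z2Spectral L2

theorem mainTheorem3_general {ι : Type*} [Fintype ι] (X : ι → Type*)
    [∀ i, MeasurableSpace (X i)] [∀ i, MeasurableSpace.CountablySeparated (X i)]
    (μ : ∀ i, Measure (X i)) [∀ i, IsProbabilityMeasure (μ i)] [∀ i, NullSingletonClass (μ i)]
    (T : ∀ i, Z2Action (X i) (μ i))
    {z₀ : ℤ × ℤ} (herg : Ergodic ((Z2Action.pi fun i => (T i).square).map z₀)
      (Measure.pi fun i => (μ i).prod (μ i)))
    (hsimple : ∀ i, (T i).SymmetricSquareSimple)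
    (hw : ∀ i, ∃ (w : ℕ → ℤ × ℤ) (a : ι → ℝ), (∀ j, 0 < a j) ∧
      WeakLimit (fun n => (T i).koopman (w n))
        ((a i : ℂ) • (T i).koopman (1, 0) + (1 - (a i : ℂ)) • Theta (μ i)) ∧
      ∀ j, j ≠ i → WeakLimit (fun n => (T j).koopman (w n))
        ((a j : ℂ) • ContinuousLinearMap.id ℂ (Lp ℂ 2 (μ j)) +
          (1 - (a j : ℂ)) • Theta (μ j)))
    (hu : ∀ i, ∃ (u : ℕ → ℤ × ℤ) (b : ι → ℝ), (∀ j, 0 < b j) ∧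
      WeakLimit (fun n => (T i).koopman (u n))
        ((b i : ℂ) • (T i).koopman (0, 1) + (1 - (b i : ℂ)) • Theta (μ i)) ∧
      ∀ j, j ≠ i → WeakLimit (fun n => (T j).koopman (u n))
        ((b j : ℂ) • ContinuousLinearMap.id ℂ (Lp ℂ 2 (μ j)) +
          (1 - (b j : ℂ)) • Theta (μ j))) :
    (Z2Action.pi fun i => (T i).square).spectralMultiplicities =
      (fun j : ℕ => (2 : ℕ∞) ^ j) '' Set.Icc 1 (Fintype.card ι) := by
  classical
  have hQ : ∀ i, fixedSpace ((T i).square.koopman z₀) = constants ((μ i).prod (μ i)) :=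
    Z2Action.fixedSpace_koopman_of_ergodic_pi (fun i => (T i).square) herg
  have hT (i : ι) : fixedSpace ((T i).koopman z₀) = constants (μ i) :=
    Z2Action.fixedSpace_koopman_of_square (hQ i)
  let S := Z2Action.squareSystem T hQ fun i B hB => by
    obtain ⟨w, a, ha, hwi, hwj⟩ := hw i
    obtain ⟨u, b, hb, hui, huj⟩ := hu i
    exact ⟨Z2Action.commute_koopmanAt_of_weakLimit T hT ha hwi hwj hB,
      Z2Action.commute_koopmanAt_of_weakLimit T hT hb hui huj hB⟩
  have hmult := S.multiplicities_eq hsimple fun i => exists_ne_zero_inner_oneL2_prod_eq_zero (μ i)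
  rw [piTensor_oneL2] at hmult
  exact hmult

theorem mainTheorem3 (k : ℕ) (X : Fin k → Type*)
    [∀ i, MeasurableSpace (X i)] [∀ i, StandardBorelSpace (X i)]
    (μ : ∀ i, Measure (X i)) [∀ i, IsProbabilityMeasure (μ i)] [∀ i, NullSingletonClass (μ i)]
    (T : ∀ i, Z2Action (X i) (μ i))
    (herg : (Z2Action.pi fun i => (T i).square).TotallyErgodic)
    (hsimple : ∀ i, (T i).SymmetricSquareSimple)
    (hw : ∀ i, ∃ (w : ℕ → ℤ × ℤ) (a : Fin k → ℝ), (∀ j, 0 < a j) ∧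
      Z2Spectral.WeakLimit (fun n => (T i).koopman (w n))
        ((a i : ℂ) • (T i).koopman (1, 0) + (1 - (a i : ℂ)) • L2.Theta (μ i)) ∧
      ∀ j, j ≠ i → Z2Spectral.WeakLimit (fun n => (T j).koopman (w n))
        ((a j : ℂ) • ContinuousLinearMap.id ℂ (Lp ℂ 2 (μ j)) +
          (1 - (a j : ℂ)) • L2.Theta (μ j)))
    (hu : ∀ i, ∃ (u : ℕ → ℤ × ℤ) (b : Fin k → ℝ), (∀ j, 0 < b j) ∧
      Z2Spectral.WeakLimit (fun n => (T i).koopman (u n))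
        ((b i : ℂ) • (T i).koopman (0, 1) + (1 - (b i : ℂ)) • L2.Theta (μ i)) ∧
      ∀ j, j ≠ i → Z2Spectral.WeakLimit (fun n => (T j).koopman (u n))
        ((b j : ℂ) • ContinuousLinearMap.id ℂ (Lp ℂ 2 (μ j)) +
          (1 - (b j : ℂ)) • L2.Theta (μ j))) :
    (Z2Action.pi fun i => (T i).square).spectralMultiplicities =
      (fun j : ℕ => (2 : ℕ∞) ^ j) '' Set.Icc 1 k := by
  rw [mainTheorem3_general X μ T (herg (1, 0) (by simp)) hsimple hw hu, Fintype.card_fin]
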